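/- **Conventions.** The two players are $\mathsf P$ (Player) and $\mathsf O$ (Opponent), $\mathsf P^\bot=\mathsf O$, $\mathsf O^\bot=\mathsf P$. Moves are $\mathrm{DROP}(n)$, $\mathrm{EM}(i,j)$, $\mathrm{STOP}(i)$, $\mathrm{JUST}(i,n)$, $\mathrm{nth}(n)$ with $i,j,n\in\mathbb N$, coded by natural numbers; they are ordered by their codes. $\mathrm{Par}$ is a countable set of parameters, coded by natural numbers, with an involution $a\mapsto a^\bot$ without fixed points. $I\subseteq\mathrm{Par}$ is *self-dual* if $I^\bot=I$. A *parametric game* $G$ consists of: a set $|G|$ of finite lists of moves (positions) containing the empty list $\langle\rangle$ and closed under prefixes; for each position that is not a leaf, the player who moves there; for each leaf a label in $\{\mathsf P,\mathsf O\}\cup\mathrm{Par}$; and a partition $(G_{\mathsf P},G_{\mathsf O})$ of the infinite branches of $|G|$. Its *finitary part* consists of $|G|$, the map giving the number of children (possibly $\omega$) of a position, the map giving the $n$-th child of a position, the turn map and the label map. $G$ is *atomic* if $|G|=\{\langle\rangle\}$; $\mathrm{END}(x)$ is the atomic game with label $x$. $G_{\langle m\rangle}$ is the sub-game after the initial move $m$.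 $\mathrm{FV}(G)$ is the smallest self-dual set containing all parameters that label leaves of $G$, and $\mathrm{FV}(G_0,\dots,G_{n-1})=\bigcup_i\mathrm{FV}(G_i)$. A *strategy* on $G$ is a set $\sigma\subseteq|G|$ containing $\langle\rangle$ and closed under prefixes. It is *$g$-winning* if at every position of $\sigma$ where $g^\bot$ moves it contains all children in $|G|$, at every position of $\sigma$ where $g$ moves it contains some child, every leaf of $G$ in $\sigma$ has label $g$, and every infinite branch of $\sigma$ is in $G_g$. $G$ is *determined* if it has a $g$-winning strategy for some $g$. For self-dual $I$, an *$I$-assignment* is a map $\eta:I\to\{\mathsf P,\mathsf O\}$ with $\eta(a^\bot)=\eta(a)^\bot$. A *$G$-assignment* is a $J$-assignment for some self-dual $J\supseteq\mathrm{FV}(G)$. For a $J$-assignment $\rho$, $\rho(G)$ is $G$ with each label $a\in J$ replaced by $\rho(a)$; $(\rho,\eta)$ is the $J\cup I$-assignment equal to $\eta$ on $I$ and to $\rho$ on $J\setminus I$. **The game $\forall I.\Gamma$.** Let $\Gamma=(G_0,\dots,G_{n-1})$ be a finite list ($n\ge 0$) of parametric games and $I$ a self-dual set of parameters. At every stage of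 $\forall I.\Gamma$ there is a list $G_0,\dots,G_{q-1}$ of local positions, at first $\Gamma$. $\mathsf P$ plays one of: $\mathrm{DROP}(q)$, and $\mathsf O$ wins; $\mathrm{EM}(i,j)$, where $G_i=\mathrm{END}(a)$, $G_j=\mathrm{END}(a^\bot)$ for some $a\in I$, and $\mathsf P$ wins; $\mathrm{STOP}(i)$, where $G_i=\mathrm{END}(x)$ with $x\in\{\mathsf P,\mathsf O\}\cup(\mathrm{FV}(\Gamma)\setminus I)$, and the play ends in a leaf with label $x$; or $\mathrm{JUST}(i,q)$, where $G_i$ is not atomic, after which the first player of $G_i$ plays an initial move $m$ of $G_i$, and $G_q=(G_i)_{\langle m\rangle}$ is added to the list; one then writes $i\vdash_m q$. An infinite play is won by $\mathsf P$ if, for some $i<n$, there are a chain $i=i_0\vdash_{m_0}i_1\vdash_{m_1}\cdots$ in it, and $\langle m_0,m_1,\dots\rangle\in(G_i)_{\mathsf P}$; otherwise it is won by $\mathsf O$. **The strategy $\mathrm{EXH}$** for $\forall I.\Gamma$ plays as follows, with state $(i,p,q,\vdash)$, where $q$ is the number of local positions and $\vdash$ the justification relation so far; the initial state is $(0,n,n,\emptyset)$.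 If $i=p<q$, pass to $(0,q,q,\vdash)$. If $i=p=q$, play $\mathrm{DROP}(q)$. If $i<p$: (1) if $G_i=\mathrm{END}(a)$ with $a\in I$ and there is a first $j<p$ with $G_j=\mathrm{END}(a^\bot)$, play $\mathrm{EM}(i,j)$; (2) if $G_i=\mathrm{END}(\mathsf P)$, play $\mathrm{STOP}(i)$; (3) if $G_i$ is atomic otherwise, pass to $(i+1,p,q,\vdash)$; (4) if $G_i$ is not atomic and $\mathsf P$ moves first in it, let $m$ be the first initial move of $G_i$ with $i\vdash_m k$ for no $k$; if it exists, play $\mathrm{JUST}(i,q)$ and then $m$, and pass to $(i+1,p,q+1,\vdash\cup\{(i,m,q)\})$, otherwise pass to $(i+1,p,q,\vdash)$; (5) if $G_i$ is not atomic and $\mathsf O$ moves first in it, then, if $i\vdash_m k$ for no $m,k$, play $\mathrm{JUST}(i,q)$, and after any answer $m$ of $\mathsf O$ pass to $(i+1,p,q+1,\vdash\cup\{(i,m,q)\})$, otherwise pass to $(i+1,p,q,\vdash)$. **Theorem.** Let $\Gamma=(G_0,\dots,G_{n-1})$ be parametric games, $I\subseteq\mathrm{Par}$ self-dual, $G=\forall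 I.\Gamma$, and $\rho$ any $G$-assignment. Let $\rho'$ be the restriction of $\rho$ to $\mathrm{FV}(G)$, so that $\rho(G)=\forall I.(\rho'(G_0),\dots,\rho'(G_{n-1}))$, and let $\mathrm{EXH}$ be the strategy above for this game. 1. The game $\rho(G)$ is determined. 2. If for all $I$-assignments $\eta$ the games $(\rho,\eta)(G_0),\dots,(\rho,\eta)(G_{n-1})$ are determined, then the following are equivalent: (a) there is a $\mathsf P$-winning strategy for $\rho(G)$; (b) $\mathrm{EXH}$ is a $\mathsf P$-winning strategy for $\rho(G)$, and it is primitive recursive relative to the finitary parts of $\rho'(G_0),\dots,\rho'(G_{n-1})$ and to the map $a\mapsto a^\bot$ on $\mathrm{Par}$ (in particular, $\mathrm{EXH}$ is primitive recursive if all of these are); (c) for every $I$-assignment $\eta$ there are $i<n$ and a $\mathsf P$-winning strategy for $(\rho,\eta)(G_i)$. -/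

import Mathlib

noncomputable section

namespace ParamGame

/-- The two players. -/
inductive Player where
  | player
  | opponent
  deriving DecidableEq

/-- The player opposed to `g`. -/
def Player.dual : Player → Player
  | .player => .opponent
  | .opponent => .player

/-- Players are coded by booleans. -/
def Player.equivBool : Player ≃ Bool where
  toFun
    | .player => true
    | .opponent => false
  invFun
    | true => .player
    | false => .opponent
  left_inv := by rintro (_ | _) <;> rfl
  right_inv := by rintro (_ | _) <;> rfl

instance : Primcodable Player := Primcodable.ofEquiv Bool Player.equivBool

/-- The moves, given by five constructors. -/
inductive Move where
  | dropAt (n : ℕ)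
  | em (i j : ℕ)
  | stopAt (i : ℕ)
  | just (i n : ℕ)
  | nth (n : ℕ)
  deriving DecidableEq

/-- Moves as a disjoint sum; this fixes the numerical coding of moves. -/
def Move.equivSum : Move ≃ ℕ ⊕ (ℕ × ℕ) ⊕ ℕ ⊕ (ℕ × ℕ) ⊕ ℕ where
  toFun
    | .dropAt n => .inl n
    | .em i j => .inr (.inl (i, j))
    | .stopAt i => .inr (.inr (.inl i))
    | .just i n => .inr (.inr (.inr (.inl (i, n))))
    | .nth n => .inr (.inr (.inr (.inr n)))
  invFun
    | .inl n => .dropAt n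
    | .inr (.inl (i, j)) => .em i j
    | .inr (.inr (.inl i)) => .stopAt i
    | .inr (.inr (.inr (.inl (i, n)))) => .just i n
    | .inr (.inr (.inr (.inr n))) => .nth n
  left_inv := by rintro (_ | _ | _ | _ | _) <;> rfl
  right_inv := by rintro (_ | _ | _ | _ | _) <;> rfl

instance : Primcodable Move :=
  Primcodable.ofEquiv (ℕ ⊕ (ℕ × ℕ) ⊕ ℕ ⊕ (ℕ × ℕ) ⊕ ℕ) Move.equivSum

/-! ### Trees of finite lists of moves -/

/-- A tree support: a set of finite lists containing `[]` and closed under prefix. -/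
def IsTreeSupport (T : Set (List Move)) : Prop :=
  [] ∈ T ∧ ∀ x y : List Move, x <+: y → y ∈ T → x ∈ T

/-- The infinite branches of `T`. -/
def branches (T : Set (List Move)) : Set (Stream' Move) :=
  {p | ∀ k, p.take k ∈ T}

/-- The leaves of `T`. -/
def leaves (T : Set (List Move)) : Set (List Move) :=
  {x | x ∈ T ∧ ∀ m, x ++ [m] ∉ T}

open Classical in
/-- The number of children of a node; `none` stands for `ω`. -/
def numChildren (T : Set (List Move)) (x : List Move) : Option ℕ :=
  if {m | x ++ [m] ∈ T}.Finite then some {m | x ++ [m] ∈ T}.ncard else none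

/-- `m` is the index of the `n`-th child of `x` (counting from `0`, in the order of the codes). -/
def IsNthChild (T : Set (List Move)) (x : List Move) (n : ℕ) (m : Move) : Prop :=
  x ++ [m] ∈ T ∧
    {m' | x ++ [m'] ∈ T ∧ Encodable.encode m' < Encodable.encode m}.ncard = n

open Classical in
/-- The `n`-th child of `x`, and `[]` if there is none. -/
def nthChild (T : Set (List Move)) (x : List Move) (n : ℕ) : List Move :=
  if h : ∃ m, IsNthChild T x n m then x ++ [h.choose] else []

/-! ### Parameters and parametric games -/

/-- An involution without fixed points on the set of parameters. -/
class ParamDual (Par : Type*) where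
  dual : Par → Par
  dual_dual : ∀ a, dual (dual a) = a
  dual_ne : ∀ a, dual a ≠ a

variable {Par : Type*}

/-- Self-dual sets of parameters. -/
def SelfDual [ParamDual Par] (I : Set Par) : Prop :=
  ParamDual.dual '' I = I

/-- A parametric game. The values of `turn` outside the non-leaves and of `label` outside the
leaves are irrelevant. -/
structure Game (Par : Type*) where
  positions : Set (List Move)
  isTreeSupport : IsTreeSupport positions
  turn : List Move → Player
  label : List Move → Player ⊕ Par
  won : Player → Set (Stream' Move)
  won_union : won .player ∪ won .opponent = branches positions
  won_disjoint : Disjoint (won .player) (won .opponent)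

namespace Game

/-- The set of parameters of `G`: the smallest self-dual set containing all parameters which label
some leaf of `G`. -/
def FV [ParamDual Par] (G : Game Par) : Set Par :=
  {a | ∃ x ∈ leaves G.positions, G.label x = .inr a} ∪
    ParamDual.dual '' {a | ∃ x ∈ leaves G.positions, G.label x = .inr a}

/-- `G` is atomic: its tree has only one node. -/
def IsAtomic (G : Game Par) : Prop := G.positions = {[]}

/-- `G` is the atomic game `END(x)`. -/
def IsEnd (G : Game Par) (x : Player ⊕ Par) : Prop := G.IsAtomic ∧ G.label [] = x

theorem mem_branches_append {T : Set (List Move)} (hT : IsTreeSupport T) (x : List Move)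
    (p : Stream' Move) : (x ++ₛ p) ∈ branches T ↔ ∀ k, x ++ p.take k ∈ T := by
  constructor
  · intro h k
    rw [Stream'.append_take]
    exact h _
  · intro h k
    refine hT.2 _ _ ?_ (h k)
    rw [Stream'.append_take]
    exact Stream'.take_prefix_take_left _ _ _ (Nat.le_add_left _ _)

/-- The sub-game of `G` of root `x`. -/
def sub (G : Game Par) (x : List Move) (hx : x ∈ G.positions) : Game Par where
  positions := {y | x ++ y ∈ G.positions}
  isTreeSupport := by
    refine ⟨by simpa using hx, fun y z hyz hz => G.isTreeSupport.2 _ _ ?_ hz⟩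
    exact (List.prefix_append_right_inj x).2 hyz
  turn y := G.turn (x ++ y)
  label y := G.label (x ++ y)
  won g := {p | (x ++ₛ p) ∈ G.won g}
  won_union := by
    ext p
    have h := Set.ext_iff.1 G.won_union (x ++ₛ p)
    rw [mem_branches_append G.isTreeSupport] at h
    exact h
  won_disjoint := by
    rw [Set.disjoint_left]
    intro p h1 h2
    exact Set.disjoint_left.1 G.won_disjoint h1 h2

/-! ### Strategies -/

/-- `σ` is a strategy on `G`. -/
def IsStrategy (G : Game Par) (σ : Set (List Move)) : Prop :=
  IsTreeSupport σ ∧ σ ⊆ G.positions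

/-- `σ` is a `g`-strategy: it considers all moves of the opponent of `g`. -/
def IsStrategyFor (G : Game Par) (g : Player) (σ : Set (List Move)) : Prop :=
  G.IsStrategy σ ∧
    ∀ p ∈ σ, G.turn p = g.dual → ∀ m, p ++ [m] ∈ G.positions → p ++ [m] ∈ σ

/-- `σ` is `g`-total. -/
def IsTotal (G : Game Par) (g : Player) (σ : Set (List Move)) : Prop :=
  G.IsStrategyFor g σ ∧
    ∀ p ∈ σ, p ∉ leaves G.positions → G.turn p = g → ∃ m, p ++ [m] ∈ σ

/-- `σ` is `g`-partially winning. -/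
def IsPartiallyWinning (G : Game Par) (g : Player) (σ : Set (List Move)) : Prop :=
  G.IsTotal g σ ∧ ∀ p ∈ σ, p ∈ leaves G.positions → G.label p = .inl g

/-- `σ` is `g`-winning. -/
def IsWinning (G : Game Par) (g : Player) (σ : Set (List Move)) : Prop :=
  G.IsPartiallyWinning g σ ∧ branches σ ⊆ G.won g

/-- `G` is determined. -/
def Determined (G : Game Par) : Prop := ∃ g σ, G.IsWinning g σ

end Game

/-! ### Assignments -/

/-- `ρ`, a partial map from parameters to players, is an `I`-assignment: its domain is `I` and it
preserves duality. -/
def IsAssignment [ParamDual Par] (I : Set Par) (ρ : Par → Option Player) : Prop :=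
  (∀ a, (ρ a).isSome ↔ a ∈ I) ∧
    ∀ a ∈ I, ρ (ParamDual.dual a) = (ρ a).map Player.dual

/-- `ρ` is a `G`-assignment: an `I`-assignment for some self-dual `I` containing the parameters
of `G`. -/
def IsGameAssignment [ParamDual Par] (G : Game Par) (ρ : Par → Option Player) : Prop :=
  ∃ I, SelfDual I ∧ G.FV ⊆ I ∧ IsAssignment I ρ

/-- The over-writing `(ρ, η)`: it is `η` on the domain of `η`, and `ρ` elsewhere. -/
def overwrite (ρ η : Par → Option Player) : Par → Option Player :=
  fun a => (η a).or (ρ a)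

open Classical in
/-- The restriction of a partial map to `S`. -/
def restrict (ρ : Par → Option Player) (S : Set Par) : Par → Option Player :=
  fun a => if a ∈ S then ρ a else none

/-- The action of a partial map on labels; labels outside the domain are left unchanged. -/
def assignLabel (ρ : Par → Option Player) : Player ⊕ Par → Player ⊕ Par
  | .inl g => .inl g
  | .inr a => match ρ a with
    | some g => .inl g
    | none => .inr a

/-- The game `ρ(G)`: each parameter in the domain of `ρ` is replaced by its value. -/
def Game.assign (G : Game Par) (ρ : Par → Option Player) : Game Par :=
  { G with label := fun x => assignLabel ρ (G.label x) }

/-! ### The game `∀I.Γ` -/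

/-- The parameters of a sequent of games. -/
def sequentFV [ParamDual Par] (Γ : List (Game Par)) : Set Par := {a | ∃ G ∈ Γ, a ∈ G.FV}

open Classical in
/-- The local positions reached from the local positions `L` by a play
`⟨JUST(i₀,n), m₀, JUST(i₁,n+1), m₁, …⟩`, possibly followed by one more move. -/
def localPositions (L : List (Game Par)) : List Move → List (Game Par)
  | .just i _ :: m :: p =>
    match L[i]? with
    | some H => if h : [m] ∈ H.positions then localPositions (L ++ [H.sub [m] h]) p else L
    | none => L
  | _ => L

/-- The positions of `∀I.Γ`. If `p` has length `2k`, then `(localPositions Γ p).length` is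
`n + k`. -/
inductive ForallPos [ParamDual Par] (I : Set Par) (Γ : List (Game Par)) : List Move → Prop
  | nil : ForallPos I Γ []
  | dropAt {p : List Move} : ForallPos I Γ p → Even p.length →
      ForallPos I Γ (p ++ [.dropAt (localPositions Γ p).length])
  | em {p : List Move} {i j : ℕ} {H K : Game Par} {a : Par} : ForallPos I Γ p → Even p.length →
      (localPositions Γ p)[i]? = some H → (localPositions Γ p)[j]? = some K →
      a ∈ I → H.IsEnd (.inr a) → K.IsEnd (.inr (ParamDual.dual a)) →
      ForallPos I Γ (p ++ [.em i j])
  | stopAt {p : List Move} {i : ℕ} {H : Game Par} : ForallPos I Γ p → Even p.length →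
      (localPositions Γ p)[i]? = some H →
      ((∃ g, H.IsEnd (.inl g)) ∨ ∃ a ∈ sequentFV Γ \ I, H.IsEnd (.inr a)) →
      ForallPos I Γ (p ++ [.stopAt i])
  | just {p : List Move} {i : ℕ} {H : Game Par} : ForallPos I Γ p → Even p.length →
      (localPositions Γ p)[i]? = some H → ¬ H.IsAtomic →
      ForallPos I Γ (p ++ [.just i (localPositions Γ p).length])
  | reply {p : List Move} {i k : ℕ} {H : Game Par} {m : Move} :
      ForallPos I Γ (p ++ [.just i k]) → Even p.length →
      (localPositions Γ p)[i]? = some H → [m] ∈ H.positions →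
      ForallPos I Γ (p ++ [.just i k] ++ [m])

/-- `i` justifies `j` through `m` in the infinite play `p` of `∀I.Γ`, where `n` is the length
of `Γ`. -/
def Justifies (n : ℕ) (p : Stream' Move) (i : ℕ) (m : Move) (j : ℕ) : Prop :=
  ∃ k, j = n + k ∧ p.get (2 * k) = .just i j ∧ p.get (2 * k + 1) = m

/-- The infinite list `q` is a local play of `p` in the local position number `i`. -/
def InfLocalPlay (n : ℕ) (q : Stream' Move) (i : ℕ) (p : Stream' Move) : Prop :=
  ∃ s : ℕ → ℕ, s 0 = i ∧ StrictMono s ∧ ∀ t, Justifies n p (s t) (q.get t) (s (t + 1))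

theorem forallPos_isTreeSupport [ParamDual Par] (I : Set Par) (Γ : List (Game Par)) :
    IsTreeSupport {p | ForallPos I Γ p} := by
  refine ⟨ForallPos.nil, ?_⟩
  intro x y hxy hy
  change ForallPos I Γ y at hy
  change ForallPos I Γ x
  have key : ∀ {p : List Move} {m : Move}, (x <+: p → ForallPos I Γ x) →
      ForallPos I Γ (p ++ [m]) → x <+: p ++ [m] → ForallPos I Γ x := by
    intro p m hp h hx
    rcases List.prefix_concat_iff.1 hx with rfl | hx
    · exact h
    · exact hp hx
  induction hy with
  | nil => rw [List.prefix_nil.1 hxy]; exact ForallPos.nil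
  | dropAt hp he ih => exact key ih (.dropAt hp he) hxy
  | em hp he h1 h2 h3 h4 h5 ih => exact key ih (.em hp he h1 h2 h3 h4 h5) hxy
  | stopAt hp he h1 h2 ih => exact key ih (.stopAt hp he h1 h2) hxy
  | just hp he h1 h2 ih => exact key ih (.just hp he h1 h2) hxy
  | reply hp he h1 h2 ih => exact key ih (.reply hp he h1 h2) hxy

/-- The game `∀I.Γ`. In positions of even length Player moves; after `JUST(i,n+k)` the first player
of the local position number `i` moves. -/
def forallGame [ParamDual Par] (I : Set Par) (Γ : List (Game Par)) : Game Par where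
  positions := {p | ForallPos I Γ p}
  isTreeSupport := forallPos_isTreeSupport I Γ
  turn p :=
    if Even p.length then .player else
      match p.getLast? with
      | some (.just i _) => match (localPositions Γ p)[i]? with
        | some H => H.turn []
        | none => .player
      | _ => .player
  label p :=
    match p.getLast? with
    | some (.em _ _) => .inl .player
    | some (.stopAt i) => match (localPositions Γ p)[i]? with
      | some H => H.label []
      | none => .inl .opponent
    | _ => .inl .opponent
  won
    | .player => {p | p ∈ branches {p | ForallPos I Γ p} ∧
        ∃ (i : ℕ) (H : Game Par), Γ[i]? = some H ∧
          ∃ q ∈ branches H.positions, InfLocalPlay Γ.length q i p ∧ q ∈ H.won .player}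
    | .opponent => {p | p ∈ branches {p | ForallPos I Γ p} ∧
        ∀ (i : ℕ) (H : Game Par), Γ[i]? = some H →
          ∀ q ∈ branches H.positions, InfLocalPlay Γ.length q i p → q ∈ H.won .opponent}
  won_union := by
    ext p
    constructor
    · rintro (h | h) <;> exact h.1
    · intro hp
      by_cases h : ∃ (i : ℕ) (H : Game Par), Γ[i]? = some H ∧
          ∃ q ∈ branches H.positions, InfLocalPlay Γ.length q i p ∧ q ∈ H.won .player
      · exact Or.inl ⟨hp, h⟩
      · refine Or.inr ⟨hp, fun i H hH q hq hqp => ?_⟩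
        rw [← H.won_union] at hq
        rcases hq with hq' | hq'
        · exact absurd ⟨i, H, hH, q, H.won_union ▸ Or.inl hq', hqp, hq'⟩ h
        · exact hq'
  won_disjoint := by
    rw [Set.disjoint_left]
    rintro p ⟨_, i, H, hH, q, hq, hqp, hw⟩ ⟨_, h⟩
    exact Set.disjoint_left.1 H.won_disjoint hw (h i H hH q hq hqp)

/-! ### The strategy `EXH` -/

/-- The move `m` from `H`, the local position number `i`, has not been done before, according to
the list `J` of triples of the justification relation. -/
def IsNewMove (H : Game Par) (i : ℕ) (J : List (ℕ × Move × ℕ)) (m : Move) : Prop :=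
  [m] ∈ H.positions ∧ ∀ k, (i, m, k) ∉ J

/-- `m` is the first new move from `H`. -/
def IsFirstNewMove (H : Game Par) (i : ℕ) (J : List (ℕ × Move × ℕ)) (m : Move) : Prop :=
  IsNewMove H i J m ∧ ∀ m', IsNewMove H i J m' → Encodable.encode m ≤ Encodable.encode m'

/-- `H = END(a)` for some `a ∈ I`, and `j` is the first index less than `p` for which the local
position number `j` is `END(a^⊥)`. -/
def EMClause [ParamDual Par] (I : Set Par) (p : ℕ) (L : List (Game Par)) (H : Game Par)
    (j : ℕ) : Prop :=
  ∃ a ∈ I, H.IsEnd (.inr a) ∧ j < p ∧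
    (∃ K, L[j]? = some K ∧ K.IsEnd (.inr (ParamDual.dual a))) ∧
    ∀ j' < j, ∀ K, L[j']? = some K → ¬ K.IsEnd (.inr (ParamDual.dual a))

/-- `Exh I i p L J r` means `r ∈ exh(i, p, q, J)`, where `L = (G_0, …, G_{q-1})` is the list of
the current local positions (so `q = L.length`), the local position number `i` is examined next,
the current cycle examines `G_0, …, G_{p-1}`, and `J` is the current justification relation. -/
inductive Exh [ParamDual Par] (I : Set Par) :
    ℕ → ℕ → List (Game Par) → List (ℕ × Move × ℕ) → List Move → Prop
  | repeat_ {p L J r} : p < L.length → Exh I 0 L.length L J r → Exh I p p L J r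
  | dropAt {L J r} : r = [] ∨ r = [.dropAt L.length] → Exh I L.length L.length L J r
  | em {i p L J r H j} : i < p → L[i]? = some H → EMClause I p L H j →
      r = [] ∨ r = [.em i j] → Exh I i p L J r
  | stopAt {i p L J r H} : i < p → L[i]? = some H → H.IsEnd (.inl .player) →
      r = [] ∨ r = [.stopAt i] → Exh I i p L J r
  | skip {i p L J r H} : i < p → L[i]? = some H → H.IsAtomic → (¬ ∃ j, EMClause I p L H j) →
      ¬ H.IsEnd (.inl .player) → Exh I (i + 1) p L J r → Exh I i p L J r
  | player_just {i p L J r H m} : i < p → L[i]? = some H → ¬ H.IsAtomic →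
      H.turn [] = .player → IsFirstNewMove H i J m →
      r = [] ∨ r = [.just i L.length] → Exh I i p L J r
  | player_move {i p L J r H m} : i < p → L[i]? = some H → ¬ H.IsAtomic →
      H.turn [] = .player → IsFirstNewMove H i J m → (hm : [m] ∈ H.positions) →
      Exh I (i + 1) p (L ++ [H.sub [m] hm]) (J ++ [(i, m, L.length)]) r →
      Exh I i p L J (.just i L.length :: m :: r)
  | player_skip {i p L J r H} : i < p → L[i]? = some H → ¬ H.IsAtomic →
      H.turn [] = .player → (¬ ∃ m, IsNewMove H i J m) →
      Exh I (i + 1) p L J r → Exh I i p L J r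
  | opponent_just {i p L J r H} : i < p → L[i]? = some H → ¬ H.IsAtomic →
      H.turn [] = .opponent → (∀ m, [m] ∈ H.positions → ∀ k, (i, m, k) ∉ J) →
      r = [] ∨ r = [.just i L.length] → Exh I i p L J r
  | opponent_move {i p L J r H m} : i < p → L[i]? = some H → ¬ H.IsAtomic →
      H.turn [] = .opponent → (∀ m, [m] ∈ H.positions → ∀ k, (i, m, k) ∉ J) →
      (hm : [m] ∈ H.positions) →
      Exh I (i + 1) p (L ++ [H.sub [m] hm]) (J ++ [(i, m, L.length)]) r →
      Exh I i p L J (.just i L.length :: m :: r)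
  | opponent_skip {i p L J r H} : i < p → L[i]? = some H → ¬ H.IsAtomic →
      H.turn [] = .opponent → (∃ m, [m] ∈ H.positions ∧ ∃ k, (i, m, k) ∈ J) →
      Exh I (i + 1) p L J r → Exh I i p L J r

/-- The strategy `EXH` for `∀I.Γ`. -/
def EXH [ParamDual Par] (I : Set Par) (Γ : List (Game Par)) : Set (List Move) :=
  {r | Exh I 0 Γ.length Γ [] r}

/-- The sequent `ρ'(Γ)`, where `ρ'` is the restriction of `ρ` to the parameters of `∀I.Γ`. The game
`ρ(∀I.Γ)` is `∀I.ρ'(Γ)`, and so `EXH` for `ρ(∀I.Γ)` is `EXH I (closedSequent I Γ ρ)`. -/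
def closedSequent [ParamDual Par] (I : Set Par) (Γ : List (Game Par))
    (ρ : Par → Option Player) : List (Game Par) :=
  Γ.map fun G => G.assign (restrict ρ (forallGame I Γ).FV)

/-! ### Relative primitive recursion -/

/-- The functions which are primitive recursive relative to the functions in `O`. -/
inductive PrimrecIn (O : Set (ℕ → ℕ)) : (ℕ → ℕ) → Prop
  | oracle {f} : f ∈ O → PrimrecIn O f
  | zero : PrimrecIn O fun _ => 0
  | succ : PrimrecIn O Nat.succ
  | left : PrimrecIn O fun n => n.unpair.1
  | right : PrimrecIn O fun n => n.unpair.2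
  | pair {f g} : PrimrecIn O f → PrimrecIn O g → PrimrecIn O fun n => Nat.pair (f n) (g n)
  | comp {f g} : PrimrecIn O f → PrimrecIn O g → PrimrecIn O fun n => f (g n)
  | prec {f g} : PrimrecIn O f → PrimrecIn O g →
      PrimrecIn O (Nat.unpaired fun z n =>
        n.rec (f z) fun y IH => g (Nat.pair z (Nat.pair y IH)))

/-- The function on codes given by `f`. By definition `Primrec f` is `Nat.Primrec (codeMap f)`. -/
def codeMap {α β : Type*} [Primcodable α] [Primcodable β] (f : α → β) : ℕ → ℕ :=
  fun n => Encodable.encode ((Encodable.decode (α := α) n).map f)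

open Classical in
/-- The characteristic function of a set. -/
def charFun {α : Type*} (S : Set α) : α → Bool := fun x => decide (x ∈ S)

namespace Game

open Classical in
/-- The turn map, undefined outside the positions which are not leaves. -/
def turnPart (G : Game Par) (x : List Move) : Option Player :=
  if x ∈ G.positions \ leaves G.positions then some (G.turn x) else none

open Classical in
/-- The winner map, undefined outside the leaves. -/
def labelPart (G : Game Par) (x : List Move) : Option (Player ⊕ Par) :=
  if x ∈ leaves G.positions then some (G.label x) else none

/-- The predicates and maps of the finitary part of `G`, as functions on codes. -/
def finitaryPart [Primcodable Par] (G : Game Par) : Set (ℕ → ℕ) :=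
  {codeMap (charFun G.positions),
    codeMap (numChildren G.positions),
    codeMap (fun x : List Move × ℕ => nthChild G.positions x.1 x.2),
    codeMap G.turnPart,
    codeMap G.labelPart}

/-- `G` has a primitive recursive finitary part. -/
def PrimrecFinitary [Primcodable Par] (G : Game Par) : Prop :=
  Primrec (charFun G.positions) ∧
    Primrec (numChildren G.positions) ∧
    Primrec (fun x : List Move × ℕ => nthChild G.positions x.1 x.2) ∧
    Primrec G.turnPart ∧
    Primrec G.labelPart

end Game

/-- The set `σ` is primitive recursive relative to the finitary parts of the games in `Γ` and to
the duality on parameters. -/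
def PrimrecRelTo [Primcodable Par] [ParamDual Par] (Γ : List (Game Par))
    (σ : Set (List Move)) : Prop :=
  PrimrecIn ({codeMap (ParamDual.dual : Par → Par)} ∪ {f | ∃ G ∈ Γ, f ∈ G.finitaryPart})
    (codeMap (charFun σ))

end ParamGame

end

open ParamGame

namespace ParamGame

variable {Par : Type*}

/-! ### Basic facts on players, games and winning strategies -/

/-! The core is a dichotomy in which determinacy of the given games plays no role: for a list `Γ`
all of whose leaf parameters lie in `I`, either `EXH` wins `∀I.Γ`, or there is one `I`-assignment
`η` under which Opponent wins every game of `Γ`.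

Suppose that a play of `EXH` is lost. Since `EXH` returns to its local positions until nothing is
left to do there, this single play explores every move of Player from each local position where he
moves, and contains an answer of Opponent at each non-atomic local position where Opponent moves. It
shows no `END(P)` and no dual pair of parameters of `I`, for `EXH` would have won by them, and none
of its infinite chains is won by Player. Such a record is a `Refutation`. Its chains of moves form a
strategy of Opponent in each game of `Γ`. Assigning all parameters met to Opponent is consistent,
because no dual pair was met, and makes all these strategies winning at once
(`Refutation.isWinning_strategy`). A finite lost play ends with `DROP` after a cycle without moves;
an infinite one needs fairness (`run_fair`, `run_explores`). Together this is
`EXH_isWinning_or_refutation`.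

Conversely, strategies of Opponent winning all `η(G)` combine to a winning strategy for `∀I.Γ`
(`exists_isWinning_opponent_forallGame`). Each game is cut down to the tree of its strategy, and the
positions of the quantified game over these trees are the combined strategy. No `EM` leaf occurs in
it, since `η` does not give both parameters of a dual pair to Opponent; every `STOP` leaf and every
infinite chain in it is won by Opponent.

Dichotomy and combination give determinacy. Condition (c) excludes the second alternative and so
yields (b). If (a) holds and (c) fails at `η`, determinacy of the given games provides Opponent with
winning strategies in all of them; their combination contradicts (a), since no game is won by both
players. The assignment `ρ` is absorbed into the games by `forallGame_assign_similar` and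
`assign_overwrite_similar`.

For the complexity, a machine replays a list of moves against `EXH`, within a number of steps
bounded in advance (`machine_correct`). The first new move of Player at a local position is the
child whose index is the number of moves made from there so far (`Simulates.isNthChild`), so the
finitary parts supply it. The set `I` is never consulted, because all leaf parameters of the closed
games belong to it. -/

@[simp] theorem Player.dual_player : Player.player.dual = .opponent := rfl

@[simp] theorem Player.dual_opponent : Player.opponent.dual = .player := rfl

theorem Player.eq_player_or_opponent (g : Player) : g = .player ∨ g = .opponent := by
  cases g <;> simp

theorem Game.eq_of_components {G K : Game Par} (h1 : G.positions = K.positions)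
    (h2 : G.turn = K.turn) (h3 : G.label = K.label) (h4 : G.won = K.won) : G = K := by
  cases G; cases K
  simp only at h1 h2 h3 h4
  subst h1 h2 h3 h4
  rfl

theorem Game.sub_sub (G : Game Par) {x y : List Move} (hx : x ∈ G.positions)
    (hy : y ∈ (G.sub x hx).positions) :
    (G.sub x hx).sub y hy = G.sub (x ++ y) hy := by
  apply Game.eq_of_components
  · ext z; simp [Game.sub]
  · ext z; simp [Game.sub]
  · ext z; simp [Game.sub]
  · ext g z; simp [Game.sub, Stream'.append_append_stream]

theorem Game.sub_nil (G : Game Par) (h : [] ∈ G.positions) : G.sub [] h = G := by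
  apply Game.eq_of_components
  · ext z; simp [Game.sub]
  · ext z; simp [Game.sub]
  · ext z; simp [Game.sub]
  · ext g z; simp [Game.sub]

theorem Game.nil_mem (G : Game Par) : [] ∈ G.positions := G.isTreeSupport.1

theorem Game.exists_move_of_not_isAtomic {G : Game Par} (h : ¬ G.IsAtomic) :
    ∃ m, [m] ∈ G.positions := by
  by_contra! hno
  refine h (Set.eq_singleton_iff_unique_mem.2 ⟨G.nil_mem, fun x hx => ?_⟩)
  rcases x with _ | ⟨m, x⟩
  · rfl
  · exact absurd (G.isTreeSupport.2 [m] (m :: x) (by simp) hx) (hno m)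

theorem Game.not_isAtomic_of_mem {G : Game Par} {m : Move} (h : [m] ∈ G.positions) :
    ¬ G.IsAtomic := by
  intro ha
  rw [Game.IsAtomic] at ha
  rw [ha] at h
  simp at h

/-- This translates between the `END` games among the local positions and the leaves of the games in
which they arise. -/
theorem Game.isAtomic_sub_iff (G : Game Par) {x : List Move} (hx : x ∈ G.positions) :
    (G.sub x hx).IsAtomic ↔ x ∈ leaves G.positions := by
  constructor
  · intro h
    refine ⟨hx, fun m hm => ?_⟩
    exact Game.not_isAtomic_of_mem (G := G.sub x hx) hm h
  · intro h
    by_contra hn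
    obtain ⟨m, hm⟩ := Game.exists_move_of_not_isAtomic hn
    exact h.2 m hm

/-- No game has winning strategies for both players. -/
theorem Game.not_isWinning_both (G : Game Par) {σ τ : Set (List Move)}
    (hσ : G.IsWinning .player σ) (hτ : G.IsWinning .opponent τ) : False := by
  obtain ⟨⟨⟨⟨⟨hσ1, hσ2⟩, hσ3⟩, hσ4⟩, hσ5⟩, hσ6⟩ := hσ
  obtain ⟨⟨⟨⟨⟨hτ1, hτ2⟩, hτ3⟩, hτ4⟩, hτ5⟩, hτ6⟩ := hτ
  -- The two strategies can be followed together: the strategy of the player who moves supplies a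
  -- move, and that of the other player admits all moves. A common leaf would have two labels.
  have step : ∀ p : List Move, p ∈ σ ∩ τ → ∃ m, p ++ [m] ∈ σ ∩ τ := by
    rintro p ⟨h1, h2⟩
    have hl : p ∉ leaves G.positions := by
      intro hl
      have := (hσ5 p h1 hl).symm.trans (hτ5 p h2 hl)
      simp at this
    rcases Player.eq_player_or_opponent (G.turn p) with ht | ht
    · obtain ⟨m, hm⟩ := hσ4 p h1 hl ht
      exact ⟨m, hm, hτ3 p h2 ht m (hσ2 hm)⟩
    · obtain ⟨m, hm⟩ := hτ4 p h2 hl ht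
      exact ⟨m, hσ3 p h1 ht m (hτ2 hm), hm⟩
  have : Nonempty Move := ⟨.nth 0⟩
  choose! f hf using step
  let pos : ℕ → List Move := fun n => Nat.rec [] (fun _ p => p ++ [f p]) n
  have hpos : ∀ n, pos n ∈ σ ∩ τ := by
    intro n
    induction n with
    | zero => exact ⟨hσ1.1, hτ1.1⟩
    | succ n ih => exact hf _ ih
  let s : Stream' Move := fun n => f (pos n)
  have hs : ∀ n, s.take n = pos n := by
    intro n
    induction n with
    | zero => rfl
    | succ n ih => rw [Stream'.take_succ', ih]; rfl
  have h1 : s ∈ G.won .player := hσ6 fun k => by rw [hs]; exact (hpos k).1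
  have h2 : s ∈ G.won .opponent := hτ6 fun k => by rw [hs]; exact (hpos k).2
  exact Set.disjoint_left.1 G.won_disjoint h1 h2

/-- Two games which differ only in the values of their maps at irrelevant positions. -/
structure Game.Similar (G K : Game Par) : Prop where
  positions : G.positions = K.positions
  turn : ∀ x ∈ G.positions, G.turn x = K.turn x
  label : ∀ x ∈ leaves G.positions, G.label x = K.label x
  won : G.won = K.won

theorem Game.Similar.symm {G K : Game Par} (h : G.Similar K) : K.Similar G where
  positions := h.positions.symm
  turn x hx := (h.turn x (h.positions ▸ hx)).symm
  label x hx := (h.label x (h.positions ▸ hx)).symm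
  won := h.won.symm

/-- The conditions on a winning strategy consult the turn map only at positions and the label map
only at leaves, where the two games agree. -/
theorem Game.Similar.isWinning {G K : Game Par} (h : G.Similar K) {g : Player}
    {σ : Set (List Move)} (hw : G.IsWinning g σ) : K.IsWinning g σ := by
  obtain ⟨⟨⟨⟨⟨h1, h2⟩, h3⟩, h4⟩, h5⟩, h6⟩ := hw
  refine ⟨⟨⟨⟨⟨h1, h.positions ▸ h2⟩, ?_⟩, ?_⟩, ?_⟩, h.won ▸ h6⟩
  · intro p hp ht m hm
    exact h3 p hp ((h.turn p (h2 hp)).trans ht) m (h.positions ▸ hm)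
  · intro p hp hl ht
    exact h4 p hp (h.positions ▸ hl) ((h.turn p (h2 hp)).trans ht)
  · intro p hp hl
    rw [← h.positions] at hl
    exact (h.label p hl).symm.trans (h5 p hp hl)

/-! ### Local positions and positions of `∀I.Γ` -/

@[simp] theorem localPositions_nil (L : List (Game Par)) : localPositions L [] = L := by
  simp [localPositions]

@[simp] theorem localPositions_singleton (L : List (Game Par)) (m : Move) :
    localPositions L [m] = L := by
  cases m <;> simp [localPositions]

theorem localPositions_just {L : List (Game Par)} {i k : ℕ} {H : Game Par} {m : Move}
    (hH : L[i]? = some H) (hm : [m] ∈ H.positions) (p : List Move) :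
    localPositions L (.just i k :: m :: p) = localPositions (L ++ [H.sub [m] hm]) p := by
  simp [localPositions, hH, hm]

variable [ParamDual Par] {I : Set Par} {Γ : List (Game Par)}

theorem ForallPos.of_append {p q : List Move} (h : ForallPos I Γ (p ++ q)) : ForallPos I Γ p :=
  (forallPos_isTreeSupport I Γ).2 p _ (List.prefix_append _ _) h

/-- Inversion of the last move of a position of `∀I.Γ`. -/
theorem ForallPos.snoc_cases {p : List Move} {m : Move} (h : ForallPos I Γ (p ++ [m])) :
    (Even p.length ∧ m = .dropAt (localPositions Γ p).length) ∨
    (Even p.length ∧ ∃ i j H K a, m = .em i j ∧ (localPositions Γ p)[i]? = some H ∧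
      (localPositions Γ p)[j]? = some K ∧ a ∈ I ∧ H.IsEnd (.inr a) ∧
      K.IsEnd (.inr (ParamDual.dual a))) ∨
    (Even p.length ∧ ∃ i H, m = .stopAt i ∧ (localPositions Γ p)[i]? = some H ∧
      ((∃ g, H.IsEnd (.inl g)) ∨ ∃ a ∈ sequentFV Γ \ I, H.IsEnd (.inr a))) ∨
    (Even p.length ∧ ∃ i H, m = .just i (localPositions Γ p).length ∧
      (localPositions Γ p)[i]? = some H ∧ ¬ H.IsAtomic) ∨
    (¬ Even p.length ∧ ∃ p' i k H, p = p' ++ [.just i k] ∧ Even p'.length ∧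
      (localPositions Γ p')[i]? = some H ∧ [m] ∈ H.positions) := by
  generalize hx : p ++ [m] = x at h
  cases h with
  | nil => simp at hx
  | dropAt hp he => obtain ⟨rfl, h⟩ := List.append_inj' hx rfl; simp at h; exact .inl ⟨he, h⟩
  | em hp he h1 h2 h3 h4 h5 =>
    obtain ⟨rfl, h⟩ := List.append_inj' hx rfl; simp at h
    exact .inr (.inl ⟨he, _, _, _, _, _, h, h1, h2, h3, h4, h5⟩)
  | stopAt hp he h1 h2 =>
    obtain ⟨rfl, h⟩ := List.append_inj' hx rfl; simp at h
    exact .inr (.inr (.inl ⟨he, _, _, h, h1, h2⟩))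
  | just hp he h1 h2 =>
    obtain ⟨rfl, h⟩ := List.append_inj' hx rfl; simp at h
    exact .inr (.inr (.inr (.inl ⟨he, _, _, h, h1, h2⟩)))
  | reply hp he h1 h2 =>
    obtain ⟨rfl, h⟩ := List.append_inj' hx rfl; simp at h; subst h
    refine .inr (.inr (.inr (.inr ⟨?_, _, _, _, _, rfl, he, h1, h2⟩)))
    simp [Nat.even_add_one, he]

theorem ForallPos.reply_length {p : List Move} {i : ℕ} {H : Game Par} {m : Move}
    (hp : ForallPos I Γ p) (he : Even p.length) (hH : (localPositions Γ p)[i]? = some H)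
    (hm : [m] ∈ H.positions) :
    ForallPos I Γ (p ++ [.just i (localPositions Γ p).length, m]) := by
  have := ForallPos.reply (.just hp he hH (Game.not_isAtomic_of_mem hm)) he hH hm
  simpa using this

/-- A position of even length is empty or ends with a justification move and its answer. -/
theorem ForallPos.even_cases {p : List Move} (hp : ForallPos I Γ p) (he : Even p.length) :
    p = [] ∨ ∃ p' i H m, p = p' ++ [.just i (localPositions Γ p').length, m] ∧
      ForallPos I Γ p' ∧ Even p'.length ∧ (localPositions Γ p')[i]? = some H ∧
      ¬ H.IsAtomic ∧ [m] ∈ H.positions := by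
  rcases List.eq_nil_or_concat' p with rfl | ⟨q, m, rfl⟩
  · exact .inl rfl
  have hq : ¬ Even q.length := by simpa [Nat.even_add_one] using he
  rcases hp.snoc_cases with h | h | h | h | ⟨_, p', i, k, H, rfl, he', hH, hm⟩
  · exact absurd h.1 hq
  · exact absurd h.1 hq
  · exact absurd h.1 hq
  · exact absurd h.1 hq
  have hp' := hp.of_append
  rcases hp'.snoc_cases with ⟨_, h⟩ | ⟨_, _, _, _, _, _, h, _⟩ | ⟨_, _, _, h, _⟩ |
      ⟨_, i', H', h, hH', hna⟩ | ⟨h, _⟩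
  · cases h
  · cases h
  · cases h
  · cases h
    exact .inr ⟨p', i, H, m, by simp, hp'.of_append, he', hH,
      Game.not_isAtomic_of_mem hm, hm⟩
  · exact absurd he' h

/-- This is induction on the number of completed rounds, a round being a justification move together
with its answer. It is the principle used for everything about local positions. -/
theorem ForallPos.even_induction {motive : List Move → Prop} (nil : motive [])
    (step : ∀ p i H m, ForallPos I Γ p → Even p.length → (localPositions Γ p)[i]? = some H →
      [m] ∈ H.positions → motive p →
      motive (p ++ [.just i (localPositions Γ p).length, m]))
    {p : List Move} (hp : ForallPos I Γ p) (he : Even p.length) : motive p := by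
  induction hn : p.length using Nat.strong_induction_on generalizing p with
  | _ n ih =>
    subst hn
    rcases hp.even_cases he with rfl | ⟨p', i, H, m, rfl, hp', he', hH, -, hm⟩
    · exact nil
    · exact step p' i H m hp' he' hH hm (ih _ (by simp) hp' he' rfl)

/-- `localPositions` recurses from the first moves, whereas `ForallPos` grows at the end; this
reconciles the two. -/
theorem ForallPos.localPositions_append {p : List Move} (hp : ForallPos I Γ p)
    (he : Even p.length) (q : List Move) :
    localPositions Γ (p ++ q) = localPositions (localPositions Γ p) q := by
  revert q
  refine ForallPos.even_induction (motive := fun p => ∀ q, localPositions Γ (p ++ q) =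
    localPositions (localPositions Γ p) q) ?_ ?_ hp he
  · simp
  · intro p i H m hp he hH hm ih q
    rw [List.append_assoc, ih, ih]
    simp only [List.cons_append, List.nil_append]
    rw [localPositions_just hH hm, localPositions_just hH hm]
    simp

theorem ForallPos.localPositions_snoc {p : List Move} (hp : ForallPos I Γ p)
    (he : Even p.length) (m : Move) : localPositions Γ (p ++ [m]) = localPositions Γ p := by
  rw [hp.localPositions_append he, localPositions_singleton]

theorem ForallPos.localPositions_reply {p : List Move} {i k : ℕ} {H : Game Par} {m : Move}
    (hp : ForallPos I Γ p) (he : Even p.length) (hH : (localPositions Γ p)[i]? = some H)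
    (hm : [m] ∈ H.positions) :
    localPositions Γ (p ++ [.just i k, m]) = localPositions Γ p ++ [H.sub [m] hm] := by
  rw [hp.localPositions_append he, localPositions_just hH hm, localPositions_nil]

theorem ForallPos.length_localPositions {p : List Move} (hp : ForallPos I Γ p)
    (he : Even p.length) : (localPositions Γ p).length = Γ.length + p.length / 2 := by
  refine ForallPos.even_induction (motive := fun p =>
    (localPositions Γ p).length = Γ.length + p.length / 2) ?_ ?_ hp he
  · simp
  · intro p i H m hp he hH hm ih
    rw [hp.localPositions_reply he hH hm]
    simp [ih]
    omega

theorem forallGame_turn_even {p : List Move} (he : Even p.length) :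
    (forallGame I Γ).turn p = .player := by
  simp [forallGame, he]

theorem forallGame_turn_just {p : List Move} (hp : ForallPos I Γ p) (he : Even p.length)
    {i k : ℕ} {H : Game Par} (hH : (localPositions Γ p)[i]? = some H) :
    (forallGame I Γ).turn (p ++ [.just i k]) = H.turn [] := by
  simp [forallGame, Nat.even_add_one, he, hp.localPositions_snoc he, hH]

/-- A position in which Opponent moves ends with a justification move. -/
theorem ForallPos.of_turn_opponent {p : List Move} (hp : ForallPos I Γ p)
    (ht : (forallGame I Γ).turn p = .opponent) :
    ∃ p' i H, p = p' ++ [.just i (localPositions Γ p').length] ∧ ForallPos I Γ p' ∧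
      Even p'.length ∧ (localPositions Γ p')[i]? = some H ∧ ¬ H.IsAtomic ∧
      H.turn [] = .opponent := by
  have ho : ¬ Even p.length := fun he => by rw [forallGame_turn_even he] at ht; cases ht
  rcases List.eq_nil_or_concat' p with rfl | ⟨q, m, rfl⟩
  · simp at ho
  have hq : Even q.length := by simpa [Nat.even_add_one] using ho
  rcases hp.snoc_cases with ⟨_, rfl⟩ | ⟨_, _, _, _, _, _, rfl, _⟩ | ⟨_, _, _, rfl, _⟩ |
      ⟨_, i, H, rfl, hH, hna⟩ | ⟨h, _⟩
  · simp [forallGame] at ht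
  · simp [forallGame] at ht
  · simp [forallGame] at ht
  · exact ⟨q, i, H, rfl, hp.of_append, hq, hH, hna,
      (forallGame_turn_just hp.of_append hq hH).symm.trans ht⟩
  · exact absurd hq h

/-- `DROP` is always available to Player. -/
theorem not_mem_leaves_of_even {p : List Move} (hp : ForallPos I Γ p) (he : Even p.length) :
    p ∉ leaves (forallGame I Γ).positions :=
  fun h => h.2 _ (.dropAt hp he)

theorem not_mem_leaves_of_just {p : List Move} {i k : ℕ} {H : Game Par}
    (hp : ForallPos I Γ (p ++ [.just i k]))
    (he : Even p.length) (hH : (localPositions Γ p)[i]? = some H) (hna : ¬ H.IsAtomic) :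
    p ++ [.just i k] ∉ leaves (forallGame I Γ).positions := by
  obtain ⟨m, hm⟩ := Game.exists_move_of_not_isAtomic hna
  exact fun h => h.2 m (.reply hp he hH hm)

/-- The leaves of `∀I.Γ`. -/
theorem forallGame_leaf_cases {p : List Move} (hl : p ∈ leaves (forallGame I Γ).positions) :
    ∃ q, ForallPos I Γ q ∧ Even q.length ∧
    (p = q ++ [.dropAt (localPositions Γ q).length] ∨
    (∃ i j H K a, p = q ++ [.em i j] ∧ (localPositions Γ q)[i]? = some H ∧
      (localPositions Γ q)[j]? = some K ∧ a ∈ I ∧ H.IsEnd (.inr a) ∧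
      K.IsEnd (.inr (ParamDual.dual a))) ∨
    (∃ i H, p = q ++ [.stopAt i] ∧ (localPositions Γ q)[i]? = some H ∧
      ((∃ g, H.IsEnd (.inl g)) ∨ ∃ a ∈ sequentFV Γ \ I, H.IsEnd (.inr a)))) := by
  have hp : ForallPos I Γ p := hl.1
  rcases List.eq_nil_or_concat' p with rfl | ⟨q, m, rfl⟩
  · exact absurd hl (not_mem_leaves_of_even hp (by simp))
  have hq : Even q.length := by
    by_contra h
    exact not_mem_leaves_of_even hp (by simpa [Nat.even_add_one] using h) hl
  refine ⟨q, hp.of_append, hq, ?_⟩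
  rcases hp.snoc_cases with ⟨_, rfl⟩ | ⟨_, i, j, H, K, a, rfl, h⟩ | ⟨_, i, H, rfl, h⟩ |
      ⟨_, i, H, rfl, hH, hna⟩ | ⟨h, _⟩
  · exact .inl rfl
  · exact .inr (.inl ⟨i, j, H, K, a, rfl, h⟩)
  · exact .inr (.inr ⟨i, H, rfl, h⟩)
  · exact absurd hl (not_mem_leaves_of_just hp hq hH hna)
  · exact absurd hq h

theorem forallGame_label_dropAt (p : List Move) (k : ℕ) :
    (forallGame I Γ).label (p ++ [.dropAt k]) = .inl .opponent := by simp [forallGame]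

theorem forallGame_label_em (p : List Move) (i j : ℕ) :
    (forallGame I Γ).label (p ++ [.em i j]) = .inl .player := by simp [forallGame]

theorem forallGame_label_stopAt {p : List Move} (hp : ForallPos I Γ p) (he : Even p.length)
    {i : ℕ} {H : Game Par} (hH : (localPositions Γ p)[i]? = some H) :
    (forallGame I Γ).label (p ++ [.stopAt i]) = H.label [] := by
  simp [forallGame, hp.localPositions_snoc he, hH]

theorem mem_leaves_of_odd {p : List Move} {m : Move} (hp : ForallPos I Γ (p ++ [m]))
    (he : Even p.length) (hm : ∀ i k, m ≠ .just i k) :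
    p ++ [m] ∈ leaves (forallGame I Γ).positions := by
  refine ⟨hp, fun m' h => ?_⟩
  have ho : ¬ Even (p ++ [m]).length := by simpa [Nat.even_add_one] using he
  rcases ForallPos.snoc_cases h with h | h | h | h | ⟨_, p', i, k, H, heq, _⟩
  · exact ho h.1
  · exact ho h.1
  · exact ho h.1
  · exact ho h.1
  · have := (List.append_inj' heq rfl).2
    simp at this
    exact hm _ _ this

/-! ### Infinite plays -/

theorem even_length_take (p : Stream' Move) (k : ℕ) : Even (p.take (2 * k)).length := by
  simp

theorem take_two_mul_succ (p : Stream' Move) (k : ℕ) :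
    p.take (2 * (k + 1)) = p.take (2 * k) ++ [p.get (2 * k), p.get (2 * k + 1)] := by
  rw [show 2 * (k + 1) = 2 * k + 1 + 1 by ring, Stream'.take_succ' (2 * k + 1),
    Stream'.take_succ' (2 * k), List.append_assoc]
  rfl

/-- The local position added by the `k`-th pair of moves of an infinite play. -/
theorem exists_localPositions_succ {p : Stream' Move}
    (hp : p ∈ branches {p | ForallPos I Γ p}) (k : ℕ) :
    ∃ i H m, ∃ hm : [m] ∈ H.positions, p.get (2 * k) = .just i (Γ.length + k) ∧
      p.get (2 * k + 1) = m ∧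
      (localPositions Γ (p.take (2 * k)))[i]? = some H ∧
      localPositions Γ (p.take (2 * (k + 1))) =
        localPositions Γ (p.take (2 * k)) ++ [H.sub [m] hm] := by
  have h0 : ForallPos I Γ (p.take (2 * k)) := hp _
  have h1 : ForallPos I Γ (p.take (2 * (k + 1))) := hp _
  have he := even_length_take p k
  rcases h1.even_cases (even_length_take p (k + 1)) with h | ⟨p', i, H, m, h, hp', he', hH, -, hm⟩
  · have := congrArg List.length h
    simp at this
  · rw [take_two_mul_succ] at h
    obtain ⟨h2, h3⟩ := List.append_inj' h rfl
    subst h2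
    simp only [List.cons.injEq, and_true] at h3
    refine ⟨i, H, m, hm, ?_, h3.2, hH, ?_⟩
    · rw [h3.1, h0.length_localPositions he]
      simp
    · rw [take_two_mul_succ, h3.1, h3.2, h0.localPositions_reply he hH hm]

theorem localPositions_take_prefix {p : Stream' Move}
    (hp : p ∈ branches {p | ForallPos I Γ p}) {k l : ℕ} (h : k ≤ l) :
    localPositions Γ (p.take (2 * k)) <+: localPositions Γ (p.take (2 * l)) := by
  induction l, h using Nat.le_induction with
  | base => exact List.prefix_rfl
  | succ l _ ih =>
    obtain ⟨_, _, _, _, _, _, _, h⟩ := exists_localPositions_succ hp l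
    rw [h]
    exact ih.trans (List.prefix_append _ _)

/-- A list of local positions is only ever extended at the end, so a local position keeps its
number. This is used for comparing different stages of a play. -/
theorem getElem?_eq_some_of_prefix {α : Type*} {l l' : List α} (h : l <+: l') {i : ℕ} {a : α}
    (hi : l[i]? = some a) : l'[i]? = some a := by
  obtain ⟨t, rfl⟩ := h
  rw [List.getElem?_append_left (List.getElem?_eq_some_iff.1 hi).1, hi]

/-- A justified local position is the sub-game after the justifying move. -/
theorem Justifies.exists_sub {p : Stream' Move} (hp : p ∈ branches {p | ForallPos I Γ p})
    {i j : ℕ} {m : Move} (h : Justifies Γ.length p i m j) {H : Game Par} {k : ℕ}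
    (hH : (localPositions Γ (p.take (2 * k)))[i]? = some H) :
    ∃ hm : [m] ∈ H.positions, ∃ l,
      (localPositions Γ (p.take (2 * l)))[j]? = some (H.sub [m] hm) := by
  obtain ⟨t, rfl, h1, h2⟩ := h
  obtain ⟨i', H', m', hm', h3, h4, h5, h6⟩ := exists_localPositions_succ hp t
  have hi : i' = i := by
    have := h3.symm.trans h1
    simp at this
    exact this
  subst hi
  obtain rfl : m' = m := h4.symm.trans h2
  have : H' = H := by
    have a1 := getElem?_eq_some_of_prefix
      (localPositions_take_prefix hp (le_max_left k t)) hH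
    have a2 := getElem?_eq_some_of_prefix
      (localPositions_take_prefix hp (le_max_right k t)) h5
    simpa using a2.symm.trans a1
  subst this
  refine ⟨hm', t + 1, ?_⟩
  rw [h6]
  have hl : (localPositions Γ (p.take (2 * t))).length = Γ.length + t := by
    rw [ForallPos.length_localPositions (I := I) (hp _) (even_length_take p t)]
    simp
  simp [hl]

/-- An infinite local play is an infinite branch of the game in which it is played. -/
theorem InfLocalPlay.mem_branches {p : Stream' Move} (hp : p ∈ branches {p | ForallPos I Γ p})
    {q : Stream' Move} {i : ℕ} (h : InfLocalPlay Γ.length q i p) {G : Game Par}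
    (hG : Γ[i]? = some G) : q ∈ branches G.positions := by
  obtain ⟨s, hs0, -, hs⟩ := h
  have key : ∀ t, ∃ hq : q.take t ∈ G.positions, ∃ k,
      (localPositions Γ (p.take (2 * k)))[s t]? = some (G.sub _ hq) := by
    intro t
    induction t with
    | zero =>
      refine ⟨G.nil_mem, 0, ?_⟩
      simp only [Stream'.take_zero, Nat.mul_zero, localPositions_nil, Game.sub_nil, hs0, hG]
    | succ t ih =>
      obtain ⟨hq, k, hk⟩ := ih
      obtain ⟨hm, l, hl⟩ := (hs t).exists_sub hp hk
      have : q.take (t + 1) = q.take t ++ [q.get t] := Stream'.take_succ' t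
      rw [Game.sub_sub] at hl
      simp only [this]
      exact ⟨hm, l, hl⟩
  exact fun k => (key k).1

end ParamGame

namespace ParamGame

variable {Par : Type*}

/-! ### Combining strategies of Opponent -/

theorem assignLabel_eq_inl {ρ : Par → Option Player} {x : Player ⊕ Par} {g : Player}
    (h : assignLabel ρ x = .inl g) : x = .inl g ∨ ∃ a, x = .inr a ∧ ρ a = some g := by
  rcases x with g' | a
  · left; simpa [assignLabel] using h
  · right
    refine ⟨a, rfl, ?_⟩
    cases hr : ρ a with
    | none => simp [assignLabel, hr] at h
    | some g' => simpa [assignLabel, hr] using h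

theorem assignLabel_eq_inr {ρ : Par → Option Player} {x : Player ⊕ Par} {a : Par}
    (h : assignLabel ρ x = .inr a) : x = .inr a ∧ ρ a = none := by
  rcases x with g' | b
  · simp [assignLabel] at h
  · cases hr : ρ b with
    | none =>
      simp only [assignLabel, hr] at h
      cases h
      exact ⟨rfl, hr⟩
    | some g' => simp [assignLabel, hr] at h

theorem assignLabel_inr_some {ρ : Par → Option Player} {a : Par} {g : Player}
    (h : ρ a = some g) : assignLabel ρ (.inr a) = .inl g := by simp [assignLabel, h]

theorem assignLabel_inr_none {ρ : Par → Option Player} {a : Par}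
    (h : ρ a = none) : assignLabel ρ (.inr a) = .inr a := by simp [assignLabel, h]

theorem restrict_eq_none {S : Set Par} {a : Par} {ρ : Par → Option Player} (ha : a ∉ S) :
    restrict ρ S a = none := by
  simp [restrict, ha]

/-- The tree of `K` is a partially winning strategy of Opponent for `η(H)`. -/
structure IsOpponentPart (η : Par → Option Player) (K H : Game Par) : Prop where
  turn : K.turn = H.turn
  label : K.label = H.label
  partially : (H.assign η).IsPartiallyWinning .opponent K.positions

namespace IsOpponentPart

variable {η : Par → Option Player} {K H : Game Par}

theorem subset (h : IsOpponentPart η K H) : K.positions ⊆ H.positions := h.partially.1.1.1.2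

theorem player_closed (h : IsOpponentPart η K H) {x : List Move} (hx : x ∈ K.positions)
    (ht : H.turn x = .player) {m : Move} (hm : x ++ [m] ∈ H.positions) :
    x ++ [m] ∈ K.positions := h.partially.1.1.2 x hx ht m hm

/-- Cutting a game down to a total strategy creates no new leaves; hence atomic games and `END`
games are the same before and after. -/
theorem exists_child (h : IsOpponentPart η K H) {x : List Move} (hx : x ∈ K.positions)
    (hl : x ∉ leaves H.positions) : ∃ m, x ++ [m] ∈ K.positions := by
  rcases Player.eq_player_or_opponent (H.turn x) with ht | ht
  · have : ∃ m, x ++ [m] ∈ H.positions := by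
      by_contra! hn
      exact hl ⟨h.subset hx, hn⟩
    obtain ⟨m, hm⟩ := this
    exact ⟨m, h.player_closed hx ht hm⟩
  · exact h.partially.1.2 x hx hl ht

theorem label_leaf (h : IsOpponentPart η K H) {x : List Move} (hx : x ∈ K.positions)
    (hl : x ∈ leaves H.positions) : H.label x = .inl .opponent ∨
      ∃ a, H.label x = .inr a ∧ η a = some .opponent :=
  assignLabel_eq_inl (h.partially.2 x hx hl)

theorem sub (h : IsOpponentPart η K H) {x : List Move} (hx : x ∈ K.positions) :
    IsOpponentPart η (K.sub x hx) (H.sub x (h.subset hx)) where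
  turn := by funext y; simp [Game.sub, h.turn]
  label := by funext y; simp [Game.sub, h.label]
  partially := by
    refine ⟨⟨⟨⟨(K.sub x hx).isTreeSupport, fun y hy => h.subset hy⟩, ?_⟩, ?_⟩, ?_⟩
    · intro y hy ht m hm
      have hm' : (x ++ y) ++ [m] ∈ H.positions := by rw [List.append_assoc]; exact hm
      have := h.player_closed hy ht hm'
      simpa [Game.sub] using this
    · intro y hy hl _
      have hl' : x ++ y ∉ leaves H.positions := by
        intro hl'
        refine hl ⟨hl'.1, fun m hm => hl'.2 m ?_⟩
        change x ++ (y ++ [m]) ∈ H.positions at hm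
        rwa [← List.append_assoc] at hm
      obtain ⟨m, hm⟩ := h.exists_child hy hl'
      exact ⟨m, by simpa [Game.sub] using hm⟩
    · intro y hy hl
      refine h.partially.2 (x ++ y) hy ⟨hl.1, fun m hm => hl.2 m ?_⟩
      change x ++ (y ++ [m]) ∈ H.positions
      rwa [← List.append_assoc]

theorem isAtomic_iff (h : IsOpponentPart η K H) : K.IsAtomic ↔ H.IsAtomic := by
  constructor
  · intro ha
    by_contra hn
    obtain ⟨m, hm⟩ := Game.exists_move_of_not_isAtomic hn
    obtain ⟨m', hm'⟩ := h.exists_child (x := []) K.nil_mem fun hl => hl.2 m hm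
    exact Game.not_isAtomic_of_mem hm' ha
  · intro ha
    by_contra hn
    obtain ⟨m, hm⟩ := Game.exists_move_of_not_isAtomic hn
    exact Game.not_isAtomic_of_mem (h.subset hm) ha

theorem isEnd_iff (h : IsOpponentPart η K H) (x : Player ⊕ Par) : K.IsEnd x ↔ H.IsEnd x := by
  rw [Game.IsEnd, Game.IsEnd, h.isAtomic_iff, h.label]

theorem end_cases (h : IsOpponentPart η K H) {x : Player ⊕ Par} (hx : H.IsEnd x) :
    x = .inl .opponent ∨ ∃ a, x = .inr a ∧ η a = some .opponent := by
  have hl : [] ∈ leaves H.positions := by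
    rw [← H.isAtomic_sub_iff H.nil_mem, Game.sub_nil]
    exact hx.1
  have := h.label_leaf (x := []) K.nil_mem hl
  rwa [hx.2] at this

end IsOpponentPart

theorem forall₂_getElem?_left {α β : Type*} {R : α → β → Prop} {l : List α} {l' : List β}
    (h : List.Forall₂ R l l') {i : ℕ} {a : α} (ha : l[i]? = some a) :
    ∃ b, l'[i]? = some b ∧ R a b := by
  obtain ⟨hi, rfl⟩ := List.getElem?_eq_some_iff.1 ha
  have hi' : i < l'.length := h.length_eq ▸ hi
  exact ⟨l'[i], by simp [hi'], h.get hi hi'⟩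

theorem forall₂_getElem?_right {α β : Type*} {R : α → β → Prop} {l : List α} {l' : List β}
    (h : List.Forall₂ R l l') {i : ℕ} {b : β} (hb : l'[i]? = some b) :
    ∃ a, l[i]? = some a ∧ R a b := by
  obtain ⟨hi, rfl⟩ := List.getElem?_eq_some_iff.1 hb
  have hi' : i < l.length := h.length_eq ▸ hi
  exact ⟨l[i], by simp [hi'], h.get hi' hi⟩

/-- The game with the tree `σ`, all of whose infinite branches are won by Opponent. -/
def Game.prune (G : Game Par) (σ : Set (List Move)) (hσ : IsTreeSupport σ) : Game Par where
  positions := σ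
  isTreeSupport := hσ
  turn := G.turn
  label := G.label
  won
    | .player => ∅
    | .opponent => branches σ
  won_union := by simp
  won_disjoint := by simp

variable [ParamDual Par] {I : Set Par} {Γ Δ : List (Game Par)} {η : Par → Option Player}

/-- This is what excludes `EM` moves when Opponent follows his strategies. -/
theorem IsAssignment.not_both_opponent (hη : IsAssignment I η) {a : Par} (ha : a ∈ I)
    (h1 : η a = some .opponent) (h2 : η (ParamDual.dual a) = some .opponent) : False := by
  rw [hη.2 a ha, h1] at h2
  simp at h2

/-- The relation `IsOpponentPart` passes to sub-games, so the two lists of local positions remain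
related round by round; a last move that is legal over the restricted games is then legal over the
original ones. -/
theorem ForallPos.of_forall₂ (hη : IsAssignment I η) (hΔ : List.Forall₂ (IsOpponentPart η) Δ Γ)
    {p : List Move}
    (hp : ForallPos I Δ p) :
    ForallPos I Γ p ∧ (Even p.length →
      List.Forall₂ (IsOpponentPart η) (localPositions Δ p) (localPositions Γ p)) := by
  have even : ∀ {p}, ForallPos I Δ p → Even p.length → ForallPos I Γ p ∧
      List.Forall₂ (IsOpponentPart η) (localPositions Δ p) (localPositions Γ p) := by
    intro p hp he
    refine ForallPos.even_induction (motive := fun p => ForallPos I Γ p ∧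
      List.Forall₂ (IsOpponentPart η) (localPositions Δ p) (localPositions Γ p)) ?_ ?_ hp he
    · exact ⟨.nil, by simpa using hΔ⟩
    · rintro p i K m hp he hK hm ⟨hp', hL⟩
      obtain ⟨H, hH, hKH⟩ := forall₂_getElem?_left hL hK
      have hm' := hKH.subset hm
      rw [hp.localPositions_reply he hK hm, hp'.localPositions_reply he hH hm', hL.length_eq]
      exact ⟨hp'.reply_length he hH hm', List.rel_append hL (.cons (hKH.sub hm) .nil)⟩
  refine ⟨?_, fun he => (even hp he).2⟩
  rcases List.eq_nil_or_concat' p with rfl | ⟨q, m, rfl⟩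
  · exact .nil
  by_cases hq : Even q.length
  · obtain ⟨hq', hL⟩ := even hp.of_append hq
    rcases hp.snoc_cases with ⟨_, rfl⟩ | ⟨_, i, j, K, K', a, rfl, hK, hK', ha, he, he'⟩ |
        ⟨_, i, K, rfl, hK, he⟩ | ⟨_, i, K, rfl, hK, hna⟩ | ⟨h, _⟩
    · rw [hL.length_eq]
      exact .dropAt hq' hq
    · obtain ⟨H, hH, hKH⟩ := forall₂_getElem?_left hL hK
      obtain ⟨H', hH', hKH'⟩ := forall₂_getElem?_left hL hK'
      exact .em hq' hq hH hH' ha ((hKH.isEnd_iff _).1 he) ((hKH'.isEnd_iff _).1 he')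
    · obtain ⟨H, hH, hKH⟩ := forall₂_getElem?_left hL hK
      refine .stopAt hq' hq hH ?_
      rcases he with ⟨g, hg⟩ | ⟨a, ha, hg⟩
      · exact .inl ⟨g, (hKH.isEnd_iff _).1 hg⟩
      -- This case is empty: a parameter at a leaf of an Opponent part has a value under `η`, hence
      -- lies in `I`, while this `STOP` clause requires one outside `I`.
      · rcases hKH.end_cases ((hKH.isEnd_iff _).1 hg) with h | ⟨b, h, hb⟩
        · cases h
        · cases h
          exact absurd ((hη.1 _).1 (by simp [hb])) ha.2
    · obtain ⟨H, hH, hKH⟩ := forall₂_getElem?_left hL hK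
      rw [hL.length_eq]
      exact .just hq' hq hH (by rwa [← hKH.isAtomic_iff])
    · exact absurd hq h
  · exact (even hp (by simpa [Nat.even_add_one] using hq)).1

/-- Strategies of Opponent which win all the games `η(G)` for `G` in `Γ` can be combined to a
winning strategy of Opponent for `∀I.Γ`. -/
theorem exists_isWinning_opponent_forallGame (hη : IsAssignment I η)
    (h : ∀ G ∈ Γ, ∃ σ, (G.assign η).IsWinning .opponent σ) :
    ∃ τ, (forallGame I Γ).IsWinning .opponent τ := by
  -- `Δ` consists of the trees of the given strategies. The second conjunct keeps what
  -- `IsOpponentPart` forgets, the winner of the infinite branches.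
  have : ∃ Δ : List (Game Par), List.Forall₂ (fun K H => IsOpponentPart η K H ∧
      branches K.positions ⊆ H.won .opponent) Δ Γ := by
    induction Γ with
    | nil => exact ⟨[], .nil⟩
    | cons G Γ ih =>
      obtain ⟨Δ, hΔ⟩ := ih fun G hG => h G (List.mem_cons_of_mem _ hG)
      obtain ⟨σ, hσ⟩ := h G List.mem_cons_self
      exact ⟨G.prune σ hσ.1.1.1.1.1 :: Δ, .cons ⟨⟨rfl, rfl, hσ.1⟩, hσ.2⟩ hΔ⟩
  obtain ⟨Δ, hΔ'⟩ := this
  have hΔ : List.Forall₂ (IsOpponentPart η) Δ Γ := hΔ'.imp fun _ _ h => h.1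
  refine ⟨{p | ForallPos I Δ p}, ⟨⟨⟨⟨forallPos_isTreeSupport I Δ,
    fun p hp => (ForallPos.of_forall₂ hη hΔ hp).1⟩, ?_⟩, ?_⟩, ?_⟩, ?_⟩
  · intro p (hp : ForallPos I Δ p) ht m (hm : ForallPos I Γ (p ++ [m]))
    have hpΓ := hm.of_append
    by_cases he : Even p.length
    · have hL := (ForallPos.of_forall₂ hη hΔ hp).2 he
      rcases hm.snoc_cases with ⟨_, rfl⟩ | ⟨_, i, j, H, H', a, rfl, hH, hH', ha, he1, he2⟩ |
          ⟨_, i, H, rfl, hH, hx⟩ | ⟨_, i, H, rfl, hH, hna⟩ | ⟨h, _⟩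
      · rw [← hL.length_eq]
        exact .dropAt hp he
      · obtain ⟨K, hK, hKH⟩ := forall₂_getElem?_right hL hH
        obtain ⟨K', hK', hKH'⟩ := forall₂_getElem?_right hL hH'
        exact .em hp he hK hK' ha ((hKH.isEnd_iff _).2 he1) ((hKH'.isEnd_iff _).2 he2)
      · obtain ⟨K, hK, hKH⟩ := forall₂_getElem?_right hL hH
        refine .stopAt hp he hK ?_
        rcases hx with ⟨g, hg⟩ | ⟨a, ha, hg⟩
        · exact .inl ⟨g, (hKH.isEnd_iff _).2 hg⟩
        · rcases hKH.end_cases hg with h | ⟨b, h, hb⟩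
          · cases h
          · cases h
            exact absurd ((hη.1 _).1 (by simp [hb])) ha.2
      · obtain ⟨K, hK, hKH⟩ := forall₂_getElem?_right hL hH
        rw [← hL.length_eq]
        exact .just hp he hK (by rwa [hKH.isAtomic_iff])
      · exact absurd he h
    · rcases hm.snoc_cases with h | h | h | h | ⟨_, p', i, k, H, rfl, he', hH, hmH⟩
      · exact absurd h.1 he
      · exact absurd h.1 he
      · exact absurd h.1 he
      · exact absurd h.1 he
      · obtain ⟨K, hK, hKH⟩ :=
          forall₂_getElem?_right ((ForallPos.of_forall₂ hη hΔ hp.of_append).2 he') hH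
        have ht' : H.turn [] = .player := (forallGame_turn_just hpΓ.of_append he' hH).symm.trans ht
        exact .reply hp he' hK (hKH.player_closed (x := []) K.nil_mem ht' hmH)
  · intro p (hp : ForallPos I Δ p) _ ht
    obtain ⟨p', i, H, rfl, _, he', hH, hna, _⟩ :=
      ForallPos.of_turn_opponent (ForallPos.of_forall₂ hη hΔ hp).1 ht
    obtain ⟨K, hK, hKH⟩ :=
      forall₂_getElem?_right ((ForallPos.of_forall₂ hη hΔ hp.of_append).2 he') hH
    obtain ⟨m, hm⟩ := Game.exists_move_of_not_isAtomic (fun h => hna (hKH.isAtomic_iff.1 h))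
    exact ⟨m, .reply hp he' hK hm⟩
  · intro p (hp : ForallPos I Δ p) hl
    obtain ⟨q, hq, he, rfl | ⟨i, j, H, H', a, rfl, hH, hH', ha, he1, he2⟩ |
      ⟨i, H, rfl, hH, hx⟩⟩ := forallGame_leaf_cases hl
    · exact forallGame_label_dropAt _ _
    · exfalso
      have hL := (ForallPos.of_forall₂ hη hΔ hp.of_append).2 he
      obtain ⟨K, hK, hKH⟩ := forall₂_getElem?_right hL hH
      obtain ⟨K', hK', hKH'⟩ := forall₂_getElem?_right hL hH'
      rcases hKH.end_cases he1 with h | ⟨b, h, hb⟩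
      · cases h
      cases h
      rcases hKH'.end_cases he2 with h | ⟨b, h, hb'⟩
      · cases h
      cases h
      exact hη.not_both_opponent ha hb hb'
    · have hL := (ForallPos.of_forall₂ hη hΔ hp.of_append).2 he
      obtain ⟨K, hK, hKH⟩ := forall₂_getElem?_right hL hH
      rw [forallGame_label_stopAt hq he hH]
      rcases hx with ⟨g, hg⟩ | ⟨a, ha, hg⟩
      · rcases hKH.end_cases hg with h | ⟨b, h, hb⟩
        · rw [hg.2, h]
        · cases h
      · rcases hKH.end_cases hg with h | ⟨b, h, hb⟩
        · cases h
        · cases h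
          exact absurd ((hη.1 _).1 (by simp [hb])) ha.2
  · intro p hp
    refine ⟨fun k => (ForallPos.of_forall₂ hη hΔ (hp k)).1, fun i H hH q hq hqp => ?_⟩
    obtain ⟨K, hK, -, hKH⟩ := forall₂_getElem?_right hΔ' hH
    rw [← hΔ.length_eq] at hqp
    exact hKH (hqp.mem_branches hp hK)

/-! ### Parameters of `∀I.Γ` and substitution -/

theorem SelfDual.dual_mem (hI : SelfDual I) {a : Par} (ha : a ∈ I) : ParamDual.dual a ∈ I := by
  rw [← hI]
  exact ⟨a, ha, rfl⟩

theorem SelfDual.dual_mem_iff (hI : SelfDual I) {a : Par} : ParamDual.dual a ∈ I ↔ a ∈ I :=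
  ⟨fun h => by simpa [ParamDual.dual_dual] using hI.dual_mem h, hI.dual_mem⟩

theorem Game.dual_mem_FV {G : Game Par} {a : Par} (h : a ∈ G.FV) : ParamDual.dual a ∈ G.FV := by
  rcases h with h | ⟨b, h, rfl⟩
  · exact .inr ⟨a, h, rfl⟩
  · rw [ParamDual.dual_dual]
    exact .inl h

/-- Only `STOP` can produce a leaf labelled by a parameter, and it is not allowed at parameters of
`I`. Consequently the restriction of `ρ` to these parameters leaves `I` untouched. -/
theorem forallGame_FV_subset (hI : SelfDual I) (Γ : List (Game Par)) :
    (forallGame I Γ).FV ⊆ sequentFV Γ \ I := by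
  have key : ∀ {a}, (∃ x ∈ leaves (forallGame I Γ).positions,
      (forallGame I Γ).label x = .inr a) → a ∈ sequentFV Γ \ I := by
    rintro a ⟨x, hx, hxa⟩
    obtain ⟨q, hq, he, rfl | ⟨i, j, H, H', b, rfl, hH, hH', ha, he1, he2⟩ |
      ⟨i, H, rfl, hH, hy⟩⟩ := forallGame_leaf_cases hx
    · rw [forallGame_label_dropAt] at hxa; cases hxa
    · rw [forallGame_label_em] at hxa; cases hxa
    · rw [forallGame_label_stopAt hq he hH] at hxa
      rcases hy with ⟨g, hg⟩ | ⟨b, hb, hg⟩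
      · rw [hg.2] at hxa; cases hxa
      · rw [hg.2] at hxa; cases hxa; exact hb
  rintro a (h | ⟨b, h, rfl⟩)
  · exact key h
  · obtain ⟨⟨G, hG, hbG⟩, hb⟩ := key h
    exact ⟨⟨G, hG, Game.dual_mem_FV hbG⟩, fun h => hb (hI.dual_mem_iff.1 h)⟩

theorem mem_FV_forallGame_of_stopAt {p : List Move} (hp : ForallPos I Γ p) (he : Even p.length)
    {i : ℕ} {H : Game Par} (hH : (localPositions Γ p)[i]? = some H) {a : Par}
    (ha : a ∈ sequentFV Γ \ I) (hx : H.IsEnd (.inr a)) : a ∈ (forallGame I Γ).FV := by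
  refine .inl ⟨p ++ [.stopAt i], mem_leaves_of_odd (.stopAt hp he hH (.inr ⟨a, ha, hx⟩)) he
    (by simp), ?_⟩
  rw [forallGame_label_stopAt hp he hH, hx.2]

/-- Every position of a game in `Γ` becomes a local position in some play of `∀I.Γ`. -/
theorem exists_localPosition {G : Game Par} (hG : G ∈ Γ) {x : List Move}
    (hx : x ∈ G.positions) :
    ∃ (p : List Move) (k : ℕ), ForallPos I Γ p ∧ Even p.length ∧
      (localPositions Γ p)[k]? = some (G.sub x hx) := by
  induction x using List.reverseRecOn with
  | nil =>
    obtain ⟨k, hk⟩ := List.getElem?_of_mem hG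
    exact ⟨[], k, .nil, by simp, by simpa [Game.sub_nil] using hk⟩
  | append_singleton x m ih =>
    have hx' : x ∈ G.positions := G.isTreeSupport.2 _ _ (List.prefix_append _ _) hx
    obtain ⟨p, k, hp, he, hk⟩ := ih hx'
    have hm : [m] ∈ (G.sub x hx').positions := hx
    refine ⟨_, (localPositions Γ p).length, hp.reply_length he hk hm, ?_, ?_⟩
    · simpa [Nat.even_add] using he
    · rw [hp.localPositions_reply he hk hm]
      simp [Game.sub_sub]

/-- Some play of the quantified game makes this leaf a local position, and there Player can play
`STOP`. Hence a `∀I.Γ`-assignment has a value at every parameter outside `I` that labels a leaf of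
`Γ`. -/
theorem mem_FV_forallGame_of_leaf {G : Game Par} (hG : G ∈ Γ) {x : List Move}
    (hx : x ∈ leaves G.positions) {a : Par} (ha : G.label x = .inr a) (haI : a ∉ I) :
    a ∈ (forallGame I Γ).FV := by
  obtain ⟨p, k, hp, he, hk⟩ := exists_localPosition (I := I) hG hx.1
  refine mem_FV_forallGame_of_stopAt hp he hk ⟨⟨G, hG, .inl ⟨x, hx, ha⟩⟩, haI⟩ ?_
  exact ⟨(G.isAtomic_sub_iff hx.1).2 hx, by simpa [Game.sub] using ha⟩

theorem localPositions_map_assign (ρ : Par → Option Player) {p : List Move}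
    (hp : ForallPos I Γ p) (he : Even p.length) :
    ForallPos I (Γ.map fun G => G.assign ρ) p ∧
    localPositions (Γ.map fun G => G.assign ρ) p =
      (localPositions Γ p).map fun G => G.assign ρ := by
  refine ForallPos.even_induction (motive := fun p => ForallPos I (Γ.map fun G => G.assign ρ) p ∧
    localPositions (Γ.map fun G => G.assign ρ) p =
      (localPositions Γ p).map fun G => G.assign ρ) ?_ ?_ hp he
  · exact ⟨.nil, by simp⟩
  · rintro p i H m hp he hH hm ⟨hp', hL⟩
    have hH' : (localPositions (Γ.map fun G => G.assign ρ) p)[i]? = some (H.assign ρ) := by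
      simp [hL, hH]
    have := hp'.reply_length he hH' hm
    refine ⟨by simpa [hL] using this, ?_⟩
    rw [hp.localPositions_reply he hH hm, hp'.localPositions_reply he hH' hm, hL, List.map_append]
    rfl

/-- Complete rounds depend on the trees alone, not on the labels, so that substitution does not
affect them. -/
theorem even_forallPos_of_map_assign (ρ : Par → Option Player) {p : List Move}
    (hp : ForallPos I (Γ.map fun G => G.assign ρ) p) (he : Even p.length) : ForallPos I Γ p := by
  refine ForallPos.even_induction (motive := fun p => Even p.length → ForallPos I Γ p) ?_ ?_
    hp he he
  · exact fun _ => .nil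
  · rintro p i K m hp he hK hm ih -
    have hp' := ih he
    have hL := (localPositions_map_assign ρ hp' he).2
    rw [hL, List.getElem?_map, Option.map_eq_some_iff] at hK
    obtain ⟨H, hH, rfl⟩ := hK
    have := hp'.reply_length he hH hm
    simpa [hL] using this

variable {ρ : Par → Option Player}

theorem IsGameAssignment.restrict_eq_some (hρ : IsGameAssignment (forallGame I Γ) ρ) {a : Par}
    (ha : a ∈ (forallGame I Γ).FV) :
    ∃ g, ρ a = some g ∧ restrict ρ (forallGame I Γ).FV a = some g := by
  obtain ⟨J, -, hJ, hρ, -⟩ := hρ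
  obtain ⟨g, hg⟩ := Option.isSome_iff_exists.1 ((hρ a).2 (hJ ha))
  exact ⟨g, hg, by simp [restrict, ha, hg]⟩

theorem IsGameAssignment.restrict_eq_none_iff (hρ : IsGameAssignment (forallGame I Γ) ρ)
    {a : Par} : restrict ρ (forallGame I Γ).FV a = none ↔ a ∉ (forallGame I Γ).FV := by
  refine ⟨fun h ha => ?_, restrict_eq_none⟩
  obtain ⟨g, -, hg⟩ := hρ.restrict_eq_some ha
  rw [h] at hg
  cases hg

/-- The labels of the leaves of `ρ'(Γ)` are players or parameters in `I`. -/
theorem closedSequent_label (hρ : IsGameAssignment (forallGame I Γ) ρ) {G : Game Par}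
    (hG : G ∈ closedSequent I Γ ρ) {x : List Move} (hx : x ∈ leaves G.positions) {a : Par}
    (ha : G.label x = .inr a) : a ∈ I := by
  obtain ⟨G, hG', rfl⟩ := List.mem_map.1 hG
  obtain ⟨h1, h2⟩ := assignLabel_eq_inr ha
  by_contra haI
  exact hρ.restrict_eq_none_iff.1 h2 (mem_FV_forallGame_of_leaf hG' hx h1 haI)

theorem closedSequent_length : (closedSequent I Γ ρ).length = Γ.length := by
  simp [closedSequent]

theorem sequentFV_closedSequent_subset : sequentFV (closedSequent I Γ ρ) ⊆ sequentFV Γ := by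
  rintro a ⟨G, hG, ha⟩
  obtain ⟨G, hG', rfl⟩ := List.mem_map.1 hG
  have hsub : {a | ∃ x ∈ leaves (G.assign (restrict ρ (forallGame I Γ).FV)).positions,
      (G.assign (restrict ρ (forallGame I Γ).FV)).label x = .inr a} ⊆
      {a | ∃ x ∈ leaves G.positions, G.label x = .inr a} := by
    rintro b ⟨x, hx, hb⟩
    exact ⟨x, hx, (assignLabel_eq_inr hb).1⟩
  exact ⟨G, hG', Set.union_subset_union hsub (Set.image_mono hsub) ha⟩

/-- Labels matter only for a final `EM` or `STOP`. Parameters of `I` are not substituted, so `EM` is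
unaffected; a parameter outside `I` that permits `STOP` turns into a player, which permits it as
well. -/
theorem forallPos_closedSequent_iff (hI : SelfDual I)
    (hρ : IsGameAssignment (forallGame I Γ) ρ) {p : List Move} :
    ForallPos I (closedSequent I Γ ρ) p ↔ ForallPos I Γ p := by
  have hFV := forallGame_FV_subset hI Γ
  rcases List.eq_nil_or_concat' p with rfl | ⟨q, m, rfl⟩
  · exact ⟨fun _ => .nil, fun _ => .nil⟩
  by_cases hq : Even q.length
  swap
  · have he : Even (q ++ [m]).length := by simpa [Nat.even_add_one] using hq
    exact ⟨fun h => even_forallPos_of_map_assign _ h he,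
      fun h => (localPositions_map_assign _ h he).1⟩
  constructor
  · intro hm
    have hp' := hm.of_append
    have hp := even_forallPos_of_map_assign _ hp' hq
    have hL : localPositions (closedSequent I Γ ρ) q = _ := (localPositions_map_assign _ hp hq).2
    rcases hm.snoc_cases with ⟨_, rfl⟩ | ⟨_, i, j, K, K', a, rfl, hK, hK', ha, he, he'⟩ |
        ⟨_, i, K, rfl, hK, he⟩ | ⟨_, i, K, rfl, hK, hna⟩ | ⟨h, _⟩
    · rw [hL, List.length_map]
      exact .dropAt hp hq
    · rw [hL, List.getElem?_map, Option.map_eq_some_iff] at hK hK'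
      obtain ⟨H, hH, rfl⟩ := hK
      obtain ⟨H', hH', rfl⟩ := hK'
      exact .em hp hq hH hH' ha ⟨he.1, (assignLabel_eq_inr he.2).1⟩
        ⟨he'.1, (assignLabel_eq_inr he'.2).1⟩
    · rw [hL, List.getElem?_map, Option.map_eq_some_iff] at hK
      obtain ⟨H, hH, rfl⟩ := hK
      refine .stopAt hp hq hH ?_
      rcases he with ⟨g, hg⟩ | ⟨a, ha, hg⟩
      · rcases assignLabel_eq_inl hg.2 with h | ⟨a, h, ha⟩
        · exact .inl ⟨g, hg.1, h⟩
        -- The parameter has a value under the restricted assignment, so it is a parameter of the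
        -- quantified game and lies outside `I`.
        · refine .inr ⟨a, hFV ?_, hg.1, h⟩
          by_contra hn
          rw [restrict_eq_none hn] at ha
          cases ha
      · exact .inr ⟨a, ⟨sequentFV_closedSequent_subset ha.1, ha.2⟩, hg.1,
          (assignLabel_eq_inr hg.2).1⟩
    · rw [hL, List.getElem?_map, Option.map_eq_some_iff] at hK
      obtain ⟨H, hH, rfl⟩ := hK
      rw [hL, List.length_map]
      exact .just hp hq hH hna
    · exact absurd hq h
  · intro hm
    have hp := hm.of_append
    obtain ⟨hp', hL⟩ := localPositions_map_assign (restrict ρ (forallGame I Γ).FV) hp hq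
    change ForallPos I (closedSequent I Γ ρ) q at hp'
    change localPositions (closedSequent I Γ ρ) q = _ at hL
    have hget : ∀ {i : ℕ} {H : Game Par}, (localPositions Γ q)[i]? = some H →
        (localPositions (closedSequent I Γ ρ) q)[i]? =
          some (H.assign (restrict ρ (forallGame I Γ).FV)) := by
      intro i H hH
      simp [hL, hH]
    have hinr : ∀ {a}, a ∈ I → assignLabel (restrict ρ (forallGame I Γ).FV) (.inr a) = .inr a :=
      fun ha => assignLabel_inr_none (restrict_eq_none fun h => (hFV h).2 ha)
    rcases hm.snoc_cases with ⟨_, rfl⟩ | ⟨_, i, j, K, K', a, rfl, hK, hK', ha, he, he'⟩ |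
        ⟨_, i, K, rfl, hK, he⟩ | ⟨_, i, K, rfl, hK, hna⟩ | ⟨h, _⟩
    · have := ForallPos.dropAt hp' hq
      rwa [hL, List.length_map] at this
    · refine .em hp' hq (hget hK) (hget hK') ha ⟨he.1, ?_⟩ ⟨he'.1, ?_⟩
      · exact (congrArg (assignLabel _) he.2).trans (hinr ha)
      · exact (congrArg (assignLabel _) he'.2).trans (hinr (hI.dual_mem ha))
    · refine .stopAt hp' hq (hget hK) ?_
      rcases he with ⟨g, hg⟩ | ⟨a, ha, hg⟩
      · exact .inl ⟨g, hg.1, (congrArg (assignLabel _) hg.2).trans rfl⟩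
      · obtain ⟨g, -, hg'⟩ :=
          hρ.restrict_eq_some (mem_FV_forallGame_of_stopAt hp hq hK ha hg)
        exact .inl ⟨g, hg.1, (congrArg (assignLabel _) hg.2).trans (assignLabel_inr_some hg')⟩
    · have := ForallPos.just hp' hq (hget hK) hna
      rwa [hL, List.length_map] at this
    · exact absurd hq h

/-- `ρ(∀I.Γ)` is `∀I.ρ'(Γ)`. -/
theorem forallGame_assign_similar (hI : SelfDual I) (hρ : IsGameAssignment (forallGame I Γ) ρ) :
    ((forallGame I Γ).assign ρ).Similar (forallGame I (closedSequent I Γ ρ)) := by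
  have hpos : {p | ForallPos I Γ p} = {p | ForallPos I (closedSequent I Γ ρ) p} := by
    ext p
    exact (forallPos_closedSequent_iff hI hρ).symm
  have hget : ∀ {q : List Move} {i : ℕ} {H : Game Par}, ForallPos I Γ q → Even q.length →
      (localPositions Γ q)[i]? = some H →
      (localPositions (closedSequent I Γ ρ) q)[i]? =
        some (H.assign (restrict ρ (forallGame I Γ).FV)) := by
    intro q i H hq he hH
    have hL : localPositions (closedSequent I Γ ρ) q = _ := (localPositions_map_assign _ hq he).2
    simp [hL, hH]
  have hget' : ∀ {i : ℕ} {K : Game Par}, (closedSequent I Γ ρ)[i]? = some K →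
      ∃ H, Γ[i]? = some H ∧ K = H.assign (restrict ρ (forallGame I Γ).FV) := by
    intro i K hK
    rw [closedSequent, List.getElem?_map, Option.map_eq_some_iff] at hK
    obtain ⟨H, hH, rfl⟩ := hK
    exact ⟨H, hH, rfl⟩
  refine ⟨hpos, ?_, ?_, ?_⟩
  · intro p (hp : ForallPos I Γ p)
    have hp' := (forallPos_closedSequent_iff hI hρ).2 hp
    change (forallGame I Γ).turn p = _
    by_cases he : Even p.length
    · rw [forallGame_turn_even he, forallGame_turn_even he]
    rcases List.eq_nil_or_concat' p with rfl | ⟨q, m, rfl⟩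
    · simp at he
    have hq : Even q.length := by simpa [Nat.even_add_one] using he
    rcases hp.snoc_cases with ⟨_, rfl⟩ | ⟨_, _, _, _, _, _, rfl, _⟩ | ⟨_, _, _, rfl, _⟩ |
        ⟨_, i, H, rfl, hH, hna⟩ | ⟨h, _⟩
    · simp [forallGame]
    · simp [forallGame]
    · simp [forallGame]
    · rw [forallGame_turn_just hp.of_append hq hH,
        forallGame_turn_just hp'.of_append hq (hget hp.of_append hq hH)]
      rfl
    · exact absurd hq h
  · intro p hl
    have hl' : p ∈ leaves (forallGame I Γ).positions := hl
    change assignLabel ρ ((forallGame I Γ).label p) = _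
    obtain ⟨q, hq, he, rfl | ⟨i, j, H, H', b, rfl, hH, hH', ha, he1, he2⟩ |
      ⟨i, H, rfl, hH, hy⟩⟩ := forallGame_leaf_cases hl'
    · rw [forallGame_label_dropAt, forallGame_label_dropAt]; rfl
    · rw [forallGame_label_em, forallGame_label_em]; rfl
    · rw [forallGame_label_stopAt hq he hH, forallGame_label_stopAt
        ((forallPos_closedSequent_iff hI hρ).2 hq) he (hget hq he hH)]
      change _ = assignLabel _ (H.label [])
      rcases hy with ⟨g, hg⟩ | ⟨a, ha, hg⟩
      · rw [hg.2]; rfl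
      · obtain ⟨g, hg1, hg2⟩ := hρ.restrict_eq_some (mem_FV_forallGame_of_stopAt hq he hH ha hg)
        rw [hg.2, assignLabel_inr_some hg1, assignLabel_inr_some hg2]
  · funext g
    have hlen : (closedSequent I Γ ρ).length = Γ.length := closedSequent_length
    cases g
    · ext p
      constructor
      · rintro ⟨hp, i, H, hH, q, hq, hqp, hw⟩
        exact ⟨hpos ▸ hp, i, H.assign (restrict ρ (forallGame I Γ).FV), by simp [closedSequent, hH],
          q, hq, hlen.symm ▸ hqp, hw⟩
      · rintro ⟨hp, i, K, hK, q, hq, hqp, hw⟩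
        obtain ⟨H, hH, rfl⟩ := hget' hK
        exact ⟨hpos.symm ▸ hp, i, H, hH, q, hq, hlen ▸ hqp, hw⟩
    · ext p
      constructor
      · rintro ⟨hp, h⟩
        refine ⟨hpos ▸ hp, fun i K hK q hq hqp => ?_⟩
        obtain ⟨H, hH, rfl⟩ := hget' hK
        exact h i H hH q hq (hlen ▸ hqp)
      · rintro ⟨hp, h⟩
        exact ⟨hpos.symm ▸ hp, fun i H hH q hq hqp =>
          h i (H.assign (restrict ρ (forallGame I Γ).FV)) (by simp [closedSequent, hH]) q hq
            (hlen.symm ▸ hqp)⟩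

/-- `(ρ,η)(G)` is `η(ρ'(G))` for `G` in `Γ`. -/
theorem assign_overwrite_similar (hI : SelfDual I) (hρ : IsGameAssignment (forallGame I Γ) ρ)
    (hη : IsAssignment I η) {G : Game Par} (hG : G ∈ Γ) :
    (G.assign (overwrite ρ η)).Similar
      ((G.assign (restrict ρ (forallGame I Γ).FV)).assign η) := by
  refine ⟨rfl, fun _ _ => rfl, fun x hx => ?_, rfl⟩
  change assignLabel _ (G.label x) = assignLabel η (assignLabel _ (G.label x))
  cases hl : G.label x with
  | inl g => rfl
  | inr a =>
    -- On `I` the restriction of `ρ` is undefined and both sides are given by `η`; outside `I` it is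
    -- `η` that is undefined, and both sides are given by `ρ`.
    by_cases ha : a ∈ I
    · obtain ⟨g, hg⟩ := Option.isSome_iff_exists.1 ((hη.1 a).2 ha)
      rw [assignLabel_inr_none (ρ := restrict ρ (forallGame I Γ).FV) (restrict_eq_none
        fun h => (forallGame_FV_subset hI Γ h).2 ha), assignLabel_inr_some hg,
        assignLabel_inr_some (g := g) (by simp [overwrite, hg])]
    · obtain ⟨g, hg1, hg2⟩ := hρ.restrict_eq_some (mem_FV_forallGame_of_leaf hG hx hl ha)
      have hn : η a = none := by
        rw [← Option.not_isSome_iff_eq_none, hη.1]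
        exact ha
      rw [assignLabel_inr_some hg2, assignLabel_inr_some (g := g) (by simp [overwrite, hn, hg1])]
      rfl

end ParamGame

namespace ParamGame

variable {Par : Type*}

/-! ### The transitions of `EXH` -/

theorem Game.IsEnd.unique {H : Game Par} {x y : Player ⊕ Par} (hx : H.IsEnd x) (hy : H.IsEnd y) :
    x = y := hx.2.symm.trans hy.2

theorem IsFirstNewMove.unique {H : Game Par} {i : ℕ} {J : List (ℕ × Move × ℕ)} {m m' : Move}
    (h : IsFirstNewMove H i J m) (h' : IsFirstNewMove H i J m') : m = m' :=
  Encodable.encode_injective (le_antisymm (h.2 _ h'.1) (h'.2 _ h.1))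

theorem exists_isFirstNewMove {H : Game Par} {i : ℕ} {J : List (ℕ × Move × ℕ)}
    (h : ∃ m, IsNewMove H i J m) : ∃ m, IsFirstNewMove H i J m := by
  classical
  have hex : ∃ c, ∃ m, Encodable.encode m = c ∧ IsNewMove H i J m :=
    let ⟨m, hm⟩ := h
    ⟨_, m, rfl, hm⟩
  obtain ⟨m, hm, hnew⟩ := Nat.find_spec hex
  exact ⟨m, hnew, fun m' h' => hm ▸ Nat.find_min' hex ⟨m', rfl, h'⟩⟩

/-- A state of `EXH`: the next local position to be examined, the end of the current cycle, the
local positions and the justification relation. -/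
structure ExhState (Par : Type*) where
  cur : ℕ
  bound : ℕ
  locals : List (Game Par)
  rel : List (ℕ × Move × ℕ)

namespace ExhState

/-- The state passes to the examination of the next local position. -/
def next (s : ExhState Par) : ExhState Par := { s with cur := s.cur + 1 }

/-- The state after the beginning of a new cycle. -/
def restart (s : ExhState Par) : ExhState Par :=
  { s with cur := 0, bound := s.locals.length }

/-- The state after the move `m` in the current local position `H`. -/
def push (s : ExhState Par) (H : Game Par) (m : Move) (hm : [m] ∈ H.positions) : ExhState Par where
  cur := s.cur + 1
  bound := s.bound
  locals := s.locals ++ [H.sub [m] hm]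
  rel := s.rel ++ [(s.cur, m, s.locals.length)]

/-- The states in which the numbers are in range. -/
structure Valid (s : ExhState Par) : Prop where
  cur_le : s.cur ≤ s.bound
  bound_le : s.bound ≤ s.locals.length

theorem Valid.next {s : ExhState Par} (hs : s.Valid) (h : s.cur < s.bound) : s.next.Valid :=
  ⟨h, hs.bound_le⟩

theorem Valid.push {s : ExhState Par} (hs : s.Valid) (h : s.cur < s.bound) {H : Game Par}
    {m : Move} (hm : [m] ∈ H.positions) : (s.push H m hm).Valid :=
  ⟨h, by simpa [ExhState.push] using hs.bound_le.trans (Nat.le_succ _)⟩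

theorem restart_valid (s : ExhState Par) : s.restart.Valid := ⟨Nat.zero_le _, le_rfl⟩

end ExhState

variable [ParamDual Par] {I : Set Par} {Γ : List (Game Par)}

theorem EMClause.isAtomic {p j : ℕ} {L : List (Game Par)} {H : Game Par}
    (h : EMClause I p L H j) : H.IsAtomic := by
  obtain ⟨a, ha, h, -⟩ := h
  exact h.1

theorem EMClause.not_isEnd_inl {p j : ℕ} {L : List (Game Par)} {H : Game Par}
    (h : EMClause I p L H j) (g : Player) : ¬ H.IsEnd (.inl g) := by
  obtain ⟨a, ha, h, -⟩ := h
  intro h'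
  cases h.unique h'

theorem EMClause.unique {p j j' : ℕ} {L : List (Game Par)} {H : Game Par}
    (h : EMClause I p L H j) (h' : EMClause I p L H j') : j = j' := by
  obtain ⟨a, ha, h1, h2, ⟨K, hK, hKa⟩, h3⟩ := h
  obtain ⟨b, hb, h1', h2', ⟨K', hK', hKb⟩, h3'⟩ := h'
  cases h1.unique h1'
  rcases lt_trichotomy j j' with hj | hj | hj
  · exact absurd hKa (h3' j hj K hK)
  · exact hj
  · exact absurd hKb (h3 j' hj K' hK')

/-- If a dual pair of parameters in `I` is available, then `EXH` finds one. -/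
theorem exists_EMClause {p j : ℕ} {L : List (Game Par)} {H K : Game Par} {a : Par} (ha : a ∈ I)
    (hH : H.IsEnd (.inr a)) (hj : j < p) (hK : L[j]? = some K)
    (hKa : K.IsEnd (.inr (ParamDual.dual a))) : ∃ j, EMClause I p L H j := by
  classical
  have hex : ∃ j, ∃ K : Game Par, L[j]? = some K ∧ K.IsEnd (.inr (ParamDual.dual a)) :=
    ⟨j, K, hK, hKa⟩
  refine ⟨Nat.find hex, a, ha, hH, (Nat.find_min' hex ⟨K, hK, hKa⟩).trans_lt hj,
    Nat.find_spec hex, fun j' hj' K' hK' h => Nat.find_min hex hj' ⟨K', hK', h⟩⟩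

/-! ### Inversion of `Exh`: determinism of the strategy. -/

section Iff

variable {i p : ℕ} {L : List (Game Par)} {J : List (ℕ × Move × ℕ)} {r : List Move} {H : Game Par}

theorem exh_repeat_iff (h : p < L.length) : Exh I p p L J r ↔ Exh I 0 L.length L J r := by
  refine ⟨fun hr => ?_, .repeat_ h⟩
  cases hr <;> first | assumption | omega

theorem exh_dropAt_iff :
    Exh I L.length L.length L J r ↔ r = [] ∨ r = [.dropAt L.length] := by
  refine ⟨fun hr => ?_, .dropAt⟩
  generalize hp : L.length = p at hr
  generalize hi : p = i at hr
  cases hr <;> first | (subst hp; assumption) | omega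

/-- The guards of the different cases exclude each other, so only the clause at hand can have
produced the play; `EMClause.unique` identifies the move. The lemmas for the other cases follow the
same pattern. -/
theorem exh_em_iff (hi : i < p) (hH : L[i]? = some H) {j : ℕ} (hj : EMClause I p L H j) :
    Exh I i p L J r ↔ r = [] ∨ r = [.em i j] := by
  refine ⟨fun hr => ?_, .em hi hH hj⟩
  have hat := hj.isAtomic
  cases hr with
  | repeat_ => omega
  | dropAt => omega
  | em h1 h2 h3 h4 =>
    rw [hH] at h2; cases h2; rwa [hj.unique h3]
  | stopAt h1 h2 h3 => rw [hH] at h2; cases h2; exact absurd h3 (hj.not_isEnd_inl _)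
  | skip h1 h2 h3 h4 => rw [hH] at h2; cases h2; exact absurd ⟨j, hj⟩ h4
  | player_just h1 h2 h3 => rw [hH] at h2; cases h2; exact absurd hat h3
  | player_move h1 h2 h3 => rw [hH] at h2; cases h2; exact absurd hat h3
  | player_skip h1 h2 h3 => rw [hH] at h2; cases h2; exact absurd hat h3
  | opponent_just h1 h2 h3 => rw [hH] at h2; cases h2; exact absurd hat h3
  | opponent_move h1 h2 h3 => rw [hH] at h2; cases h2; exact absurd hat h3
  | opponent_skip h1 h2 h3 => rw [hH] at h2; cases h2; exact absurd hat h3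

theorem exh_stopAt_iff (hi : i < p) (hH : L[i]? = some H) (hx : H.IsEnd (.inl .player)) :
    Exh I i p L J r ↔ r = [] ∨ r = [.stopAt i] := by
  refine ⟨fun hr => ?_, .stopAt hi hH hx⟩
  have hat := hx.1
  cases hr with
  | repeat_ => omega
  | dropAt => omega
  | em h1 h2 h3 h4 => rw [hH] at h2; cases h2; exact absurd hx (h3.not_isEnd_inl _)
  | stopAt h1 h2 h3 h4 => exact h4
  | skip h1 h2 h3 h4 h5 => rw [hH] at h2; cases h2; exact absurd hx h5
  | player_just h1 h2 h3 => rw [hH] at h2; cases h2; exact absurd hat h3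
  | player_move h1 h2 h3 => rw [hH] at h2; cases h2; exact absurd hat h3
  | player_skip h1 h2 h3 => rw [hH] at h2; cases h2; exact absurd hat h3
  | opponent_just h1 h2 h3 => rw [hH] at h2; cases h2; exact absurd hat h3
  | opponent_move h1 h2 h3 => rw [hH] at h2; cases h2; exact absurd hat h3
  | opponent_skip h1 h2 h3 => rw [hH] at h2; cases h2; exact absurd hat h3

theorem exh_skip_iff (hi : i < p) (hH : L[i]? = some H) (hat : H.IsAtomic)
    (hem : ¬ ∃ j, EMClause I p L H j) (hx : ¬ H.IsEnd (.inl .player)) :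
    Exh I i p L J r ↔ Exh I (i + 1) p L J r := by
  refine ⟨fun hr => ?_, .skip hi hH hat hem hx⟩
  cases hr with
  | repeat_ => omega
  | dropAt => omega
  | em h1 h2 h3 h4 => rw [hH] at h2; cases h2; exact absurd ⟨_, h3⟩ hem
  | stopAt h1 h2 h3 h4 => rw [hH] at h2; cases h2; exact absurd h3 hx
  | skip h1 h2 h3 h4 h5 h6 => exact h6
  | player_just h1 h2 h3 => rw [hH] at h2; cases h2; exact absurd hat h3
  | player_move h1 h2 h3 => rw [hH] at h2; cases h2; exact absurd hat h3
  | player_skip h1 h2 h3 => rw [hH] at h2; cases h2; exact absurd hat h3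
  | opponent_just h1 h2 h3 => rw [hH] at h2; cases h2; exact absurd hat h3
  | opponent_move h1 h2 h3 => rw [hH] at h2; cases h2; exact absurd hat h3
  | opponent_skip h1 h2 h3 => rw [hH] at h2; cases h2; exact absurd hat h3

theorem exh_player_move_iff (hi : i < p) (hH : L[i]? = some H) (hna : ¬ H.IsAtomic)
    (ht : H.turn [] = .player) {m : Move} (hm : IsFirstNewMove H i J m)
    (hmp : [m] ∈ H.positions) :
    Exh I i p L J r ↔ r = [] ∨ r = [.just i L.length] ∨ ∃ r', r = .just i L.length :: m :: r' ∧
      Exh I (i + 1) p (L ++ [H.sub [m] hmp]) (J ++ [(i, m, L.length)]) r' := by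
  constructor
  · intro hr
    cases hr with
    | repeat_ => omega
    | dropAt => omega
    | em h1 h2 h3 h4 => rw [hH] at h2; cases h2; exact absurd h3.isAtomic hna
    | stopAt h1 h2 h3 h4 => rw [hH] at h2; cases h2; exact absurd h3.1 hna
    | skip h1 h2 h3 => rw [hH] at h2; cases h2; exact absurd h3 hna
    | player_just h1 h2 h3 h4 h5 h6 => exact h6.imp_right .inl
    | player_move h1 h2 h3 h4 h5 h6 h7 =>
      rw [hH] at h2; cases h2; cases hm.unique h5; exact .inr (.inr ⟨_, rfl, h7⟩)
    | player_skip h1 h2 h3 h4 h5 => rw [hH] at h2; cases h2; exact absurd ⟨m, hm.1⟩ h5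
    | opponent_just h1 h2 h3 h4 => rw [hH] at h2; cases h2; rw [ht] at h4; cases h4
    | opponent_move h1 h2 h3 h4 => rw [hH] at h2; cases h2; rw [ht] at h4; cases h4
    | opponent_skip h1 h2 h3 h4 => rw [hH] at h2; cases h2; rw [ht] at h4; cases h4
  · rintro (h | h | ⟨r', rfl, h⟩)
    · exact .player_just hi hH hna ht hm (.inl h)
    · exact .player_just hi hH hna ht hm (.inr h)
    · exact .player_move hi hH hna ht hm hmp h

theorem exh_player_skip_iff (hi : i < p) (hH : L[i]? = some H) (hna : ¬ H.IsAtomic)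
    (ht : H.turn [] = .player) (hm : ¬ ∃ m, IsNewMove H i J m) :
    Exh I i p L J r ↔ Exh I (i + 1) p L J r := by
  refine ⟨fun hr => ?_, .player_skip hi hH hna ht hm⟩
  cases hr with
  | repeat_ => omega
  | dropAt => omega
  | em h1 h2 h3 h4 => rw [hH] at h2; cases h2; exact absurd h3.isAtomic hna
  | stopAt h1 h2 h3 h4 => rw [hH] at h2; cases h2; exact absurd h3.1 hna
  | skip h1 h2 h3 => rw [hH] at h2; cases h2; exact absurd h3 hna
  | player_just h1 h2 h3 h4 h5 => rw [hH] at h2; cases h2; exact absurd ⟨_, h5.1⟩ hm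
  | player_move h1 h2 h3 h4 h5 => rw [hH] at h2; cases h2; exact absurd ⟨_, h5.1⟩ hm
  | player_skip h1 h2 h3 h4 h5 h6 => exact h6
  | opponent_just h1 h2 h3 h4 => rw [hH] at h2; cases h2; rw [ht] at h4; cases h4
  | opponent_move h1 h2 h3 h4 => rw [hH] at h2; cases h2; rw [ht] at h4; cases h4
  | opponent_skip h1 h2 h3 h4 => rw [hH] at h2; cases h2; rw [ht] at h4; cases h4

theorem exh_opponent_move_iff (hi : i < p) (hH : L[i]? = some H) (hna : ¬ H.IsAtomic)
    (ht : H.turn [] = .opponent) (hJ : ∀ m, [m] ∈ H.positions → ∀ k, (i, m, k) ∉ J) :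
    Exh I i p L J r ↔ r = [] ∨ r = [.just i L.length] ∨
      ∃ m r', ∃ hm : [m] ∈ H.positions, r = .just i L.length :: m :: r' ∧
      Exh I (i + 1) p (L ++ [H.sub [m] hm]) (J ++ [(i, m, L.length)]) r' := by
  constructor
  · intro hr
    cases hr with
    | repeat_ => omega
    | dropAt => omega
    | em h1 h2 h3 h4 => rw [hH] at h2; cases h2; exact absurd h3.isAtomic hna
    | stopAt h1 h2 h3 h4 => rw [hH] at h2; cases h2; exact absurd h3.1 hna
    | skip h1 h2 h3 => rw [hH] at h2; cases h2; exact absurd h3 hna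
    | player_just h1 h2 h3 h4 => rw [hH] at h2; cases h2; rw [ht] at h4; cases h4
    | player_move h1 h2 h3 h4 => rw [hH] at h2; cases h2; rw [ht] at h4; cases h4
    | player_skip h1 h2 h3 h4 => rw [hH] at h2; cases h2; rw [ht] at h4; cases h4
    | opponent_just h1 h2 h3 h4 h5 h6 => exact h6.imp_right .inl
    | opponent_move h1 h2 h3 h4 h5 h6 h7 =>
      rw [hH] at h2; cases h2; exact .inr (.inr ⟨_, _, h6, rfl, h7⟩)
    | opponent_skip h1 h2 h3 h4 h5 =>
      rw [hH] at h2; cases h2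
      obtain ⟨m, hm, k, hk⟩ := h5
      exact absurd hk (hJ m hm k)
  · rintro (h | h | ⟨m, r', hm, rfl, h⟩)
    · exact .opponent_just hi hH hna ht hJ (.inl h)
    · exact .opponent_just hi hH hna ht hJ (.inr h)
    · exact .opponent_move hi hH hna ht hJ hm h

theorem exh_opponent_skip_iff (hi : i < p) (hH : L[i]? = some H) (hna : ¬ H.IsAtomic)
    (ht : H.turn [] = .opponent) (hJ : ∃ m, [m] ∈ H.positions ∧ ∃ k, (i, m, k) ∈ J) :
    Exh I i p L J r ↔ Exh I (i + 1) p L J r := by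
  refine ⟨fun hr => ?_, .opponent_skip hi hH hna ht hJ⟩
  obtain ⟨m, hm, k, hk⟩ := hJ
  cases hr with
  | repeat_ => omega
  | dropAt => omega
  | em h1 h2 h3 h4 => rw [hH] at h2; cases h2; exact absurd h3.isAtomic hna
  | stopAt h1 h2 h3 h4 => rw [hH] at h2; cases h2; exact absurd h3.1 hna
  | skip h1 h2 h3 => rw [hH] at h2; cases h2; exact absurd h3 hna
  | player_just h1 h2 h3 h4 => rw [hH] at h2; cases h2; rw [ht] at h4; cases h4
  | player_move h1 h2 h3 h4 => rw [hH] at h2; cases h2; rw [ht] at h4; cases h4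
  | player_skip h1 h2 h3 h4 => rw [hH] at h2; cases h2; rw [ht] at h4; cases h4
  | opponent_just h1 h2 h3 h4 h5 => rw [hH] at h2; cases h2; exact absurd hk (h5 m hm k)
  | opponent_move h1 h2 h3 h4 h5 => rw [hH] at h2; cases h2; exact absurd hk (h5 m hm k)
  | opponent_skip h1 h2 h3 h4 h5 h6 => exact h6

end Iff

namespace ExhState

/-- The plays of `EXH` from the state `s`. -/
def Plays (I : Set Par) (s : ExhState Par) (r : List Move) : Prop :=
  Exh I s.cur s.bound s.locals s.rel r

/-- What `EXH` does in a state. -/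
inductive Action (I : Set Par) (s : ExhState Par) : Prop
  | restart : s.cur = s.bound → s.bound < s.locals.length →
      (∀ r, s.Plays I r ↔ s.restart.Plays I r) → Action I s
  | dropAt : s.cur = s.bound → s.bound = s.locals.length →
      (∀ r, s.Plays I r ↔ r = [] ∨ r = [.dropAt s.locals.length]) → Action I s
  | em {H : Game Par} {j : ℕ} : s.cur < s.bound → s.locals[s.cur]? = some H →
      EMClause I s.bound s.locals H j →
      (∀ r, s.Plays I r ↔ r = [] ∨ r = [.em s.cur j]) → Action I s
  | stopAt {H : Game Par} : s.cur < s.bound → s.locals[s.cur]? = some H → H.IsEnd (.inl .player) →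
      (∀ r, s.Plays I r ↔ r = [] ∨ r = [.stopAt s.cur]) → Action I s
  | skip {H : Game Par} : s.cur < s.bound → s.locals[s.cur]? = some H → H.IsAtomic →
      (¬ ∃ j, EMClause I s.bound s.locals H j) → ¬ H.IsEnd (.inl .player) →
      (∀ r, s.Plays I r ↔ s.next.Plays I r) → Action I s
  | player_move {H : Game Par} {m : Move} (hm : [m] ∈ H.positions) : s.cur < s.bound →
      s.locals[s.cur]? = some H → ¬ H.IsAtomic → H.turn [] = .player →
      IsFirstNewMove H s.cur s.rel m →
      (∀ r, s.Plays I r ↔ r = [] ∨ r = [.just s.cur s.locals.length] ∨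
        ∃ r', r = .just s.cur s.locals.length :: m :: r' ∧ (s.push H m hm).Plays I r') → Action I s
  | player_skip {H : Game Par} : s.cur < s.bound → s.locals[s.cur]? = some H → ¬ H.IsAtomic →
      H.turn [] = .player → (¬ ∃ m, IsNewMove H s.cur s.rel m) →
      (∀ r, s.Plays I r ↔ s.next.Plays I r) → Action I s
  | opponent_move {H : Game Par} : s.cur < s.bound → s.locals[s.cur]? = some H → ¬ H.IsAtomic →
      H.turn [] = .opponent → (∀ m, [m] ∈ H.positions → ∀ k, (s.cur, m, k) ∉ s.rel) →
      (∀ r, s.Plays I r ↔ r = [] ∨ r = [.just s.cur s.locals.length] ∨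
        ∃ m r', ∃ hm : [m] ∈ H.positions,
          r = .just s.cur s.locals.length :: m :: r' ∧ (s.push H m hm).Plays I r') → Action I s
  | opponent_skip {H : Game Par} : s.cur < s.bound → s.locals[s.cur]? = some H → ¬ H.IsAtomic →
      H.turn [] = .opponent → (∃ m, [m] ∈ H.positions ∧ ∃ k, (s.cur, m, k) ∈ s.rel) →
      (∀ r, s.Plays I r ↔ s.next.Plays I r) → Action I s

/-- The guards are also exhaustive. Validity is needed for the current index to be that of an
existing local position. -/
theorem Valid.action {s : ExhState Par} (hs : s.Valid) (I : Set Par) : s.Action I := by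
  classical
  rcases hs.cur_le.eq_or_lt with hi | hi
  · rcases hs.bound_le.eq_or_lt with hp | hp
    · refine .dropAt hi hp fun r => ?_
      rw [Plays, hi, hp]
      exact exh_dropAt_iff
    · refine .restart hi hp fun r => ?_
      rw [Plays, hi]
      exact exh_repeat_iff hp
  obtain ⟨H, hH⟩ : ∃ H, s.locals[s.cur]? = some H :=
    ⟨_, List.getElem?_eq_getElem (hi.trans_le hs.bound_le)⟩
  by_cases hat : H.IsAtomic
  · by_cases hem : ∃ j, EMClause I s.bound s.locals H j
    · obtain ⟨j, hj⟩ := hem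
      exact .em hi hH hj fun r => exh_em_iff hi hH hj
    by_cases hx : H.IsEnd (.inl .player)
    · exact .stopAt hi hH hx fun r => exh_stopAt_iff hi hH hx
    · exact .skip hi hH hat hem hx fun r => exh_skip_iff hi hH hat hem hx
  rcases Player.eq_player_or_opponent (H.turn []) with ht | ht
  · by_cases hnew : ∃ m, IsNewMove H s.cur s.rel m
    · obtain ⟨m, hm⟩ := exists_isFirstNewMove hnew
      exact .player_move hm.1.1 hi hH hat ht hm fun r => exh_player_move_iff hi hH hat ht hm hm.1.1
    · exact .player_skip hi hH hat ht hnew fun r => exh_player_skip_iff hi hH hat ht hnew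
  · by_cases hJ : ∃ m, [m] ∈ H.positions ∧ ∃ k, (s.cur, m, k) ∈ s.rel
    · exact .opponent_skip hi hH hat ht hJ fun r => exh_opponent_skip_iff hi hH hat ht hJ
    · have hJ' : ∀ m, [m] ∈ H.positions → ∀ k, (s.cur, m, k) ∉ s.rel :=
        fun m hm k hk => hJ ⟨m, hm, k, hk⟩
      exact .opponent_move hi hH hat ht hJ' fun r => exh_opponent_move_iff hi hH hat ht hJ'

/-- In every state `EXH` makes a move. -/
theorem Valid.exists_plays_singleton {s : ExhState Par} (hs : s.Valid) (I : Set Par) :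
    ∃ m, s.Plays I [m] := by
  -- This measure drops at every transition without a move. Passing to the next position lowers the
  -- second summand; a new cycle replaces a first summand of at least `s.locals.length + 1` by a
  -- second summand of `s.locals.length`.
  induction hn : (s.locals.length - s.bound) * (s.locals.length + 1) + (s.bound - s.cur)
    using Nat.strong_induction_on generalizing s with
  | _ n ih =>
  subst hn
  have hnext : s.cur < s.bound → (∀ r, s.Plays I r ↔ s.next.Plays I r) → ∃ m, s.Plays I [m] := by
    intro hi h
    obtain ⟨m, hm⟩ := ih _ (by simp only [ExhState.next]; omega) (hs.next hi) rfl
    exact ⟨m, (h _).2 hm⟩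
  cases hs.action I with
  | restart hi hp h =>
    obtain ⟨m, hm⟩ := ih _ (by
      simp only [ExhState.restart, Nat.sub_self, Nat.zero_mul, Nat.sub_zero, zero_add]
      have : 1 * (s.locals.length + 1) ≤ (s.locals.length - s.bound) * (s.locals.length + 1) :=
        Nat.mul_le_mul_right _ (by omega)
      omega) s.restart_valid rfl
    exact ⟨m, (h _).2 hm⟩
  | dropAt hi hp h => exact ⟨_, (h _).2 (.inr rfl)⟩
  | em hi hH hj h => exact ⟨_, (h _).2 (.inr rfl)⟩
  | stopAt hi hH hx h => exact ⟨_, (h _).2 (.inr rfl)⟩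
  | skip hi hH h1 h2 h3 h => exact hnext hi h
  | player_move hm hi hH h1 h2 h3 h => exact ⟨_, (h _).2 (.inr (.inl rfl))⟩
  | player_skip hi hH h1 h2 h3 h => exact hnext hi h
  | opponent_move hi hH h1 h2 h3 h => exact ⟨_, (h _).2 (.inr (.inl rfl))⟩
  | opponent_skip hi hH h1 h2 h3 h => exact hnext hi h

end ExhState

/-- A play cut off right after a justification move is admitted by the `just` clause, which has the
same guard as the corresponding `move` clause. -/
theorem exh_of_prefix {i p : ℕ} {L : List (Game Par)} {J : List (ℕ × Move × ℕ)} {r r' : List Move}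
    (h : Exh I i p L J r) (hr : r' <+: r) : Exh I i p L J r' := by
  have short : ∀ {m : Move} {r r' : List Move}, r = [] ∨ r = [m] → r' <+: r →
      r' = [] ∨ r' = [m] := by
    rintro m r r' (rfl | rfl) h
    · exact .inl (List.prefix_nil.1 h)
    · rcases List.prefix_cons_iff.1 h with rfl | ⟨t, rfl, ht⟩
      · exact .inl rfl
      · rw [List.prefix_nil.1 ht]; exact .inr rfl
  have long : ∀ {m m' : Move} {r r' : List Move}, r' <+: m :: m' :: r →
      (r' = [] ∨ r' = [m]) ∨ ∃ t, r' = m :: m' :: t ∧ t <+: r := by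
    intro m m' r r' h
    rcases List.prefix_cons_iff.1 h with rfl | ⟨t, rfl, ht⟩
    · exact .inl (.inl rfl)
    · rcases List.prefix_cons_iff.1 ht with rfl | ⟨t', rfl, ht'⟩
      · exact .inl (.inr rfl)
      · exact .inr ⟨t', rfl, ht'⟩
  induction h generalizing r' with
  | repeat_ h _ ih => exact .repeat_ h (ih hr)
  | dropAt h => exact .dropAt (short h hr)
  | em h1 h2 h3 h => exact .em h1 h2 h3 (short h hr)
  | stopAt h1 h2 h3 h => exact .stopAt h1 h2 h3 (short h hr)
  | skip h1 h2 h3 h4 h5 _ ih => exact .skip h1 h2 h3 h4 h5 (ih hr)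
  | player_just h1 h2 h3 h4 h5 h => exact .player_just h1 h2 h3 h4 h5 (short h hr)
  | player_move h1 h2 h3 h4 h5 h6 _ ih =>
    rcases long hr with h | ⟨t, rfl, ht⟩
    · exact .player_just h1 h2 h3 h4 h5 h
    · exact .player_move h1 h2 h3 h4 h5 h6 (ih ht)
  | player_skip h1 h2 h3 h4 h5 _ ih => exact .player_skip h1 h2 h3 h4 h5 (ih hr)
  | opponent_just h1 h2 h3 h4 h5 h => exact .opponent_just h1 h2 h3 h4 h5 (short h hr)
  | opponent_move h1 h2 h3 h4 h5 h6 _ ih =>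
    rcases long hr with h | ⟨t, rfl, ht⟩
    · exact .opponent_just h1 h2 h3 h4 h5 h
    · exact .opponent_move h1 h2 h3 h4 h5 h6 (ih ht)
  | opponent_skip h1 h2 h3 h4 h5 _ ih => exact .opponent_skip h1 h2 h3 h4 h5 (ih hr)

theorem ExhState.Plays.of_prefix {s : ExhState Par} {r r' : List Move} (h : s.Plays I r)
    (hr : r' <+: r) : s.Plays I r' := exh_of_prefix h hr

theorem ExhState.Valid.plays_nil {s : ExhState Par} (hs : s.Valid) (I : Set Par) :
    s.Plays I [] := by
  obtain ⟨m, hm⟩ := hs.exists_plays_singleton I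
  exact hm.of_prefix (List.nil_prefix)

end ParamGame

namespace ParamGame

/-! ### Refutations -/

section Refutation

variable {Par : Type*} [ParamDual Par]

/-- The record of a lost play against an exhaustive strategy: local positions, numbered by some
natural numbers, and a justification relation, such that all choices of Player are explored and
Opponent loses nowhere. -/
structure Refutation (I : Set Par) (Γ : List (Game Par)) where
  IsLocal : ℕ → Game Par → Prop
  Rel : ℕ → Move → ℕ → Prop
  isLocal_unique {k H H'} : IsLocal k H → IsLocal k H' → H = H'
  start {i G} : Γ[i]? = some G → IsLocal i G
  rel_sub {k m l} : Rel k m l → ∃ H, ∃ hm : [m] ∈ H.positions, IsLocal k H ∧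
    IsLocal l (H.sub [m] hm)
  rel_unique {k m l l'} : Rel k m l → Rel k m l' → l = l'
  not_isEnd_player {k H} : IsLocal k H → ¬ H.IsEnd (.inl .player)
  not_isEnd_dual {k H l K a} : a ∈ I → IsLocal k H → IsLocal l K → H.IsEnd (.inr a) →
    ¬ K.IsEnd (.inr (ParamDual.dual a))
  player_moves {k H m} : IsLocal k H → H.turn [] = .player → [m] ∈ H.positions → ∃ l, Rel k m l
  opponent_move {k H} : IsLocal k H → ¬ H.IsAtomic → H.turn [] = .opponent → ∃ m l, Rel k m l
  won {i G} {q : Stream' Move} {s : ℕ → ℕ} : Γ[i]? = some G → q ∈ branches G.positions → s 0 = i →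
    (∀ t, Rel (s t) (q.get t) (s (t + 1))) → q ∈ G.won .opponent

namespace Refutation

variable {I : Set Par} {Γ : List (Game Par)}

/-- `x` leads from the local position number `i` to the local position number `l`. -/
inductive Chain (R : Refutation I Γ) (i : ℕ) : List Move → ℕ → Prop
  | nil : Chain R i [] i
  | snoc {x l m l'} : Chain R i x l → R.Rel l m l' → Chain R i (x ++ [m]) l'

theorem Chain.snoc_cases {R : Refutation I Γ} {i l' : ℕ} {x : List Move} {m : Move}
    (h : R.Chain i (x ++ [m]) l') : ∃ l, R.Chain i x l ∧ R.Rel l m l' := by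
  generalize hy : x ++ [m] = y at h
  cases h with
  | nil => simp at hy
  | snoc h1 h2 =>
    obtain ⟨rfl, h⟩ := List.append_inj' hy rfl
    simp only [List.cons.injEq, and_true] at h
    subst h
    exact ⟨_, h1, h2⟩

/-- From a given local position each move is recorded at most once, so the moves determine the
numbers along a chain. -/
theorem Chain.unique {R : Refutation I Γ} {i : ℕ} {x : List Move} {l l' : ℕ}
    (h : R.Chain i x l) (h' : R.Chain i x l') : l = l' := by
  induction h generalizing l' with
  | nil =>
    generalize hy : ([] : List Move) = y at h'
    cases h' with
    | nil => rfl
    | snoc _ _ => simp at hy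
  | snoc _ h2 ih =>
    obtain ⟨l₁, h3, h4⟩ := h'.snoc_cases
    rw [ih h3] at h2
    exact R.rel_unique h2 h4

/-- Chains identify positions of `G` with local positions; this carries the clauses of a refutation
over to the conditions on a strategy in `G`. -/
theorem Chain.isLocal {R : Refutation I Γ} {i : ℕ} {G : Game Par} (hG : Γ[i]? = some G)
    {x : List Move} {l : ℕ} (h : R.Chain i x l) :
    ∃ hx : x ∈ G.positions, R.IsLocal l (G.sub x hx) := by
  induction h with
  | nil => exact ⟨G.nil_mem, by rw [Game.sub_nil]; exact R.start hG⟩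
  | snoc _ h2 ih =>
    obtain ⟨hx, hl⟩ := ih
    obtain ⟨H, hm, hH, hH'⟩ := R.rel_sub h2
    obtain rfl := R.isLocal_unique hH hl
    rw [Game.sub_sub] at hH'
    exact ⟨hm, hH'⟩

/-- The strategy of Opponent in the game number `i`. -/
def strategy (R : Refutation I Γ) (i : ℕ) : Set (List Move) := {x | ∃ l, R.Chain i x l}

theorem strategy_isTreeSupport (R : Refutation I Γ) (i : ℕ) : IsTreeSupport (R.strategy i) := by
  refine ⟨⟨i, .nil⟩, ?_⟩
  rintro x y hxy ⟨l, hl⟩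
  induction hl with
  | nil => rw [List.prefix_nil.1 hxy]; exact ⟨i, .nil⟩
  | snoc h1 h2 ih =>
    rcases List.prefix_concat_iff.1 hxy with rfl | hx
    · exact ⟨_, .snoc h1 h2⟩
    · exact ih hx

/-- Each prefix of the branch comes with a chain of its own. As the moves determine the end of a
chain, these chains fit together into one infinite chain, to which the clause `won` applies. -/
theorem strategy_branch (R : Refutation I Γ) {i : ℕ} {G : Game Par} (hG : Γ[i]? = some G)
    {q : Stream' Move} (hq : q ∈ branches (R.strategy i)) : q ∈ G.won .opponent := by
  choose s hs using hq
  refine R.won (s := s) hG (fun k => ((hs k).isLocal hG).1) ((hs 0).unique .nil) fun t => ?_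
  have := hs (t + 1)
  rw [Stream'.take_succ'] at this
  obtain ⟨l, h1, h2⟩ := this.snoc_cases
  rwa [(hs t).unique h1]

open Classical in
/-- The assignment falsifying all parameters met in a refutation. -/
noncomputable def assignment [Encodable Par] (R : Refutation I Γ) : Par → Option Player := fun a =>
  if a ∈ I then some (
    if ∃ k H, R.IsLocal k H ∧ H.IsEnd (.inr a) then .opponent
    else if ∃ k H, R.IsLocal k H ∧ H.IsEnd (.inr (ParamDual.dual a)) then .player
    else if Encodable.encode a < Encodable.encode (ParamDual.dual a) then .player
    else .opponent)
  else none

/-- A refutation does not meet both parameters of a dual pair of `I`, so the values forced on the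
parameters met are consistent. If neither is met, the smaller code decides; the codes differ because
the involution has no fixed points. -/
theorem assignment_isAssignment [Encodable Par] (R : Refutation I Γ) (hI : SelfDual I) :
    IsAssignment I R.assignment := by
  refine ⟨fun a => by simp [assignment], fun a ha => ?_⟩
  have hne : Encodable.encode (ParamDual.dual a) ≠ Encodable.encode a :=
    fun h => ParamDual.dual_ne a (Encodable.encode_injective h)
  simp only [assignment, ha, hI.dual_mem ha, if_true, ParamDual.dual_dual, Option.map_some]
  by_cases h1 : ∃ k H, R.IsLocal k H ∧ H.IsEnd (.inr a)
  · have h2 : ¬ ∃ k H, R.IsLocal k H ∧ H.IsEnd (.inr (ParamDual.dual a)) := by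
      rintro ⟨l, K, hK, hKa⟩
      obtain ⟨k, H, hH, hHa⟩ := h1
      exact R.not_isEnd_dual ha hH hK hHa hKa
    simp [h1, h2, ParamDual.dual_dual]
  · by_cases h2 : ∃ k H, R.IsLocal k H ∧ H.IsEnd (.inr (ParamDual.dual a))
    · simp [h1, h2]
    · rcases lt_or_gt_of_ne hne with h | h
      · simp [h1, h2, h, h.not_gt, ParamDual.dual_dual]
      · simp [h1, h2, h, h.not_gt, ParamDual.dual_dual]

/-- A refutation yields winning strategies of Opponent. -/
theorem isWinning_strategy [Encodable Par] (R : Refutation I Γ)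
    (hΓ : ∀ G ∈ Γ, ∀ x ∈ leaves G.positions, ∀ a, G.label x = .inr a → a ∈ I) {i : ℕ}
    {G : Game Par} (hG : Γ[i]? = some G) :
    (G.assign R.assignment).IsWinning .opponent (R.strategy i) := by
  refine ⟨⟨⟨⟨⟨R.strategy_isTreeSupport i, fun x ⟨l, hl⟩ => (hl.isLocal hG).1⟩, ?_⟩, ?_⟩, ?_⟩,
    fun q hq => R.strategy_branch hG hq⟩
  · rintro x ⟨l, hl⟩ ht m hm
    obtain ⟨hx, hloc⟩ := hl.isLocal hG
    obtain ⟨l', hl'⟩ := R.player_moves (m := m) hloc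
      (by simpa [Game.sub, Game.assign] using ht) hm
    exact ⟨l', .snoc hl hl'⟩
  · rintro x ⟨l, hl⟩ hleaf ht
    obtain ⟨hx, hloc⟩ := hl.isLocal hG
    obtain ⟨m, l', hl'⟩ := R.opponent_move hloc (by rwa [G.isAtomic_sub_iff hx])
      (by simpa [Game.sub, Game.assign] using ht)
    exact ⟨m, l', .snoc hl hl'⟩
  · rintro x ⟨l, hl⟩ hleaf
    obtain ⟨hx, hloc⟩ := hl.isLocal hG
    have hat := (G.isAtomic_sub_iff hx).2 hleaf
    have hlab : (G.sub x hx).label [] = G.label x := by simp [Game.sub]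
    change assignLabel _ (G.label x) = _
    cases hx' : G.label x with
    | inl g =>
      rcases Player.eq_player_or_opponent g with rfl | rfl
      · exact absurd ⟨hat, hlab.trans hx'⟩ (R.not_isEnd_player hloc)
      · rfl
    | inr a =>
      have ha : a ∈ I := hΓ G (List.mem_of_getElem? hG) x hleaf a hx'
      apply assignLabel_inr_some
      have : ∃ k H, R.IsLocal k H ∧ H.IsEnd (.inr a) := ⟨l, _, hloc, hat, hlab.trans hx'⟩
      simp [assignment, ha, this]

end Refutation

end Refutation

/-! ### The states reached in a play of `EXH` -/

variable {Par : Type*} [ParamDual Par] {I : Set Par} {Γ : List (Game Par)}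

namespace ExhState

/-- Nothing remains to be done with the local position number `k`. -/
structure Saturated (I : Set Par) (s : ExhState Par) (k : ℕ) : Prop where
  not_isEnd_player {H} : s.locals[k]? = some H → ¬ H.IsEnd (.inl .player)
  not_isEnd_dual {H a l K} : s.locals[k]? = some H → a ∈ I → H.IsEnd (.inr a) → l < s.bound →
    s.locals[l]? = some K → ¬ K.IsEnd (.inr (ParamDual.dual a))
  player_moves {H m} : s.locals[k]? = some H → H.turn [] = .player → [m] ∈ H.positions →
    ∃ l, (k, m, l) ∈ s.rel
  opponent_move {H} : s.locals[k]? = some H → ¬ H.IsAtomic → H.turn [] = .opponent →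
    ∃ m l, (k, m, l) ∈ s.rel

/-- `s` is the state of `EXH` at some stage after the moves `p` have been played. -/
structure Reached (I : Set Par) (Γ : List (Game Par)) (p : List Move) (s : ExhState Par) :
    Prop where
  valid : s.Valid
  pos : ForallPos I Γ p
  even : Even p.length
  locals_eq : s.locals = localPositions Γ p
  plays_iff : ∀ r, p ++ r ∈ EXH I Γ ↔ s.Plays I r
  rel_sub {k m l} : (k, m, l) ∈ s.rel → k < l ∧ ∃ H, ∃ hm : [m] ∈ H.positions,
    s.locals[k]? = some H ∧ s.locals[l]? = some (H.sub [m] hm)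
  rel_unique {k m l l'} : (k, m, l) ∈ s.rel → (k, m, l') ∈ s.rel → l = l'
  rel_justifies {k m l} : (k, m, l) ∈ s.rel → ∃ t, l = Γ.length + t ∧
    p[2 * t]? = some (.just k l) ∧ p[2 * t + 1]? = some m
  saturated {k} : s.locals.length = s.bound → k < s.cur → s.Saturated I k

/-- The initial state. -/
def init (Γ : List (Game Par)) : ExhState Par := ⟨0, Γ.length, Γ, []⟩

theorem reached_init (I : Set Par) (Γ : List (Game Par)) : Reached I Γ [] (init Γ) where
  valid := ⟨Nat.zero_le _, le_rfl⟩
  pos := .nil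
  even := by simp
  locals_eq := by simp [init]
  plays_iff r := Iff.rfl
  rel_sub h := by simp [init] at h
  rel_unique h := by simp [init] at h
  rel_justifies h := by simp [init] at h
  saturated _ h := by simp [init] at h

namespace Reached

variable {p : List Move} {s : ExhState Par}

theorem restart (h : Reached I Γ p s) (hr : ∀ r, s.Plays I r ↔ s.restart.Plays I r) :
    Reached I Γ p s.restart where
  valid := s.restart_valid
  pos := h.pos
  even := h.even
  locals_eq := h.locals_eq
  plays_iff r := (h.plays_iff r).trans (hr r)
  rel_sub := h.rel_sub
  rel_unique := h.rel_unique
  rel_justifies := h.rel_justifies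
  saturated _ hk := by simp [ExhState.restart] at hk

/-- The condition `s.locals.length = s.bound` means that no move has been made since the cycle
began. Passing on changes neither the local positions nor the relation, so the earlier positions
stay saturated and the current one joins them. -/
theorem next (h : Reached I Γ p s) (hi : s.cur < s.bound) (hs : s.Saturated I s.cur)
    (hr : ∀ r, s.Plays I r ↔ s.next.Plays I r) : Reached I Γ p s.next where
  valid := h.valid.next hi
  pos := h.pos
  even := h.even
  locals_eq := h.locals_eq
  plays_iff r := (h.plays_iff r).trans (hr r)
  rel_sub := h.rel_sub
  rel_unique := h.rel_unique
  rel_justifies := h.rel_justifies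
  saturated {k} hl hk := by
    rcases Nat.lt_succ_iff_lt_or_eq.1 hk with hk | rfl
    · have := h.saturated hl hk
      exact ⟨this.1, this.2, this.3, this.4⟩
    · exact ⟨hs.1, hs.2, hs.3, hs.4⟩

theorem length_locals (h : Reached I Γ p s) : s.locals.length = Γ.length + p.length / 2 := by
  rw [h.locals_eq, h.pos.length_localPositions h.even]

/-- Novelty of the move keeps the relation functional. The new local position gets the next free
number, which exceeds that of its origin, so numbers increase along chains; it also equals
`Γ.length` plus the number of rounds played, as `Justifies` demands. -/
theorem push (h : Reached I Γ p s) (hi : s.cur < s.bound) {H : Game Par}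
    (hH : s.locals[s.cur]? = some H) {m : Move} (hm : [m] ∈ H.positions)
    (hnew : ∀ k, (s.cur, m, k) ∉ s.rel)
    (hr : ∀ r, s.Plays I (.just s.cur s.locals.length :: m :: r) ↔ (s.push H m hm).Plays I r) :
    Reached I Γ (p ++ [.just s.cur s.locals.length, m]) (s.push H m hm) := by
  have hH' : (localPositions Γ p)[s.cur]? = some H := h.locals_eq ▸ hH
  have hcur : s.cur < s.locals.length := hi.trans_le h.valid.bound_le
  have hlen : p.length = 2 * (p.length / 2) := (Nat.two_mul_div_two_of_even h.even).symm
  refine ⟨h.valid.push hi hm, ?_, ?_, ?_, fun r => ?_, ?_, ?_, ?_, ?_⟩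
  · have := h.pos.reply_length h.even hH' hm
    rwa [← h.locals_eq] at this
  · simpa [Nat.even_add] using h.even
  · rw [h.pos.localPositions_reply h.even hH' hm, ← h.locals_eq]
    rfl
  · rw [List.append_assoc, h.plays_iff]
    exact hr r
  · intro k m' l hmem
    simp only [ExhState.push, List.mem_append, List.mem_singleton, Prod.mk.injEq] at hmem
    rcases hmem with hmem | ⟨rfl, rfl, rfl⟩
    · obtain ⟨h1, K, hK, h2, h3⟩ := h.rel_sub hmem
      exact ⟨h1, K, hK, getElem?_eq_some_of_prefix (List.prefix_append _ _) h2,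
        getElem?_eq_some_of_prefix (List.prefix_append _ _) h3⟩
    · exact ⟨hcur, H, hm, getElem?_eq_some_of_prefix (List.prefix_append _ _) hH,
        by simp [ExhState.push]⟩
  · intro k m' l l' hl hl'
    simp only [ExhState.push, List.mem_append, List.mem_singleton, Prod.mk.injEq] at hl hl'
    rcases hl with hl | ⟨rfl, rfl, rfl⟩ <;> rcases hl' with hl' | ⟨h1, h2, rfl⟩
    · exact h.rel_unique hl hl'
    · subst h1 h2; exact absurd hl (hnew _)
    · exact absurd hl' (hnew _)
    · rfl
  · intro k m' l hmem
    simp only [ExhState.push, List.mem_append, List.mem_singleton, Prod.mk.injEq] at hmem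
    rcases hmem with hmem | ⟨rfl, rfl, rfl⟩
    · obtain ⟨t, h1, h2, h3⟩ := h.rel_justifies hmem
      exact ⟨t, h1, getElem?_eq_some_of_prefix (List.prefix_append _ _) h2,
        getElem?_eq_some_of_prefix (List.prefix_append _ _) h3⟩
    · refine ⟨p.length / 2, h.length_locals, ?_, ?_⟩
      · rw [← hlen]; simp
      · rw [← hlen]; simp
  -- A move leaves more local positions than the bound of the cycle, so nothing is claimed about
  -- saturation.
  · intro k hl
    have := h.valid.bound_le
    simp [ExhState.push] at hl
    omega

end Reached

/-- `EXH` passes over a local position only if the guard for acting there fails, and this failure is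
saturation. For an atomic position the guards are those of `EM` and `STOP`; the two lemmas that
follow treat the positions of Player and of Opponent. -/
theorem saturated_of_isAtomic {s : ExhState Par} {H : Game Par} (hH : s.locals[s.cur]? = some H)
    (hat : H.IsAtomic) (hem : ¬ ∃ j, EMClause I s.bound s.locals H j)
    (hx : ¬ H.IsEnd (.inl .player)) : s.Saturated I s.cur where
  not_isEnd_player h := by rw [hH] at h; cases h; exact hx
  not_isEnd_dual h ha hHa hl hK hKa := by
    rw [hH] at h; cases h; exact hem (exists_EMClause ha hHa hl hK hKa)
  player_moves h _ hm := by
    rw [hH] at h; cases h; exact absurd hat (Game.not_isAtomic_of_mem hm)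
  opponent_move h hna := by rw [hH] at h; cases h; exact absurd hat hna

theorem saturated_of_player {s : ExhState Par} {H : Game Par} (hH : s.locals[s.cur]? = some H)
    (hna : ¬ H.IsAtomic) (ht : H.turn [] = .player) (hm : ¬ ∃ m, IsNewMove H s.cur s.rel m) :
    s.Saturated I s.cur where
  not_isEnd_player h := by rw [hH] at h; cases h; exact fun hx => hna hx.1
  not_isEnd_dual h _ hHa := by rw [hH] at h; cases h; exact absurd hHa.1 hna
  player_moves {H' m} h _ hmp := by
    rw [hH] at h; cases h
    by_contra! hn
    exact hm ⟨m, hmp, hn⟩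
  opponent_move h _ ht' := by rw [hH] at h; cases h; rw [ht] at ht'; cases ht'

theorem saturated_of_opponent {s : ExhState Par} {H : Game Par} (hH : s.locals[s.cur]? = some H)
    (hna : ¬ H.IsAtomic) (ht : H.turn [] = .opponent)
    (hJ : ∃ m, [m] ∈ H.positions ∧ ∃ k, (s.cur, m, k) ∈ s.rel) : s.Saturated I s.cur where
  not_isEnd_player h := by rw [hH] at h; cases h; exact fun hx => hna hx.1
  not_isEnd_dual h _ hHa := by rw [hH] at h; cases h; exact absurd hHa.1 hna
  player_moves h ht' := by rw [hH] at h; cases h; rw [ht] at ht'; cases ht'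
  opponent_move h _ _ := by
    obtain ⟨m, -, k, hk⟩ := hJ
    exact ⟨m, k, hk⟩

/-- `m` is the move of `EXH` in the state `s`. -/
inductive Active (I : Set Par) (s : ExhState Par) : Move → Prop
  | dropAt : s.cur = s.bound → s.bound = s.locals.length →
      (∀ r, s.Plays I r → r = [] ∨ r = [.dropAt s.locals.length]) →
      Active I s (.dropAt s.locals.length)
  | em {H : Game Par} {j : ℕ} : s.locals[s.cur]? = some H → EMClause I s.bound s.locals H j →
      (∀ r, s.Plays I r → r = [] ∨ r = [.em s.cur j]) → Active I s (.em s.cur j)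
  | stopAt {H : Game Par} : s.locals[s.cur]? = some H → H.IsEnd (.inl .player) →
      (∀ r, s.Plays I r → r = [] ∨ r = [.stopAt s.cur]) → Active I s (.stopAt s.cur)
  | player_move {H : Game Par} : s.locals[s.cur]? = some H → ¬ H.IsAtomic → H.turn [] = .player →
      (∃ m, s.Plays I [.just s.cur s.locals.length, m]) → Active I s (.just s.cur s.locals.length)
  | opponent_move {H : Game Par} : s.locals[s.cur]? = some H → ¬ H.IsAtomic →
      H.turn [] = .opponent →
      (∀ m, [m] ∈ H.positions → s.Plays I [.just s.cur s.locals.length, m]) →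
      Active I s (.just s.cur s.locals.length)

/-- A play of `EXH` ends in a state in which `EXH` has a move, or with this move. -/
theorem Reached.exists_active {p r : List Move} {s : ExhState Par} (hs : Reached I Γ p s)
    (hr : p ++ r ∈ EXH I Γ) : ∃ p' s' m, Reached I Γ p' s' ∧ s'.Active I m ∧ s'.Plays I [m] ∧
      (p ++ r = p' ∨ p ++ r = p' ++ [m]) := by
  -- The outer induction is on the moves still to be read, the inner one on the measure which
  -- decreases at transitions without a move.
  induction hlen : r.length using Nat.strong_induction_on generalizing p r s with
  | _ n ih =>
  subst hlen
  induction hn : (s.locals.length - s.bound) * (s.locals.length + 1) + (s.bound - s.cur)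
    using Nat.strong_induction_on generalizing s with
  | _ N ih' =>
  subst hn
  have hnext : s.cur < s.bound → s.Saturated I s.cur → (∀ r, s.Plays I r ↔ s.next.Plays I r) →
      ∃ p' s' m, Reached I Γ p' s' ∧ s'.Active I m ∧ s'.Plays I [m] ∧
        (p ++ r = p' ∨ p ++ r = p' ++ [m]) := fun hi hsat h =>
    ih' _ (by simp only [ExhState.next]; omega) (hs.next hi hsat h) rfl
  have hplay := (hs.plays_iff r).1 hr
  have term : ∀ {m}, s.Active I m → (∀ r, s.Plays I r ↔ r = [] ∨ r = [m]) →
      ∃ p' s' m, Reached I Γ p' s' ∧ s'.Active I m ∧ s'.Plays I [m] ∧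
        (p ++ r = p' ∨ p ++ r = p' ++ [m]) := by
    intro m hact h
    refine ⟨p, s, m, hs, hact, (h _).2 (.inr rfl), ?_⟩
    exact ((h r).1 hplay).imp (fun h => by simp [h]) (fun h => by simp [h])
  cases hs.valid.action I with
  | restart hi hp h =>
    refine ih' _ ?_ (hs.restart h) rfl
    simp only [ExhState.restart, Nat.sub_self, Nat.zero_mul, Nat.sub_zero, zero_add]
    have : 1 * (s.locals.length + 1) ≤ (s.locals.length - s.bound) * (s.locals.length + 1) :=
      Nat.mul_le_mul_right _ (by omega)
    omega
  | dropAt hi hp h => exact term (.dropAt hi hp fun r => (h r).1) h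
  | em hi hH hj h => exact term (.em hH hj fun r => (h r).1) h
  | stopAt hi hH hx h => exact term (.stopAt hH hx fun r => (h r).1) h
  | skip hi hH h1 h2 h3 h => exact hnext hi (saturated_of_isAtomic hH h1 h2 h3) h
  | player_move hm hi hH h1 h2 h3 h =>
    have hact : s.Active I (.just s.cur s.locals.length) := .player_move hH h1 h2 ⟨_, (h _).2
      (.inr (.inr ⟨[], rfl, (hs.valid.push hi hm).plays_nil I⟩))⟩
    have hpl : s.Plays I [.just s.cur s.locals.length] := (h _).2 (.inr (.inl rfl))
    rcases (h r).1 hplay with rfl | rfl | ⟨r', rfl, hr'⟩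
    · exact ⟨p, s, _, hs, hact, hpl, .inl (by simp)⟩
    · exact ⟨p, s, _, hs, hact, hpl, .inr rfl⟩
    · have := hs.push hi hH hm h3.1.2 fun r => by simp [h]
      obtain ⟨p', s', m', a1, a2, a3, a4⟩ := ih r'.length (by simp) (r := r') this
        (by simpa using hr) rfl
      exact ⟨p', s', m', a1, a2, a3, by simpa using a4⟩
  | player_skip hi hH h1 h2 h3 h => exact hnext hi (saturated_of_player hH h1 h2 h3) h
  | opponent_move hi hH h1 h2 h3 h =>
    have hact : s.Active I (.just s.cur s.locals.length) := .opponent_move hH h1 h2 fun m hm =>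
      (h _).2 (.inr (.inr ⟨m, [], hm, rfl, (hs.valid.push hi hm).plays_nil I⟩))
    have hpl : s.Plays I [.just s.cur s.locals.length] := (h _).2 (.inr (.inl rfl))
    rcases (h r).1 hplay with rfl | rfl | ⟨m, r', hm, rfl, hr'⟩
    · exact ⟨p, s, _, hs, hact, hpl, .inl (by simp)⟩
    · exact ⟨p, s, _, hs, hact, hpl, .inr rfl⟩
    · have := hs.push hi hH hm (h3 m hm) fun r => by
        rw [h]
        constructor
        · rintro (h | h | ⟨m', r', hm', h, h'⟩)
          · simp at h
          · simp at h
          · simp at h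
            obtain ⟨rfl, rfl⟩ := h
            exact h'
        · exact fun h => .inr (.inr ⟨m, r, hm, rfl, h⟩)
      obtain ⟨p', s', m', a1, a2, a3, a4⟩ := ih r'.length (by simp) (r := r') this
        (by simpa using hr) rfl
      exact ⟨p', s', m', a1, a2, a3, by simpa using a4⟩
  | opponent_skip hi hH h1 h2 h3 h => exact hnext hi (saturated_of_opponent hH h1 h2 h3) h

theorem exists_active_of_mem_EXH {r : List Move} (hr : r ∈ EXH I Γ) :
    ∃ p s m, Reached I Γ p s ∧ s.Active I m ∧ s.Plays I [m] ∧ (r = p ∨ r = p ++ [m]) := by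
  simpa using (reached_init I Γ).exists_active (r := r) (by simpa using hr)

theorem Reached.forallPos_active {p : List Move} {s : ExhState Par} (hs : Reached I Γ p s)
    {m : Move} (hm : s.Active I m) : ForallPos I Γ (p ++ [m]) := by
  cases hm with
  | dropAt hi hp => rw [hs.locals_eq]; exact .dropAt hs.pos hs.even
  | em hH hj =>
    obtain ⟨a, ha, hHa, hjp, ⟨K, hK, hKa⟩, -⟩ := hj
    rw [hs.locals_eq] at hH hK
    exact .em hs.pos hs.even hH hK ha hHa hKa
  | stopAt hH hx => rw [hs.locals_eq] at hH; exact .stopAt hs.pos hs.even hH (.inl ⟨_, hx⟩)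
  | player_move hH hna => rw [hs.locals_eq] at hH ⊢; exact .just hs.pos hs.even hH hna
  | opponent_move hH hna => rw [hs.locals_eq] at hH ⊢; exact .just hs.pos hs.even hH hna

end ExhState

open ExhState

theorem EXH_subset : EXH I Γ ⊆ {p | ForallPos I Γ p} := by
  intro r hr
  obtain ⟨p, s, m, hs, hact, -, rfl | rfl⟩ := exists_active_of_mem_EXH hr
  · exact hs.pos
  · exact hs.forallPos_active hact

/-- `EXH` is a total strategy of Player. -/
theorem EXH_isTotal : (forallGame I Γ).IsTotal .player (EXH I Γ) := by
  refine ⟨⟨⟨⟨(reached_init I Γ).valid.plays_nil I, fun x y hxy hy => exh_of_prefix hy hxy⟩,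
    EXH_subset⟩, ?_⟩, ?_⟩
  · intro r hr ht m hm
    obtain ⟨q, i, K, hq, hqp, hqe, hK, -, hKt⟩ := ForallPos.of_turn_opponent (EXH_subset hr) ht
    obtain ⟨p, s, m₀, hs, hact, -, rfl | rfl⟩ := exists_active_of_mem_EXH hr
    · rw [forallGame_turn_even hs.even] at ht
      cases ht
    · obtain ⟨rfl, hm₀⟩ := List.append_inj' hq rfl
      simp only [List.cons.injEq, and_true] at hm₀
      subst hm₀
      rcases ForallPos.snoc_cases hm with h | h | h | h | ⟨_, p', i', k', H', heq, -, hH', hmH⟩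
      · exact absurd h.1 (by simp [Nat.even_add_one, hqe])
      · exact absurd h.1 (by simp [Nat.even_add_one, hqe])
      · exact absurd h.1 (by simp [Nat.even_add_one, hqe])
      · exact absurd h.1 (by simp [Nat.even_add_one, hqe])
      obtain ⟨rfl, h'⟩ := List.append_inj' heq rfl
      simp only [List.cons.injEq, Move.just.injEq, and_true] at h'
      obtain ⟨rfl, -⟩ := h'
      generalize hjm : Move.just i (localPositions Γ p).length = jm at hact
      cases hact with
      | dropAt => cases hjm
      | em => cases hjm
      | stopAt => cases hjm
      | player_move hH hna ht' =>
        rw [hs.locals_eq] at hH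
        obtain ⟨rfl, -⟩ := Move.just.inj hjm
        rw [hH] at hK
        cases hK
        rw [ht'] at hKt
        cases hKt
      | opponent_move hH hna ht' h =>
        rw [hs.locals_eq] at hH
        obtain ⟨rfl, -⟩ := Move.just.inj hjm
        rw [hH] at hK hH'
        cases hK
        cases hH'
        rw [List.append_assoc, hs.plays_iff]
        exact h m hmH
  · intro r hr hl ht
    obtain ⟨p, s, m₀, hs, hact, hpl, rfl | rfl⟩ := exists_active_of_mem_EXH hr
    · exact ⟨m₀, (hs.plays_iff _).2 hpl⟩
    · have hpos := hs.forallPos_active hact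
      cases hact with
      | dropAt => exact absurd (mem_leaves_of_odd hpos hs.even (by simp)) hl
      | em => exact absurd (mem_leaves_of_odd hpos hs.even (by simp)) hl
      | stopAt => exact absurd (mem_leaves_of_odd hpos hs.even (by simp)) hl
      | player_move hH hna ht' h =>
        obtain ⟨m, hm⟩ := h
        exact ⟨m, by rw [List.append_assoc]; exact (hs.plays_iff _).2 hm⟩
      | opponent_move hH hna ht' h =>
        rw [hs.locals_eq] at hH
        rw [forallGame_turn_just hs.pos hs.even hH, ht'] at ht
        cases ht

/-! ### Lost plays of `EXH` -/

/-- A finite play lost by `EXH` yields a refutation. -/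
theorem exists_refutation_of_dropAt {p : List Move} {s : ExhState Par} (hs : Reached I Γ p s)
    (hi : s.cur = s.bound) (hp : s.bound = s.locals.length) : Nonempty (Refutation I Γ) := by
  have hlt : ∀ {k : ℕ} {H : Game Par}, s.locals[k]? = some H → k < s.cur := by
    intro k H hk
    rw [hi, hp]
    exact (List.getElem?_eq_some_iff.1 hk).1
  -- When `EXH` drops, a complete cycle over all local positions has passed without a move, so all
  -- of them are saturated.
  have hsat : ∀ {k : ℕ} {H : Game Par}, s.locals[k]? = some H → s.Saturated I k :=
    fun hk => hs.saturated hp.symm (hlt hk)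
  refine ⟨{ IsLocal := fun k H => s.locals[k]? = some H
            Rel := fun k m l => (k, m, l) ∈ s.rel
            isLocal_unique := fun h h' => by rw [h] at h'; cases h'; rfl
            start := ?_
            rel_sub := fun h => (hs.rel_sub h).2
            rel_unique := hs.rel_unique
            not_isEnd_player := fun h => (hsat h).not_isEnd_player h
            not_isEnd_dual := fun ha h h' hH =>
              (hsat h).not_isEnd_dual h ha hH (by rw [← hi]; exact hlt h') h'
            player_moves := fun h => (hsat h).player_moves h
            opponent_move := fun h => (hsat h).opponent_move h
            won := ?_ }⟩
  · intro i G hG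
    have hpre : Γ <+: localPositions Γ p := by
      refine ForallPos.even_induction (motive := fun p => Γ <+: localPositions Γ p) ?_ ?_
        hs.pos hs.even
      · simp
      · intro p i H m hp he hH hm ih
        rw [hp.localPositions_reply he hH hm]
        exact ih.trans (List.prefix_append _ _)
    rw [hs.locals_eq]
    exact getElem?_eq_some_of_prefix hpre hG
  -- There are no infinite chains: their numbers increase strictly, while all local positions have
  -- numbers below `s.cur`.
  · intro i G q t _ _ _ ht
    have hmono : StrictMono t := strictMono_nat_of_lt_succ fun k => (hs.rel_sub (ht k)).1
    obtain ⟨-, H, -, hH, -⟩ := hs.rel_sub (ht s.cur)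
    exact absurd (hlt hH) (hmono.le_apply).not_gt

/-- The steps of `EXH` in an infinite play. -/
inductive ExhStep (I : Set Par) (s : ExhState Par) : ExhState Par → Prop
  | restart : s.cur = s.bound → ExhStep I s s.restart
  | next : s.cur < s.bound → s.Saturated I s.cur → ExhStep I s s.next
  | push {H : Game Par} {m : Move} (hm : [m] ∈ H.positions) : s.cur < s.bound →
      s.locals[s.cur]? = some H →
      (H.turn [] = .player → IsFirstNewMove H s.cur s.rel m) → ExhStep I s (s.push H m hm)

/-- The play continues by two more moves, which rules out the actions that end a play. Every other
action leaves the part already read unchanged or lengthens it by two moves. -/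
theorem ExhState.Reached.exists_step {P : Stream' Move} (hP : P ∈ branches (EXH I Γ)) {k : ℕ}
    {s : ExhState Par} (hs : Reached I Γ (P.take k) s) :
    ∃ k' s', Reached I Γ (P.take k') s' ∧ ExhStep I s s' := by
  have htake : P.take (k + 2) = P.take k ++ [P.get k, P.get (k + 1)] := by
    rw [Stream'.take_succ' (k + 1), Stream'.take_succ' k, List.append_assoc]
    rfl
  have hpl : s.Plays I [P.get k, P.get (k + 1)] := by
    rw [← hs.plays_iff, ← htake]
    exact hP _
  have term : ∀ {m}, ¬ (∀ r, s.Plays I r ↔ r = [] ∨ r = [m]) := by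
    intro m h
    simpa using (h _).1 hpl
  cases hs.valid.action I with
  | restart hi hp h => exact ⟨k, _, hs.restart h, .restart hi⟩
  | dropAt hi hp h => exact absurd h term
  | em hi hH hj h => exact absurd h term
  | stopAt hi hH hx h => exact absurd h term
  | skip hi hH h1 h2 h3 h =>
    have hsat := saturated_of_isAtomic (I := I) hH h1 h2 h3
    exact ⟨k, _, hs.next hi hsat h, .next hi hsat⟩
  | player_move hm hi hH h1 h2 h3 h =>
    have h' := (h _).1 hpl
    simp only [List.cons_ne_nil, List.cons.injEq, and_false, false_or] at h'
    obtain ⟨r', ⟨e1, e2, -⟩, -⟩ := h'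
    refine ⟨k + 2, _, ?_, .push hm hi hH fun _ => h3⟩
    rw [htake, e1, e2]
    exact hs.push hi hH hm h3.1.2 fun r => by simp [h]
  | player_skip hi hH h1 h2 h3 h =>
    have hsat := saturated_of_player (I := I) hH h1 h2 h3
    exact ⟨k, _, hs.next hi hsat h, .next hi hsat⟩
  | opponent_move hi hH h1 h2 h3 h =>
    have h' := (h _).1 hpl
    simp only [List.cons_ne_nil, List.cons.injEq, and_false, false_or] at h'
    obtain ⟨m, r', hm, ⟨e1, e2, -⟩, -⟩ := h'
    refine ⟨k + 2, _, ?_, .push hm hi hH fun ht => by rw [h2] at ht; cases ht⟩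
    rw [htake, e1, e2]
    refine hs.push hi hH hm (h3 m hm) fun r => ?_
    rw [h]
    constructor
    · rintro (h | h | ⟨m', r', hm', h, h'⟩)
      · simp at h
      · simp at h
      · simp at h
        obtain ⟨rfl, rfl⟩ := h
        exact h'
    · exact fun h => .inr (.inr ⟨m, r, hm, rfl, h⟩)
  | opponent_skip hi hH h1 h2 h3 h =>
    have hsat := saturated_of_opponent (I := I) hH h1 h2 h3
    exact ⟨k, _, hs.next hi hsat h, .next hi hsat⟩

theorem ExhStep.locals_prefix {s s' : ExhState Par} (h : ExhStep I s s') :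
    s.locals <+: s'.locals := by
  cases h with
  | restart => exact List.prefix_rfl
  | next => exact List.prefix_rfl
  | push hm => exact List.prefix_append _ _

theorem ExhStep.rel_subset {s s' : ExhState Par} (h : ExhStep I s s') {x : ℕ × Move × ℕ}
    (hx : x ∈ s.rel) : x ∈ s'.rel := by
  cases h with
  | restart => exact hx
  | next => exact hx
  | push hm => exact List.mem_append_left _ hx

theorem ExhStep.of_cur_lt {s s' : ExhState Par} (h : ExhStep I s s') (hi : s.cur < s.bound) :
    s'.cur = s.cur + 1 ∧ s'.bound = s.bound := by
  cases h with
  | restart h => omega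
  | next => exact ⟨rfl, rfl⟩
  | push hm => exact ⟨rfl, rfl⟩

theorem ExhStep.of_cur_eq {s s' : ExhState Par} (h : ExhStep I s s') (hi : s.cur = s.bound) :
    s' = s.restart := by
  cases h with
  | restart h => rfl
  | next => omega
  | push hm => omega

/-! ### Fairness of an infinite run. -/

section Run

variable {s : ℕ → ExhState Par}

theorem run_locals_prefix (hstep : ∀ t, ExhStep I (s t) (s (t + 1)))
    {t t' : ℕ} (h : t ≤ t') : (s t).locals <+: (s t').locals := by
  induction t', h using Nat.le_induction with
  | base => exact List.prefix_rfl
  | succ t' _ ih => exact ih.trans (hstep t').locals_prefix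

theorem run_rel_subset (hstep : ∀ t, ExhStep I (s t) (s (t + 1)))
    {t t' : ℕ} (h : t ≤ t') {x : ℕ × Move × ℕ} (hx : x ∈ (s t).rel) :
    x ∈ (s t').rel := by
  induction t', h using Nat.le_induction with
  | base => exact hx
  | succ t' _ ih => exact (hstep t').rel_subset ih

/-- Every local position is examined again and again. -/
theorem run_fair (hstep : ∀ t, ExhStep I (s t) (s (t + 1)))
    (hv : ∀ t, (s t).Valid) (t : ℕ) {k : ℕ} (hk : k < (s t).locals.length) :
    ∃ t', t ≤ t' ∧ (s t').cur = k ∧ k < (s t').bound ∧ (s t).locals.length ≤ (s t').bound := by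
  -- Every step inside a cycle advances `cur` and keeps `bound`, so the current cycle ends.
  have h1 : ∀ d t, (s t).bound - (s t).cur = d → ∃ t', t ≤ t' ∧ (s t').cur = (s t').bound := by
    intro d
    induction d with
    | zero => exact fun t ht => ⟨t, le_rfl, by have := (hv t).cur_le; omega⟩
    | succ d ih =>
      intro t ht
      obtain ⟨e1, e2⟩ := (hstep t).of_cur_lt (by omega)
      obtain ⟨t', h1, h2⟩ := ih (t + 1) (by omega)
      exact ⟨t', by omega, h2⟩
  obtain ⟨t₁, ht₁, he⟩ := h1 _ t rfl
  have hr := (hstep t₁).of_cur_eq he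
  have hle := (run_locals_prefix hstep ht₁).length_le
  -- The next cycle then examines in order all local positions present at its start, among them
  -- those of stage `t`.
  have h2 : ∀ j, j ≤ (s t₁).locals.length →
      (s (t₁ + 1 + j)).cur = j ∧ (s (t₁ + 1 + j)).bound = (s t₁).locals.length := by
    intro j
    induction j with
    | zero => intro _; simp [hr, ExhState.restart]
    | succ j ih =>
      intro hj
      obtain ⟨e1, e2⟩ := ih (by omega)
      obtain ⟨e3, e4⟩ := (hstep (t₁ + 1 + j)).of_cur_lt (by omega)
      rw [← add_assoc]
      exact ⟨by omega, by omega⟩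
  obtain ⟨e1, e2⟩ := h2 k (by omega)
  exact ⟨t₁ + 1 + k, by omega, e1, by omega, by omega⟩

/-- All moves of Player from a local position are explored. -/
theorem run_explores (hstep : ∀ t, ExhStep I (s t) (s (t + 1)))
    (hv : ∀ t, (s t).Valid) {t k : ℕ} {H : Game Par}
    (hH : (s t).locals[k]? = some H) (ht : H.turn [] = .player) (n : ℕ) :
    ∃ T, t ≤ T ∧ ∀ m, [m] ∈ H.positions → Encodable.encode m < n →
      ∃ l, (k, m, l) ∈ (s T).rel := by
  -- Once the moves with code below `n` are explored, take an unexplored move with code `n`. At the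
  -- next visit to `k` the first new move has code at most `n`, and not less, so it is this move.
  induction n with
  | zero => exact ⟨t, le_rfl, fun m _ h => absurd h (Nat.not_lt_zero _)⟩
  | succ n ih =>
    obtain ⟨T, hT, hexp⟩ := ih
    have hHT := getElem?_eq_some_of_prefix (run_locals_prefix hstep hT) hH
    obtain ⟨T', hT', hcur, hlt, -⟩ := run_fair hstep hv T (List.getElem?_eq_some_iff.1 hHT).1
    have hHT' := getElem?_eq_some_of_prefix (run_locals_prefix hstep hT') hHT
    refine ⟨T' + 1, by omega, fun m hm hmn => ?_⟩
    by_contra hno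
    have hno' : ∀ l, (k, m, l) ∉ (s T').rel := fun l hl => hno ⟨l, (hstep T').rel_subset hl⟩
    rcases Nat.lt_succ_iff_lt_or_eq.1 hmn with hmn | hmn
    · obtain ⟨l, hl⟩ := hexp m hm hmn
      exact hno' l (run_rel_subset hstep hT' hl)
    have hst := hstep T'
    generalize hs' : s (T' + 1) = s' at hst hno
    cases hst with
    | restart h => omega
    | next _ hsat =>
      rw [hcur] at hsat
      obtain ⟨l, hl⟩ := hsat.player_moves hHT' ht hm
      exact hno' l hl
    | push hm' hlt' hH' hfirst =>
      rw [hcur, hHT'] at hH'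
      cases hH'
      have hf := hfirst ht
      rw [hcur] at hf
      rename_i m'
      have hle := hf.2 m ⟨hm, hno'⟩
      rcases hle.lt_or_eq with h | h
      · obtain ⟨l, hl⟩ := hexp m' hm' (by omega)
        exact hf.1.2 l (run_rel_subset hstep hT' hl)
      · obtain rfl := Encodable.encode_injective h
        exact hno ⟨(s T').locals.length, by rw [ExhState.push, hcur]; simp⟩

end Run

/-- An infinite play lost by `EXH` yields a refutation. -/
theorem exists_refutation_of_branch {P : Stream' Move} (hP : P ∈ branches (EXH I Γ))
    (hlost : P ∉ (forallGame I Γ).won .player) : Nonempty (Refutation I Γ) := by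
  -- A state is bundled with the number of moves read so far and the proof that it is reached;
  -- choosing successors then yields an infinite run.
  let σ : Type _ := {x : ℕ × ExhState Par // Reached I Γ (P.take x.1) x.2}
  have hex : ∀ x : σ, ∃ y : σ, ExhStep I x.1.2 y.1.2 := by
    rintro ⟨⟨k, s⟩, hs⟩
    obtain ⟨k', s', hs', h⟩ := hs.exists_step hP
    exact ⟨⟨⟨k', s'⟩, hs'⟩, h⟩
  choose f hf using hex
  let x : ℕ → σ := fun t => Nat.rec ⟨⟨0, init Γ⟩, reached_init I Γ⟩ (fun _ y => f y) t
  let s : ℕ → ExhState Par := fun t => (x t).1.2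
  have hreach : ∀ t, Reached I Γ (P.take (x t).1.1) (s t) := fun t => (x t).2
  have hstep : ∀ t, ExhStep I (s t) (s (t + 1)) := fun t => hf (x t)
  have hv : ∀ t, (s t).Valid := fun t => (hreach t).valid
  -- At a later visit the position is either found saturated or moved from; in the latter case it is
  -- not atomic, which settles the clauses about `END` games.
  have visit : ∀ {t k : ℕ} {H : Game Par}, (s t).locals[k]? = some H →
      ∃ t', (s t').locals[k]? = some H ∧ (s t').cur = k ∧ (s t).locals <+: (s t').locals ∧
        (s t).locals.length ≤ (s t').bound ∧
        ((s t').Saturated I k ∨ ∃ m l, [m] ∈ H.positions ∧ (k, m, l) ∈ (s (t' + 1)).rel) := by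
    intro t k H hH
    obtain ⟨t', ht', hcur, hlt, hb⟩ := run_fair hstep hv t (List.getElem?_eq_some_iff.1 hH).1
    have hpre := run_locals_prefix hstep ht'
    have hH' := getElem?_eq_some_of_prefix hpre hH
    refine ⟨t', hH', hcur, hpre, hb, ?_⟩
    have hst := hstep t'
    generalize hs' : s (t' + 1) = s' at hst
    cases hst with
    | restart h => omega
    | next _ hsat => rw [hcur] at hsat; exact .inl hsat
    | push hm _ hK _ =>
      rw [hcur, hH'] at hK
      cases hK
      exact .inr ⟨_, (s t').locals.length, hm, by rw [ExhState.push, hcur]; simp⟩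
  refine ⟨{ IsLocal := fun k H => ∃ t, (s t).locals[k]? = some H
            Rel := fun k m l => ∃ t, (k, m, l) ∈ (s t).rel
            isLocal_unique := ?_
            start := fun h => ⟨0, h⟩
            rel_sub := ?_
            rel_unique := ?_
            not_isEnd_player := ?_
            not_isEnd_dual := ?_
            player_moves := ?_
            opponent_move := ?_
            won := ?_ }⟩
  · rintro k H H' ⟨t, ht⟩ ⟨t', ht'⟩
    have a1 := getElem?_eq_some_of_prefix (run_locals_prefix hstep (le_max_left t t')) ht
    have a2 := getElem?_eq_some_of_prefix (run_locals_prefix hstep (le_max_right t t')) ht'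
    simpa using a1.symm.trans a2
  · rintro k m l ⟨t, ht⟩
    obtain ⟨-, H, hm, h1, h2⟩ := (hreach t).rel_sub ht
    exact ⟨H, hm, ⟨t, h1⟩, ⟨t, h2⟩⟩
  · rintro k m l l' ⟨t, ht⟩ ⟨t', ht'⟩
    exact (hreach (max t t')).rel_unique (run_rel_subset hstep (le_max_left t t') ht)
      (run_rel_subset hstep (le_max_right t t') ht')
  · rintro k H ⟨t, ht⟩ hx
    obtain ⟨t', hH, -, -, -, hsat | ⟨m, l, hm, -⟩⟩ := visit ht
    · exact hsat.not_isEnd_player hH hx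
    · exact Game.not_isAtomic_of_mem hm hx.1
  · rintro k H l K a ha ⟨t, ht⟩ ⟨t', ht'⟩ hHa hKa
    -- Both positions exist at a common stage. At the visit that follows, the bound of the cycle
    -- covers them both, so the search for a dual partner would have succeeded.
    have a1 := getElem?_eq_some_of_prefix (run_locals_prefix hstep (le_max_left t t')) ht
    have a2 := getElem?_eq_some_of_prefix (run_locals_prefix hstep (le_max_right t t')) ht'
    obtain ⟨T, hH, -, hpre, hb, hsat | ⟨m, l, hm, -⟩⟩ := visit a1
    · exact hsat.not_isEnd_dual hH ha hHa ((List.getElem?_eq_some_iff.1 a2).1.trans_le hb)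
        (getElem?_eq_some_of_prefix hpre a2) hKa
    · exact Game.not_isAtomic_of_mem hm hHa.1
  · rintro k H m ⟨t, ht⟩ hturn hm
    obtain ⟨T, -, hT⟩ := run_explores hstep hv ht hturn (Encodable.encode m + 1)
    obtain ⟨l, hl⟩ := hT m hm (Nat.lt_succ_self _)
    exact ⟨l, T, hl⟩
  · rintro k H ⟨t, ht⟩ hna hturn
    obtain ⟨T, hH, -, -, -, hsat | ⟨m, l, -, hl⟩⟩ := visit ht
    · obtain ⟨m, l, hl⟩ := hsat.opponent_move hH hna hturn
      exact ⟨m, l, T, hl⟩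
    · exact ⟨m, l, T + 1, hl⟩
  -- An infinite chain of the record is a local play of `P`; if its branch were won by Player, so
  -- would be `P`.
  · intro i G q u hG hq hu hrel
    have hinf : InfLocalPlay Γ.length q i P := by
      refine ⟨u, hu, strictMono_nat_of_lt_succ fun k => ?_, fun k => ?_⟩
      · obtain ⟨t, ht⟩ := hrel k
        exact ((hreach t).rel_sub ht).1
      · obtain ⟨t, ht⟩ := hrel k
        obtain ⟨c, hc, h1, h2⟩ := (hreach t).rel_justifies ht
        refine ⟨c, hc, ?_, ?_⟩
        · have hlt := (List.getElem?_eq_some_iff.1 h1).1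
          rw [Stream'.length_take] at hlt
          rw [Stream'.getElem?_take hlt] at h1
          simpa using h1
        · have hlt := (List.getElem?_eq_some_iff.1 h2).1
          rw [Stream'.length_take] at hlt
          rw [Stream'.getElem?_take hlt] at h2
          simpa using h2
    have hwon := hq
    rw [← G.won_union] at hwon
    refine hwon.resolve_left fun hw => hlost ⟨fun k => EXH_subset (hP k), i, G, hG, q, hq, hinf, hw⟩

/-- If `EXH` is not a winning strategy, then there is a refutation. -/
theorem EXH_isWinning_or_refutation (I : Set Par) (Γ : List (Game Par)) :
    (forallGame I Γ).IsWinning .player (EXH I Γ) ∨ Nonempty (Refutation I Γ) := by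
  by_contra! hcon
  obtain ⟨hnot, hno⟩ := hcon
  rw [← not_nonempty_iff] at hno
  refine hnot ⟨⟨EXH_isTotal, fun r hr hl => ?_⟩, fun P hP => ?_⟩
  · obtain ⟨p, s, m, hs, hact, -, rfl | rfl⟩ := exists_active_of_mem_EXH hr
    · exact absurd hl (not_mem_leaves_of_even hs.pos hs.even)
    · cases hact with
      -- `DROP` is the only losing leaf that `EXH` can reach.
      | dropAt hi hp => exact absurd (exists_refutation_of_dropAt hs hi hp) hno
      | em => exact forallGame_label_em _ _ _
      | stopAt hH hx =>
        rw [hs.locals_eq] at hH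
        rw [forallGame_label_stopAt hs.pos hs.even hH, hx.2]
      | player_move hH hna =>
        rw [hs.locals_eq] at hH
        exact absurd hl (not_mem_leaves_of_just (EXH_subset hr) hs.even hH hna)
      | opponent_move hH hna =>
        rw [hs.locals_eq] at hH
        exact absurd hl (not_mem_leaves_of_just (EXH_subset hr) hs.even hH hna)
  · by_contra h
    exact hno (exists_refutation_of_branch hP h)

end ParamGame

namespace ParamGame

open Encodable

/-! ### Relative primitive recursion on coded types -/

theorem PrimrecIn.of_primrec {O : Set (ℕ → ℕ)} {f : ℕ → ℕ} (hf : Nat.Primrec f) :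
    PrimrecIn O f := by
  induction hf with
  | zero => exact .zero
  | succ => exact .succ
  | left => exact .left
  | right => exact .right
  | pair _ _ h1 h2 => exact .pair h1 h2
  | comp _ _ h1 h2 => exact .comp h1 h2
  | prec _ _ h1 h2 => exact .prec h1 h2

theorem PrimrecIn.primrec {O : Set (ℕ → ℕ)} (hO : ∀ f ∈ O, Nat.Primrec f) {f : ℕ → ℕ}
    (hf : PrimrecIn O f) : Nat.Primrec f := by
  induction hf with
  | oracle h => exact hO _ h
  | zero => exact .zero
  | succ => exact .succ
  | left => exact .left
  | right => exact .right
  | pair _ _ h1 h2 => exact .pair h1 h2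
  | comp _ _ h1 h2 => exact .comp h1 h2
  | prec _ _ h1 h2 => exact .prec h1 h2

/-- The map on codes of options which is `F` on codes of `some`. -/
def liftCode (F : ℕ → ℕ) (c : ℕ) : ℕ := c.rec 0 fun y _ => F y

/-- A case distinction is a recursion that ignores the previous value; the parameter of the
recursion is a dummy `0`. -/
theorem PrimrecIn.liftCode {O : Set (ℕ → ℕ)} {F : ℕ → ℕ} (hF : PrimrecIn O F) :
    PrimrecIn O (liftCode F) := by
  have h := (PrimrecIn.prec .zero (hF.comp (PrimrecIn.left.comp .right))).comp
    (PrimrecIn.pair .zero (.of_primrec (Primrec.nat_iff.1 Primrec.id)))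
  convert h using 1
  funext c
  simp only [ParamGame.liftCode, Nat.unpaired, Nat.unpair_pair, id]

/-- `f` is primitive recursive relative to the functions in `O`. -/
def PrimrecRel' (O : Set (ℕ → ℕ)) {α β : Type*} [Primcodable α] [Primcodable β] (f : α → β) :
    Prop := PrimrecIn O (codeMap f)

namespace PrimrecRel'

variable {O : Set (ℕ → ℕ)} {α β γ σ : Type*} [Primcodable α] [Primcodable β] [Primcodable γ]
  [Primcodable σ]

theorem of_primrec {f : α → β} (hf : Primrec f) : PrimrecRel' O f := PrimrecIn.of_primrec hf

theorem oracle {f : α → β} (hf : codeMap f ∈ O) : PrimrecRel' O f := PrimrecIn.oracle hf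

theorem of_eq {f g : α → β} (hf : PrimrecRel' O f) (h : ∀ a, f a = g a) : PrimrecRel' O g :=
  funext h ▸ hf

/-- `codeMap g` returns the code of an option, with `0` where its argument codes nothing. `liftCode`
removes the `some` before `codeMap f` is applied. -/
theorem comp {f : β → γ} {g : α → β} (hf : PrimrecRel' O f) (hg : PrimrecRel' O g) :
    PrimrecRel' O fun a => f (g a) := by
  have h := (PrimrecIn.liftCode hf).comp hg
  unfold PrimrecRel'
  convert h using 1
  funext n
  simp only [codeMap]
  cases hn : decode (α := α) n with
  | none => simp [ParamGame.liftCode]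
  | some a => simp [ParamGame.liftCode, codeMap]

theorem pair {f : α → β} {g : α → γ} (hf : PrimrecRel' O f) (hg : PrimrecRel' O g) :
    PrimrecRel' O fun a => (f a, g a) := by
  -- `F` turns the codes of two options into the code of an optional pair. Both are `some` or both
  -- are `none`, so testing the first suffices, and `pred` strips `some` from the second.
  let F : ℕ → ℕ := fun n =>
    Nat.casesOn n.unpair.1 0 fun x => Nat.succ (Nat.pair x n.unpair.2.pred)
  have hF : Nat.Primrec F := by
    refine Primrec.nat_iff.1 (Primrec.nat_casesOn (Primrec.fst.comp Primrec.unpair)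
      (Primrec.const 0) ?_)
    exact Primrec.succ.comp (Primrec₂.natPair.comp Primrec.snd
      (Primrec.pred.comp (Primrec.snd.comp (Primrec.unpair.comp Primrec.fst))))
  have h := (PrimrecIn.of_primrec (O := O) hF).comp (PrimrecIn.pair hf hg)
  unfold PrimrecRel'
  convert h using 1
  funext n
  simp only [codeMap, F, Nat.unpair_pair]
  cases hn : decode (α := α) n with
  | none => simp
  | some a => simp

theorem ite {c : α → Prop} [DecidablePred c] {f g : α → β} (hc : PrimrecPred c)
    (hf : PrimrecRel' O f) (hg : PrimrecRel' O g) :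
    PrimrecRel' O fun a => if c a then f a else g a := by
  have hF : Primrec fun x : α × β × β => if c x.1 then x.2.1 else x.2.2 :=
    Primrec.ite (hc.comp Primrec.fst) (Primrec.fst.comp Primrec.snd)
      (Primrec.snd.comp Primrec.snd)
  exact (of_primrec hF).comp ((of_primrec Primrec.id).pair (hf.pair hg))

theorem option_map {f : α → β} (hf : PrimrecRel' O f) : PrimrecRel' O (Option.map f) := by
  -- `F` inserts a second `some` into the code of a `some` and keeps `0`. `K` treats the argument
  -- `0`, the code of `none`, whose image has the code `1` of `some none`.
  let F : ℕ → ℕ := fun c => Nat.casesOn c 0 fun x => Nat.succ (Nat.succ x)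
  have hF : Nat.Primrec F := Primrec.nat_iff.1 (Primrec.nat_casesOn Primrec.id (Primrec.const 0)
    (Primrec.succ.comp (Primrec.succ.comp Primrec.snd)))
  let K : ℕ → ℕ := fun n => Nat.casesOn n.unpair.1 1 fun _ => n.unpair.2
  have hK : Nat.Primrec K := Primrec.nat_iff.1 (Primrec.nat_casesOn
    (Primrec.fst.comp Primrec.unpair) (Primrec.const 1)
    ((Primrec.snd.comp Primrec.unpair).comp Primrec.fst))
  have h := (PrimrecIn.of_primrec (O := O) hK).comp (PrimrecIn.pair
    (.of_primrec (Primrec.nat_iff.1 Primrec.id))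
    ((PrimrecIn.of_primrec (O := O) hF).comp
      (PrimrecIn.comp hf (.of_primrec (Primrec.nat_iff.1 Primrec.pred)))))
  unfold PrimrecRel'
  convert h using 1
  funext n
  cases n with
  | zero => simp [codeMap, K]
  | succ n =>
    simp only [codeMap, K, F, Nat.unpair_pair, decode_option_succ, id, Nat.pred_succ]
    cases hn : decode (α := α) n with
    | none => simp
    | some a => simp

/-- The recursion runs on codes of options, each step passing through `liftCode`; `Nat.pred` strips
`some` from the number of steps. Where the argument codes nothing, the starting value and the number
of steps are both `0`, and so is the result. -/
theorem iterate {n : α → ℕ} {init : α → σ} {step : σ → σ} (hn : Primrec n)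
    (hinit : PrimrecRel' O init) (hstep : PrimrecRel' O step) :
    PrimrecRel' O fun a => step^[n a] (init a) := by
  have h := (PrimrecIn.prec (O := O) (.of_primrec (Primrec.nat_iff.1 Primrec.id))
    ((PrimrecIn.liftCode hstep).comp (PrimrecIn.right.comp .right))).comp
    (PrimrecIn.pair hinit
      (PrimrecIn.comp (.of_primrec (Primrec.nat_iff.1 Primrec.pred)) (.of_primrec hn)))
  unfold PrimrecRel'
  convert h using 1
  funext c
  simp only [Nat.unpaired, Nat.unpair_pair, id, codeMap]
  cases hc : decode (α := α) c with
  | none => simp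
  | some a =>
    simp only [Option.map_some, encode_some, Encodable.encode_nat, Nat.pred_succ]
    generalize n a = k
    induction k with
    | zero => rfl
    | succ k ih =>
      simp only [← ih, Function.iterate_succ_apply']
      simp [ParamGame.liftCode, codeMap]

/-- Finitely many functions can be combined to one. -/
theorem list_lookup {ι : Type*} {φ : ι → α → β} (d : β) (l : List ι)
    (h : ∀ i ∈ l, PrimrecRel' O (φ i)) :
    PrimrecRel' O fun x : ℕ × α => (l[x.1]?).elim d fun i => φ i x.2 := by
  induction l with
  | nil => exact (of_primrec (Primrec.const d)).of_eq fun x => by simp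
  | cons i l ih =>
    have h1 : PrimrecRel' O fun x : ℕ × α => φ i x.2 :=
      (h i List.mem_cons_self).comp (of_primrec Primrec.snd)
    have h2 : PrimrecRel' O fun x : ℕ × α => (l[x.1 - 1]?).elim d fun i => φ i x.2 :=
      (ih fun j hj => h j (List.mem_cons_of_mem _ hj)).comp
        (of_primrec ((Primrec.nat_sub.comp Primrec.fst (Primrec.const 1)).pair Primrec.snd))
    refine (ite (c := fun x : ℕ × α => x.1 = 0)
      (Primrec.eq.comp Primrec.fst (Primrec.const 0)) h1 h2).of_eq ?_
    rintro ⟨_ | n, a⟩ <;> simp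

end PrimrecRel'

/-! ### A machine for `EXH` -/

theorem primrec_dropAt : Primrec Move.dropAt :=
  (Primrec.of_equiv_symm (e := Move.equivSum)).comp Primrec.sumInl

theorem primrec_em : Primrec₂ Move.em :=
  (Primrec.of_equiv_symm (e := Move.equivSum)).comp
    (Primrec.sumInr.comp (Primrec.sumInl.comp (Primrec.fst.pair Primrec.snd)))

theorem primrec_stopAt : Primrec Move.stopAt :=
  (Primrec.of_equiv_symm (e := Move.equivSum)).comp
    (Primrec.sumInr.comp (Primrec.sumInr.comp Primrec.sumInl))

theorem primrec_just : Primrec₂ Move.just :=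
  (Primrec.of_equiv_symm (e := Move.equivSum)).comp
    (Primrec.sumInr.comp (Primrec.sumInr.comp (Primrec.sumInr.comp
      (Primrec.sumInl.comp (Primrec.fst.pair Primrec.snd)))))

/-- What `EXH` has to know of a position: its label, the dual of its label if this is a parameter,
and the player who moves there. -/
abbrev PosInfo (Par : Type*) := Option (Player ⊕ Par) × Option Par × Option Player

/-- A local position is recorded as the number of a game, a position of this game, and the
information on this position. -/
abbrev PosRecord (Par : Type*) := (ℕ × List Move) × PosInfo Par

/-- The state of the machine: the numbers `i`, `p`; the local positions; the list of the first
components of the justification relation; the remaining moves of the play which is examined, or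
`none` if this play has been found not to be a play of `EXH`. -/
abbrev MachineState (Par : Type*) :=
  (ℕ × ℕ) × (List (PosRecord Par) × List ℕ) × Option (List Move)

namespace MachineState

variable {Par : Type*}

/-- The number of the current local position. -/
def cur (s : MachineState Par) : ℕ := s.1.1
/-- The end of the current cycle. -/
def bound (s : MachineState Par) : ℕ := s.1.2
/-- The records of the local positions. -/
def recs (s : MachineState Par) : List (PosRecord Par) := s.2.1.1
/-- The local positions from which a move has been made. -/
def rel (s : MachineState Par) : List ℕ := s.2.1.2
/-- The remaining moves. -/
def rest (s : MachineState Par) : Option (List Move) := s.2.2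
/-- The record of the current local position. -/
def here (s : MachineState Par) : PosRecord Par := (s.recs[s.cur]?).getD ((0, []), none, none, none)
/-- The number of moves made from the current local position. -/
def count (s : MachineState Par) : ℕ :=
  (s.rel.filterMap fun j => if j = s.cur then some j else none).length
/-- The second of the remaining moves. -/
def reply (s : MachineState Par) : Move := ((s.rest.getD []).tail.head?).getD (.nth 0)
/-- The position reached by the second of the remaining moves. -/
def target (s : MachineState Par) : List Move := s.here.1.2 ++ [s.reply]

open Classical in
/-- The first local position which is the dual of the current one. -/
noncomputable def partner (s : MachineState Par) : ℕ :=
  s.recs.findIdx fun r => decide (r.2.1 = s.here.2.2.1.map Sum.inr)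

/-- The justification move. -/
def justMove (s : MachineState Par) : Move := .just s.cur s.recs.length

/-- The only possible remaining move is `m`. -/
def term (s : MachineState Par) (m : Move) : MachineState Par :=
  (s.1, s.2.1, if s.rest = some [m] then some [] else none)

/-- A justification move has to be played; `b` says whether the second move is correct. -/
def go (s : MachineState Par) (b : Bool) (t : PosInfo Par) : MachineState Par :=
  if s.rest = some [s.justMove] then (s.1, s.2.1, some [])
  else if (s.rest.getD []).head? = some s.justMove ∧ b = true then
    ((s.cur + 1, s.bound), (s.recs ++ [((s.here.1.1, s.target), t)], s.rel ++ [s.cur]),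
      some ((s.rest.getD []).drop 2))
  else (s.1, s.2.1, none)

open Classical in
/-- The transition of the machine, given the next unexplored child of the current local position,
and whether the target is a position, and the information on it. -/
noncomputable def trans (s : MachineState Par) (a : List Move × Bool × PosInfo Par) :
    MachineState Par :=
  if s.rest = none ∨ s.rest = some [] then s
  else if ¬ s.cur < s.bound then
    if s.bound < s.recs.length then ((0, s.recs.length), s.2) else s.term (.dropAt s.recs.length)
  else if s.here.2.2.2 = some .player ∧ a.1 ≠ [] then s.go (decide (a.1 = s.target)) a.2.2
  else if s.here.2.2.2 = some .opponent ∧ s.count = 0 then s.go a.2.1 a.2.2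
  else if s.here.2.2.1.isSome = true ∧ s.partner < s.bound then s.term (.em s.cur s.partner)
  else if s.here.2.1 = some (.inl .player) then s.term (.stopAt s.cur)
  else ((s.cur + 1, s.bound), s.2)

/-! ### Primitive recursiveness of the transition. -/

variable [Primcodable Par]

theorem primrec_cur : Primrec (cur (Par := Par)) := Primrec.fst.comp Primrec.fst

theorem primrec_bound : Primrec (bound (Par := Par)) := Primrec.snd.comp Primrec.fst

theorem primrec_recs : Primrec (recs (Par := Par)) :=
  Primrec.fst.comp (Primrec.fst.comp Primrec.snd)

theorem primrec_rel : Primrec (rel (Par := Par)) :=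
  Primrec.snd.comp (Primrec.fst.comp Primrec.snd)

theorem primrec_rest : Primrec (rest (Par := Par)) := Primrec.snd.comp Primrec.snd

theorem primrec_here : Primrec (here (Par := Par)) :=
  Primrec.option_getD.comp (Primrec.list_getElem?.comp primrec_recs primrec_cur) (Primrec.const _)

theorem primrec_count : Primrec (count (Par := Par)) := by
  refine Primrec.list_length.comp (Primrec.listFilterMap primrec_rel ?_)
  exact Primrec.ite (Primrec.eq.comp Primrec.snd (primrec_cur.comp Primrec.fst))
    (Primrec.option_some.comp Primrec.snd) (Primrec.const none)

theorem primrec_moves : Primrec fun s : MachineState Par => s.rest.getD [] :=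
  Primrec.option_getD.comp primrec_rest (Primrec.const [])

theorem primrec_reply : Primrec (reply (Par := Par)) :=
  Primrec.option_getD.comp (Primrec.list_head?.comp (Primrec.list_tail.comp primrec_moves))
    (Primrec.const _)

theorem primrec_target : Primrec (target (Par := Par)) :=
  Primrec.list_concat.comp (Primrec.snd.comp (Primrec.fst.comp primrec_here)) primrec_reply

theorem primrec_dual_here : Primrec fun s : MachineState Par => s.here.2.2.1 :=
  Primrec.fst.comp (Primrec.snd.comp (Primrec.snd.comp primrec_here))

theorem primrec_turn_here : Primrec fun s : MachineState Par => s.here.2.2.2 :=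
  Primrec.snd.comp (Primrec.snd.comp (Primrec.snd.comp primrec_here))

theorem primrec_label_here : Primrec fun s : MachineState Par => s.here.2.1 :=
  Primrec.fst.comp (Primrec.snd.comp primrec_here)

theorem primrec_partner : Primrec (partner (Par := Par)) := by
  classical
  refine Primrec.list_findIdx primrec_recs (PrimrecRel.decide ?_)
  exact Primrec.eq.comp (Primrec.fst.comp (Primrec.snd.comp Primrec.snd))
    ((Primrec.option_map primrec_dual_here (Primrec.sumInr.comp Primrec.snd).to₂).comp Primrec.fst)

theorem primrec_length_recs : Primrec fun s : MachineState Par => s.recs.length :=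
  Primrec.list_length.comp primrec_recs

theorem primrec_justMove : Primrec (justMove (Par := Par)) :=
  primrec_just.comp primrec_cur primrec_length_recs

theorem primrec_singleton : Primrec fun m : Move => some [m] :=
  Primrec.option_some.comp (Primrec.list_cons.comp Primrec.id (Primrec.const []))

theorem primrec_term : Primrec₂ (term (Par := Par)) := by
  refine (Primrec.fst.comp Primrec.fst).pair ((Primrec.fst.comp (Primrec.snd.comp
    Primrec.fst)).pair (Primrec.ite ?_ (Primrec.const _) (Primrec.const _)))
  exact Primrec.eq.comp (primrec_rest.comp Primrec.fst) (primrec_singleton.comp Primrec.snd)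

theorem primrec_go :
    Primrec fun x : MachineState Par × Bool × PosInfo Par => x.1.go x.2.1 x.2.2 := by
  have keep : ∀ o : Option (List Move), Primrec fun x : MachineState Par × Bool × PosInfo Par =>
      ((x.1.1, x.1.2.1, o) : MachineState Par) := fun o =>
    (Primrec.fst.comp Primrec.fst).pair ((Primrec.fst.comp (Primrec.snd.comp
      Primrec.fst)).pair (Primrec.const o))
  refine Primrec.ite ?_ (keep _) (Primrec.ite ?_ ?_ (keep _))
  · exact Primrec.eq.comp (primrec_rest.comp Primrec.fst)
      (primrec_singleton.comp (primrec_justMove.comp Primrec.fst))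
  · refine PrimrecPred.and ?_ ?_
    · exact Primrec.eq.comp (Primrec.list_head?.comp (primrec_moves.comp Primrec.fst))
        (Primrec.option_some.comp (primrec_justMove.comp Primrec.fst))
    · exact Primrec.eq.comp (Primrec.fst.comp Primrec.snd) (Primrec.const true)
  · refine ((Primrec.succ.comp (primrec_cur.comp Primrec.fst)).pair
      (primrec_bound.comp Primrec.fst)).pair (Primrec.pair (Primrec.pair ?_ ?_) ?_)
    · exact Primrec.list_concat.comp (primrec_recs.comp Primrec.fst)
        (((Primrec.fst.comp (Primrec.fst.comp (primrec_here.comp Primrec.fst))).pair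
          (primrec_target.comp Primrec.fst)).pair (Primrec.snd.comp Primrec.snd))
    · exact Primrec.list_concat.comp (primrec_rel.comp Primrec.fst) (primrec_cur.comp Primrec.fst)
    · exact Primrec.option_some.comp (Primrec.list_drop.comp (Primrec.const 2)
        (primrec_moves.comp Primrec.fst))

set_option maxHeartbeats 1000000 in
theorem primrec_trans : Primrec₂ (trans (Par := Par)) := by
  classical
  have f : Primrec fun x : MachineState Par × (List Move × Bool × PosInfo Par) => x.1 :=
    Primrec.fst
  have a : Primrec fun x : MachineState Par × (List Move × Bool × PosInfo Par) => x.2.2.2 :=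
    Primrec.snd.comp (Primrec.snd.comp Primrec.snd)
  have hb : Primrec fun x : MachineState Par × (List Move × Bool × PosInfo Par) => x.2.2.1 :=
    Primrec.fst.comp (Primrec.snd.comp Primrec.snd)
  have hd : Primrec fun x : MachineState Par × (List Move × Bool × PosInfo Par) =>
      decide (x.2.1 = x.1.target) :=
    PrimrecPred.decide (Primrec.eq.comp (Primrec.fst.comp Primrec.snd) (primrec_target.comp f))
  have g1 : Primrec fun x : MachineState Par × (List Move × Bool × PosInfo Par) =>
      x.1.go (decide (x.2.1 = x.1.target)) x.2.2.2 := primrec_go.comp (f.pair (hd.pair a))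
  have g2 : Primrec fun x : MachineState Par × (List Move × Bool × PosInfo Par) =>
      x.1.go x.2.2.1 x.2.2.2 := primrec_go.comp (f.pair (hb.pair a))
  have hcur := primrec_cur.comp f
  have hbound := primrec_bound.comp f
  have hlen := primrec_length_recs.comp f
  refine Primrec.ite ?_ f (Primrec.ite ?_ (Primrec.ite ?_ ?_ ?_)
    (Primrec.ite ?_ ?_ (Primrec.ite ?_ ?_ (Primrec.ite ?_ ?_ (Primrec.ite ?_ ?_ ?_)))))
  · exact (Primrec.eq.comp (primrec_rest.comp f) (Primrec.const none)).or
      (Primrec.eq.comp (primrec_rest.comp f) (Primrec.const (some [])))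
  · exact (Primrec.nat_lt.comp hcur hbound).not
  · exact Primrec.nat_lt.comp hbound hlen
  · exact ((Primrec.const 0).pair hlen).pair (Primrec.snd.comp f)
  · exact primrec_term.comp f (primrec_dropAt.comp hlen)
  · exact (Primrec.eq.comp (primrec_turn_here.comp f) (Primrec.const _)).and
      (Primrec.eq.comp (Primrec.fst.comp Primrec.snd) (Primrec.const [])).not
  · exact g1
  · exact (Primrec.eq.comp (primrec_turn_here.comp f) (Primrec.const _)).and
      (Primrec.eq.comp (primrec_count.comp f) (Primrec.const 0))
  · exact g2
  · exact (Primrec.eq.comp (Primrec.option_isSome.comp (primrec_dual_here.comp f))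
      (Primrec.const true)).and (Primrec.nat_lt.comp (primrec_partner.comp f) hbound)
  · exact primrec_term.comp f (primrec_em.comp hcur (primrec_partner.comp f))
  · exact Primrec.eq.comp (primrec_label_here.comp f) (Primrec.const _)
  · exact primrec_term.comp f (primrec_stopAt.comp hcur)
  · exact ((Primrec.succ.comp hcur).pair hbound).pair (Primrec.snd.comp f)

end MachineState

/-- The parameter in a label. -/
def labelPar {Par : Type*} (l : Option (Player ⊕ Par)) : Option Par :=
  l.bind fun x => Sum.casesOn x (fun _ => none) some

theorem primrec_labelPar {Par : Type*} [Primcodable Par] : Primrec (labelPar (Par := Par)) := by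
  refine Primrec.option_bind Primrec.id ?_
  exact Primrec.sumCasesOn Primrec.snd (Primrec.const none).to₂
    (Primrec.option_some.comp Primrec.snd).to₂

/-! ### The machine with its oracles. -/

section Oracle

variable {Par : Type*} [Primcodable Par] [ParamDual Par]

/-- The information on the position `x` of `G`. -/
noncomputable def Game.info (G : Game Par) (x : List Move) : PosInfo Par :=
  (G.labelPart x, (labelPar (G.labelPart x)).map ParamDual.dual, G.turnPart x)

/-- The answers of the finitary parts of the games in `Γ`. -/
noncomputable def answers (Γ : List (Game Par)) (s : MachineState Par) :
    List Move × Bool × PosInfo Par :=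
  ((Γ[s.here.1.1]?).elim [] fun G => nthChild G.positions s.here.1.2 s.count,
    (Γ[s.here.1.1]?).elim false fun G => charFun G.positions s.target,
    (Γ[s.here.1.1]?).elim (none, none, none) fun G => G.info s.target)

/-- The step of the machine. -/
noncomputable def machineStep (Γ : List (Game Par)) (s : MachineState Par) : MachineState Par :=
  s.trans (answers Γ s)

/-- The initial state of the machine. -/
noncomputable def machineInit (Γ : List (Game Par)) (r : List Move) : MachineState Par :=
  ((0, Γ.length), (Γ.zipIdx.map fun x => ((x.2, []), x.1.info []), []), some r)

/-- A bound for the number of steps of the machine. -/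
def machineFuel (n : ℕ) (r : List Move) : ℕ := (r.length + 1) * (2 * (n + r.length) + 4)

theorem primrec_machineFuel (n : ℕ) : Primrec (machineFuel n) :=
  Primrec.nat_mul.comp (Primrec.succ.comp Primrec.list_length)
    (Primrec.nat_add.comp (Primrec.nat_mul.comp (Primrec.const 2)
      (Primrec.nat_add.comp (Primrec.const n) Primrec.list_length)) (Primrec.const 4))

variable {O : Set (ℕ → ℕ)} {Γ : List (Game Par)}

theorem Game.info_primrecRel (hdual : codeMap (ParamDual.dual : Par → Par) ∈ O) {G : Game Par}
    (hG : G.finitaryPart ⊆ O) : PrimrecRel' O G.info := by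
  have hl : PrimrecRel' O G.labelPart := .oracle (hG (by simp [Game.finitaryPart]))
  have ht : PrimrecRel' O G.turnPart := .oracle (hG (by simp [Game.finitaryPart]))
  exact hl.pair ((((PrimrecRel'.oracle hdual).option_map).comp
    ((PrimrecRel'.of_primrec primrec_labelPar).comp hl)).pair ht)

/-- `Γ` is a fixed finite list, so selecting the game to be questioned is a finite case distinction;
what happens with the answers is primitive recursive outright. -/
theorem machineStep_primrecRel (hdual : codeMap (ParamDual.dual : Par → Par) ∈ O)
    (hΓ : ∀ G ∈ Γ, G.finitaryPart ⊆ O) : PrimrecRel' O (machineStep Γ) := by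
  have hidx : Primrec fun s : MachineState Par => s.here.1.1 :=
    Primrec.fst.comp (Primrec.fst.comp MachineState.primrec_here)
  have hx : Primrec fun s : MachineState Par => s.here.1.2 :=
    Primrec.snd.comp (Primrec.fst.comp MachineState.primrec_here)
  have h1 := (PrimrecRel'.list_lookup (O := O)
    (φ := fun (G : Game Par) (x : List Move × ℕ) => nthChild G.positions x.1 x.2) [] Γ
    fun G hG => .oracle (hΓ G hG (by simp [Game.finitaryPart]))).comp
    (.of_primrec (hidx.pair (hx.pair MachineState.primrec_count)))
  have h2 := (PrimrecRel'.list_lookup (O := O)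
    (φ := fun (G : Game Par) => charFun G.positions) false Γ
    fun G hG => .oracle (hΓ G hG (by simp [Game.finitaryPart]))).comp
    (.of_primrec (hidx.pair MachineState.primrec_target))
  have h3 := (PrimrecRel'.list_lookup (O := O) (φ := Game.info (Par := Par)) (none, none, none) Γ
    fun G hG => Game.info_primrecRel hdual (hΓ G hG)).comp
    (.of_primrec (hidx.pair MachineState.primrec_target))
  exact (PrimrecRel'.of_primrec MachineState.primrec_trans).comp
    ((PrimrecRel'.of_primrec Primrec.id).pair (h1.pair (h2.pair h3)))

/-- The information on the roots of the games in `Γ` is finite and enters the initial state as a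
constant, so only the steps use oracles. -/
theorem machine_primrecRel (hdual : codeMap (ParamDual.dual : Par → Par) ∈ O)
    (hΓ : ∀ G ∈ Γ, G.finitaryPart ⊆ O) :
    PrimrecRel' O fun r => decide
      (((machineStep Γ)^[machineFuel Γ.length r] (machineInit Γ r)).rest = some []) := by
  have hinit : Primrec (machineInit Γ) :=
    (Primrec.const (0, Γ.length)).pair ((Primrec.const _).pair Primrec.option_some)
  have hout : Primrec fun s : MachineState Par => decide (s.rest = some []) :=
    (Primrec.eq.comp MachineState.primrec_rest (Primrec.const (some []))).decide
  exact (PrimrecRel'.of_primrec hout).comp (PrimrecRel'.iterate (primrec_machineFuel _)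
    (.of_primrec hinit) (machineStep_primrecRel hdual hΓ))

end Oracle

end ParamGame

namespace ParamGame

open Encodable

/-! ### Correctness of the machine -/

/-! ### Counting children and moves. -/

section NthChild

theorem finite_encode_lt (S : Set Move) (n : ℕ) : {m | m ∈ S ∧ encode m < n}.Finite :=
  ((Set.finite_lt_nat n).preimage encode_injective.injOn).subset fun _ h => h.2

/-- Of two children, the one with the larger code has strictly more siblings with smaller codes. -/
theorem IsNthChild.unique {T : Set (List Move)} {x : List Move} {n : ℕ} {m m' : Move}
    (h : IsNthChild T x n m) (h' : IsNthChild T x n m') : m = m' := by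
  have key : ∀ {m m'}, IsNthChild T x n m → IsNthChild T x n m' → ¬ encode m < encode m' := by
    intro m m' h h' hlt
    have hss : {k | x ++ [k] ∈ T ∧ encode k < encode m} ⊂
        {k | x ++ [k] ∈ T ∧ encode k < encode m'} := by
      refine ⟨fun k hk => ⟨hk.1, hk.2.trans hlt⟩, fun hsub => ?_⟩
      exact lt_irrefl _ (hsub ⟨h.1, hlt⟩).2
    have := Set.ncard_lt_ncard hss (finite_encode_lt {k | x ++ [k] ∈ T} _)
    rw [h.2, h'.2] at this
    exact lt_irrefl _ this
  exact encode_injective (le_antisymm (not_lt.1 (key h' h)) (not_lt.1 (key h h')))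

theorem nthChild_eq {T : Set (List Move)} {x : List Move} {n : ℕ} {m : Move}
    (h : IsNthChild T x n m) : nthChild T x n = x ++ [m] := by
  have hex : ∃ m, IsNthChild T x n m := ⟨m, h⟩
  rw [nthChild, dif_pos hex, hex.choose_spec.unique h]

theorem nthChild_eq_nil {T : Set (List Move)} {x : List Move} {n : ℕ}
    (h : ¬ ∃ m, IsNthChild T x n m) : nthChild T x n = [] := by
  rw [nthChild, dif_neg h]

/-- No pair of origin and move is repeated, so the entries with origin `i` correspond to the moves
made from `i`. The machine can therefore store the origins alone and still count moves. -/
theorem length_filterMap_eq_ncard {l : List (ℕ × Move × ℕ)}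
    (hl : (l.map fun x => (x.1, x.2.1)).Nodup) (i : ℕ) :
    {m | ∃ k, (i, m, k) ∈ l}.Finite ∧
    ((l.map Prod.fst).filterMap fun j => if j = i then some j else none).length =
      {m | ∃ k, (i, m, k) ∈ l}.ncard := by
  induction l with
  | nil => simp
  | cons y l ih =>
    obtain ⟨j, m, k⟩ := y
    rw [List.map_cons, List.nodup_cons] at hl
    obtain ⟨hfin, hcard⟩ := ih hl.2
    by_cases hj : j = i
    · subst hj
      have hset : {m' | ∃ k', (j, m', k') ∈ (j, m, k) :: l} =
          insert m {m' | ∃ k', (j, m', k') ∈ l} := by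
        ext m'
        simp only [List.mem_cons, Prod.mk.injEq, true_and, Set.mem_ofPred_eq, Set.mem_insert_iff]
        constructor
        · rintro ⟨k', ⟨h, -⟩ | h⟩
          · exact .inl h
          · exact .inr ⟨k', h⟩
        · rintro (h | ⟨k', h⟩)
          · exact ⟨k, .inl ⟨h, rfl⟩⟩
          · exact ⟨k', .inr h⟩
      have hnot : m ∉ {m' | ∃ k', (j, m', k') ∈ l} := by
        rintro ⟨k', hk'⟩
        exact hl.1 (List.mem_map.2 ⟨_, hk', rfl⟩)
      rw [hset, Set.ncard_insert_of_notMem hnot hfin, ← hcard]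
      exact ⟨hfin.insert m, by simp⟩
    · have hset : {m' | ∃ k', (i, m', k') ∈ (j, m, k) :: l} = {m' | ∃ k', (i, m', k') ∈ l} := by
        ext m'
        simp [Ne.symm hj]
      rw [hset]
      refine ⟨hfin, ?_⟩
      rw [← hcard]
      simp [hj]

end NthChild

variable {Par : Type*} [ParamDual Par] {I : Set Par} {Γ : List (Game Par)}

/-- Among positions, the label part is defined exactly at the leaves and the turn part exactly
elsewhere, so the stored information reveals whether a local position is atomic. -/
theorem Game.info_of_isAtomic {G : Game Par} {x : List Move} (hx : x ∈ G.positions)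
    (h : (G.sub x hx).IsAtomic) : G.info x =
      (some ((G.sub x hx).label []), (labelPar (some ((G.sub x hx).label []))).map ParamDual.dual,
        none) := by
  rw [G.isAtomic_sub_iff hx] at h
  simp [Game.info, Game.labelPart, Game.turnPart, h, Game.sub]

theorem Game.info_of_not_isAtomic {G : Game Par} {x : List Move} (hx : x ∈ G.positions)
    (h : ¬ (G.sub x hx).IsAtomic) : G.info x = (none, none, some ((G.sub x hx).turn [])) := by
  rw [G.isAtomic_sub_iff hx] at h
  simp [Game.info, Game.labelPart, Game.turnPart, h, hx, Game.sub, labelPar]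

theorem Game.info_fst_eq_some_iff {G : Game Par} {x : List Move} (hx : x ∈ G.positions)
    (y : Player ⊕ Par) : (G.info x).1 = some y ↔ (G.sub x hx).IsEnd y := by
  by_cases h : (G.sub x hx).IsAtomic
  · simp [Game.info_of_isAtomic hx h, Game.IsEnd, h]
  · simp [Game.info_of_not_isAtomic hx h, Game.IsEnd, h]

theorem Game.info_dual_eq_some_iff {G : Game Par} {x : List Move} (hx : x ∈ G.positions)
    (b : Par) : (G.info x).2.1 = some b ↔
      ∃ a, (G.sub x hx).IsEnd (.inr a) ∧ b = ParamDual.dual a := by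
  by_cases h : (G.sub x hx).IsAtomic
  · rw [Game.info_of_isAtomic hx h]
    cases hl : (G.sub x hx).label [] with
    | inl g => simp [labelPar, Game.IsEnd, hl]
    | inr a => simp [labelPar, Game.IsEnd, hl, h, eq_comm]
  · simp [Game.info_of_not_isAtomic hx h, Game.IsEnd, h]

/-- The state `t` of the machine represents the state `s` of `EXH`. -/
structure Simulates (Γ : List (Game Par)) (s : ExhState Par) (t : MachineState Par) : Prop where
  valid : s.Valid
  cur : t.cur = s.cur
  bound : t.bound = s.bound
  length : t.recs.length = s.locals.length
  rel : t.rel = s.rel.map Prod.fst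
  recs {k : ℕ} {R : PosRecord Par} : t.recs[k]? = some R →
    ∃ G : Game Par, ∃ hx : R.1.2 ∈ G.positions,
      Γ[R.1.1]? = some G ∧ s.locals[k]? = some (G.sub R.1.2 hx) ∧ R.2 = G.info R.1.2
  rel_moves {k : ℕ} {m : Move} {l : ℕ} : (k, m, l) ∈ s.rel → ∃ H : Game Par,
    s.locals[k]? = some H ∧ [m] ∈ H.positions ∧
    (H.turn [] = .player → ∀ m', [m'] ∈ H.positions → encode m' < encode m →
      ∃ l', (k, m', l') ∈ s.rel)
  nodup : (s.rel.map fun x => (x.1, x.2.1)).Nodup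

namespace Simulates

variable {s : ExhState Par} {t : MachineState Par}

theorem next (h : Simulates Γ s t) (hi : s.cur < s.bound) :
    Simulates Γ s.next ((t.cur + 1, t.bound), t.2) where
  valid := h.valid.next hi
  cur := congrArg (· + 1) h.cur
  bound := h.bound
  length := h.length
  rel := h.rel
  recs := h.recs
  rel_moves := h.rel_moves
  nodup := h.nodup

theorem restart (h : Simulates Γ s t) : Simulates Γ s.restart ((0, t.recs.length), t.2) where
  valid := s.restart_valid
  cur := rfl
  bound := h.length
  length := h.length
  rel := h.rel
  recs := h.recs
  rel_moves := h.rel_moves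
  nodup := h.nodup

/-- In a position of Player the new move is the first new one, so all moves with smaller codes have
already been made; this preserves `rel_moves`, which asks nothing about order at positions of
Opponent. -/
theorem push (h : Simulates Γ s t) (hi : s.cur < s.bound) {g : ℕ} {G : Game Par} {x : List Move}
    {hx : x ∈ G.positions} (hG : Γ[g]? = some G) (hH : s.locals[s.cur]? = some (G.sub x hx))
    {m : Move} (hm : [m] ∈ (G.sub x hx).positions) (hnew : ∀ l, (s.cur, m, l) ∉ s.rel)
    (hfirst : (G.sub x hx).turn [] = .player → IsFirstNewMove (G.sub x hx) s.cur s.rel m)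
    (o : Option (List Move)) :
    Simulates Γ (s.push _ m hm) ((t.cur + 1, t.bound),
      (t.recs ++ [((g, x ++ [m]), G.info (x ++ [m]))], t.rel ++ [t.cur]), o) where
  valid := h.valid.push hi hm
  cur := congrArg (· + 1) h.cur
  bound := h.bound
  length := by
    change (t.recs ++ [_]).length = (s.locals ++ [_]).length
    simp [h.length]
  rel := by
    change t.rel ++ [t.cur] = (s.rel ++ [(s.cur, m, s.locals.length)]).map Prod.fst
    simp [h.rel, h.cur]
  recs {k R} hR := by
    change (t.recs ++ [((g, x ++ [m]), G.info (x ++ [m]))])[k]? = some R at hR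
    change ∃ K : Game Par, ∃ hx' : R.1.2 ∈ K.positions, Γ[R.1.1]? = some K ∧
      (s.locals ++ [(G.sub x hx).sub [m] hm])[k]? = some (K.sub R.1.2 hx') ∧ R.2 = K.info R.1.2
    rcases lt_or_ge k t.recs.length with hk | hk
    · rw [List.getElem?_append_left hk] at hR
      obtain ⟨K, hx', h1, h2, h3⟩ := h.recs hR
      exact ⟨K, hx', h1, getElem?_eq_some_of_prefix (List.prefix_append _ _) h2, h3⟩
    · rw [List.getElem?_append_right hk, List.getElem?_singleton] at hR
      split_ifs at hR with hk'
      cases hR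
      refine ⟨G, hm, hG, ?_, rfl⟩
      rw [Game.sub_sub]
      have : k = s.locals.length := by rw [← h.length]; omega
      simp [this]
  rel_moves {k m' l} hmem := by
    change (k, m', l) ∈ s.rel ++ [(s.cur, m, s.locals.length)] at hmem
    rw [List.mem_append, List.mem_singleton] at hmem
    rcases hmem with hmem | hmem
    · obtain ⟨H, h1, h2, h3⟩ := h.rel_moves hmem
      refine ⟨H, getElem?_eq_some_of_prefix (List.prefix_append _ _) h1, h2, fun ht m₁ h4 h5 => ?_⟩
      obtain ⟨l', hl'⟩ := h3 ht m₁ h4 h5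
      exact ⟨l', List.mem_append_left _ hl'⟩
    · cases hmem
      refine ⟨_, getElem?_eq_some_of_prefix (List.prefix_append _ _) hH, hm,
        fun ht m₁ h4 h5 => ?_⟩
      by_contra hno
      have := (hfirst ht).2 m₁ ⟨h4, fun l hl => hno ⟨l, List.mem_append_left _ hl⟩⟩
      omega
  nodup := by
    change ((s.rel ++ [(s.cur, m, s.locals.length)]).map fun x => (x.1, x.2.1)).Nodup
    rw [List.map_append, List.nodup_append]
    refine ⟨h.nodup, by simp, ?_⟩
    intro a ha b hb hab
    obtain ⟨⟨k, m', l⟩, hy, rfl⟩ := List.mem_map.1 ha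
    simp only [List.map_cons, List.map_nil, List.mem_singleton] at hb
    rw [hb] at hab
    simp only [Prod.mk.injEq] at hab
    obtain ⟨rfl, rfl⟩ := hab
    exact hnew _ hy

theorem here_eq (h : Simulates Γ s t) (hi : s.cur < s.bound) :
    ∃ (g : ℕ) (x : List Move) (G : Game Par), ∃ hx : x ∈ G.positions,
      t.here = ((g, x), G.info x) ∧ Γ[g]? = some G ∧
      s.locals[s.cur]? = some (G.sub x hx) := by
  have hlt : t.cur < t.recs.length := by
    rw [h.cur, h.length]
    exact hi.trans_le h.valid.bound_le
  have hR : t.recs[t.cur]? = some t.here := by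
    simp [MachineState.here, List.getElem?_eq_getElem hlt]
  obtain ⟨G, hx, h1, h2, h3⟩ := h.recs hR
  rw [h.cur] at h2
  exact ⟨t.here.1.1, t.here.1.2, G, hx, by rw [← h3], h1, h2⟩

theorem count_eq (h : Simulates Γ s t) :
    {m | ∃ l, (s.cur, m, l) ∈ s.rel}.Finite ∧
      t.count = {m | ∃ l, (s.cur, m, l) ∈ s.rel}.ncard := by
  rw [MachineState.count, h.rel, h.cur]
  exact length_filterMap_eq_ncard h.nodup s.cur

/-- By `rel_moves`, the moves already made from a position of Player form an initial segment of its
children. The siblings smaller than the first new move are thus exactly the moves made, and their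
number is its index. -/
theorem isNthChild (h : Simulates Γ s t) {G : Game Par} {x : List Move} {hx : x ∈ G.positions}
    (hH : s.locals[s.cur]? = some (G.sub x hx)) (ht : (G.sub x hx).turn [] = .player) {m : Move}
    (hm : IsFirstNewMove (G.sub x hx) s.cur s.rel m) : IsNthChild G.positions x t.count m := by
  refine ⟨hm.1.1, ?_⟩
  rw [h.count_eq.2]
  congr 1
  ext m'
  constructor
  · rintro ⟨h1, h2⟩
    by_contra hno
    have := hm.2 m' ⟨h1, fun l hl => hno ⟨l, hl⟩⟩
    omega
  · rintro ⟨l, hl⟩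
    obtain ⟨H, h1, h2, h3⟩ := h.rel_moves hl
    rw [hH] at h1
    cases h1
    refine ⟨h2, ?_⟩
    by_contra hlt
    rcases (not_lt.1 hlt).lt_or_eq with hlt | heq
    · obtain ⟨l', hl'⟩ := h3 ht m hm.1.1 hlt
      exact hm.1.2 l' hl'
    · rw [encode_injective heq] at hm
      exact hm.1.2 l hl

/-- If all children have been explored, the smaller siblings of any child form a proper subset of
the moves made, so its index is less than `t.count`. -/
theorem not_isNthChild (h : Simulates Γ s t) {G : Game Par} {x : List Move}
    {hx : x ∈ G.positions} (hm : ¬ ∃ m, IsNewMove (G.sub x hx) s.cur s.rel m) :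
    ¬ ∃ m, IsNthChild G.positions x t.count m := by
  rintro ⟨m, hmx, hcard⟩
  have hall : ∀ m', x ++ [m'] ∈ G.positions → ∃ l, (s.cur, m', l) ∈ s.rel := by
    intro m' hm'
    by_contra! hno
    exact hm ⟨m', hm', hno⟩
  obtain ⟨hfin, hcount⟩ := h.count_eq
  have hss : {m' | x ++ [m'] ∈ G.positions ∧ encode m' < encode m} ⊂
      {m | ∃ l, (s.cur, m, l) ∈ s.rel} := by
    refine ⟨fun m' hm' => hall m' hm'.1, fun hsub => ?_⟩
    exact lt_irrefl _ (hsub (hall m hmx)).2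
  have := Set.ncard_lt_ncard hss hfin
  rw [hcard, hcount] at this
  exact lt_irrefl _ this

theorem count_eq_zero_iff (h : Simulates Γ s t) :
    t.count = 0 ↔ ∀ m l, (s.cur, m, l) ∉ s.rel := by
  obtain ⟨hfin, hcount⟩ := h.count_eq
  rw [hcount, Set.ncard_eq_zero hfin, Set.eq_empty_iff_forall_notMem]
  simp

theorem rec_isEnd_iff (h : Simulates Γ s t) {k : ℕ} {R : PosRecord Par} {K : Game Par}
    (hR : t.recs[k]? = some R) (hK : s.locals[k]? = some K) (y : Player ⊕ Par) :
    R.2.1 = some y ↔ K.IsEnd y := by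
  obtain ⟨G, hx, -, h2, h3⟩ := h.recs hR
  rw [hK] at h2
  cases h2
  rw [h3, Game.info_fst_eq_some_iff hx]

theorem partner_eq (h : Simulates Γ s t) {G : Game Par} {x : List Move}
    {hx : x ∈ G.positions} {g j : ℕ} (hhere : t.here = ((g, x), G.info x))
    (hj : EMClause I s.bound s.locals (G.sub x hx) j) :
    t.here.2.2.1.isSome = true ∧ t.partner = j := by
  classical
  obtain ⟨a, ha, hHa, hjp, ⟨K, hK, hKa⟩, hmin⟩ := hj
  have hd : t.here.2.2.1 = some (ParamDual.dual a) := by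
    rw [hhere]
    exact (Game.info_dual_eq_some_iff hx _).2 ⟨a, hHa, rfl⟩
  have hjl : j < t.recs.length := by
    rw [h.length]
    exact hjp.trans_le h.valid.bound_le
  refine ⟨by simp [hd], ?_⟩
  rw [MachineState.partner, hd, Option.map_some, List.findIdx_eq hjl]
  refine ⟨?_, fun j' hj' => ?_⟩
  · exact decide_eq_true <| (h.rec_isEnd_iff (List.getElem?_eq_getElem hjl) hK _).2 hKa
  · refine decide_eq_false ?_
    have hj'l : j' < s.locals.length := by
      rw [← h.length]
      exact hj'.trans hjl
    intro h'
    exact hmin j' hj' _ (List.getElem?_eq_getElem hj'l)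
      ((h.rec_isEnd_iff (List.getElem?_eq_getElem (hj'.trans hjl))
        (List.getElem?_eq_getElem hj'l) _).1 h')

/-- The machine does not test whether the parameter lies in `I`; by the hypothesis on leaf labels it
always does, so a partner found below the bound satisfies `EMClause`. -/
theorem not_partner (h : Simulates Γ s t)
    (hΓ : ∀ G ∈ Γ, ∀ x ∈ leaves G.positions, ∀ a, G.label x = .inr a → a ∈ I)
    {G : Game Par} {x : List Move} {hx : x ∈ G.positions} {g : ℕ}
    (hhere : t.here = ((g, x), G.info x)) (hG : Γ[g]? = some G)
    (hno : ¬ ∃ j, EMClause I s.bound s.locals (G.sub x hx) j) :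
    ¬ (t.here.2.2.1.isSome = true ∧ t.partner < t.bound) := by
  classical
  rintro ⟨hd, hp⟩
  obtain ⟨b, hb⟩ := Option.isSome_iff_exists.1 hd
  have hb' := hb
  rw [hhere] at hb'
  obtain ⟨a, hHa, rfl⟩ := (Game.info_dual_eq_some_iff hx _).1 hb'
  have haI : a ∈ I := by
    refine hΓ G (List.mem_of_getElem? hG) x ((G.isAtomic_sub_iff hx).1 hHa.1) a ?_
    have := hHa.2
    simpa [Game.sub] using this
  rw [h.bound] at hp
  have hpl : t.partner < t.recs.length := by
    rw [h.length]
    exact hp.trans_le h.valid.bound_le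
  have hpl' : t.partner < s.locals.length := h.length ▸ hpl
  have hspec : t.recs[t.partner].2.1 = some (.inr (ParamDual.dual a)) := by
    have := of_decide_eq_true (List.findIdx_getElem (w := hpl))
    exact this.trans (by rw [hb, Option.map_some])
  exact hno (exists_EMClause haI hHa hp (List.getElem?_eq_getElem hpl')
    ((h.rec_isEnd_iff (List.getElem?_eq_getElem hpl) (List.getElem?_eq_getElem hpl') _).1 hspec))

end Simulates

/-- A machine that has accepted or rejected stays put, so a surplus of steps is harmless. -/
theorem machineStep_of_done {t : MachineState Par} (h : t.rest = none ∨ t.rest = some [])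
    (n : ℕ) : (machineStep Γ)^[n] t = t := by
  refine Function.iterate_fixed ?_ n
  rw [machineStep, MachineState.trans, if_pos h]

theorem machine_term {t : MachineState Par} {m : Move} {r : List Move} (hr : t.rest = some r)
    (n : ℕ) : ((machineStep Γ)^[n] (t.term m)).rest = some [] ↔ r = [m] := by
  have h : (t.term m).rest = if t.rest = some [m] then some [] else none := rfl
  rw [machineStep_of_done, h, hr]
  · simp
  · rw [h]
    split_ifs <;> simp

/-- The number of steps needed by the machine. -/
def stepBound (M : ℕ) (s : ExhState Par) (r : List Move) : ℕ :=
  r.length * (2 * M + 4) + (if s.bound < s.locals.length then M + 2 else 0) + (s.bound - s.cur)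

/-- The quantity `stepBound` decreases at every transition that continues the simulation. Passing on
lowers the last summand; a new cycle exchanges `M + 2` for at most `M`; a round reads two moves and
frees twice `2 * M + 4`, which pays for the new cycle it may cause. A round also keeps
`s.locals.length + r.length` below `M`. -/
theorem machine_correct
    (hΓ : ∀ G ∈ Γ, ∀ x ∈ leaves G.positions, ∀ a, G.label x = .inr a → a ∈ I) (M n : ℕ) :
    ∀ {s : ExhState Par} {t : MachineState Par} {r : List Move}, Simulates Γ s t →
      t.rest = some r → s.locals.length + r.length ≤ M → stepBound M s r ≤ n →
      (((machineStep Γ)^[n] t).rest = some [] ↔ s.Plays I r) := by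
  induction n with
  | zero =>
    intro s t r h hr hM hn
    have hr0 : r = [] := by
      rw [← List.length_eq_zero_iff]
      by_contra hne
      have : 1 * (2 * M + 4) ≤ r.length * (2 * M + 4) := Nat.mul_le_mul_right _ (by omega)
      unfold stepBound at hn
      omega
    subst hr0
    simp [hr, h.valid.plays_nil I]
  | succ n ih =>
    intro s t r h hr hM hn
    by_cases hr0 : r = []
    · subst hr0
      rw [machineStep_of_done (.inr hr)]
      simp [hr, h.valid.plays_nil I]
    rw [Function.iterate_succ_apply]
    have hactive : ¬ (t.rest = none ∨ t.rest = some []) := by simp [hr, hr0]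
    have term : ∀ {m}, machineStep Γ t = t.term m → (∀ r, s.Plays I r ↔ r = [] ∨ r = [m]) →
        (((machineStep Γ)^[n] (machineStep Γ t)).rest = some [] ↔ s.Plays I r) := by
      intro m h1 h2
      rw [h1, machine_term hr, h2]
      simp [hr0]
    have next : s.cur < s.bound → machineStep Γ t = ((t.cur + 1, t.bound), t.2) →
        (∀ r, s.Plays I r ↔ s.next.Plays I r) →
        (((machineStep Γ)^[n] (machineStep Γ t)).rest = some [] ↔ s.Plays I r) := by
      intro hi h1 h2
      rw [h1, h2]
      refine ih (h.next hi) hr hM ?_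
      have hb : stepBound M s.next r = r.length * (2 * M + 4) +
        (if s.bound < s.locals.length then M + 2 else 0) + (s.bound - (s.cur + 1)) := rfl
      rw [hb]
      unfold stepBound at hn
      omega
    -- This treats both kinds of round together. The predicate `ok` says which second move is
    -- accepted: the first new move where Player moves, any legal move where Opponent does.
    have go : ∀ {g : ℕ} {G : Game Par} {x : List Move} {hx : x ∈ G.positions} {b : Bool}
        {ok : Move → Prop}, s.cur < s.bound →
        t.here = ((g, x), G.info x) → Γ[g]? = some G → s.locals[s.cur]? = some (G.sub x hx) →
        machineStep Γ t = t.go b (G.info t.target) → (b = true ↔ ok t.reply) →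
        (∀ m, ok m → [m] ∈ (G.sub x hx).positions ∧ (∀ l, (s.cur, m, l) ∉ s.rel) ∧
          ((G.sub x hx).turn [] = .player → IsFirstNewMove (G.sub x hx) s.cur s.rel m)) →
        (∀ r, s.Plays I r ↔ r = [] ∨ r = [.just s.cur s.locals.length] ∨
          ∃ m r', ∃ hm : [m] ∈ (G.sub x hx).positions, ok m ∧
            r = .just s.cur s.locals.length :: m :: r' ∧ (s.push _ m hm).Plays I r') →
        (((machineStep Γ)^[n] (machineStep Γ t)).rest = some [] ↔ s.Plays I r) := by
      intro g G x hx b ok hi hhere hG hH h1 hb hok hP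
      have hjust : t.justMove = .just s.cur s.locals.length := by
        rw [MachineState.justMove, h.cur, h.length]
      rw [h1, hP]
      rw [MachineState.go, hr, hjust]
      by_cases hr1 : r = [.just s.cur s.locals.length]
      · rw [if_pos (by rw [hr1]), machineStep_of_done (.inr rfl)]
        exact ⟨fun _ => .inr (.inl hr1), fun _ => rfl⟩
      rw [if_neg (by simpa using hr1)]
      obtain ⟨a, r₁, rfl⟩ := List.exists_cons_of_ne_nil hr0
      by_cases ha : a = .just s.cur s.locals.length
      swap
      · rw [if_neg (by simp [ha]), machineStep_of_done (.inl rfl)]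
        simp [ha, MachineState.rest]
      subst ha
      rcases r₁ with _ | ⟨m, r'⟩
      · exact absurd rfl hr1
      have hreply : t.reply = m := by simp [MachineState.reply, hr]
      have htarget : t.target = x ++ [m] := by rw [MachineState.target, hreply, hhere]
      rw [hreply] at hb
      by_cases hokm : ok m
      · rw [if_pos ⟨rfl, hb.2 hokm⟩]
        obtain ⟨hm, hnew, hfirst⟩ := hok m hokm
        have hsim := h.push hi hG hH hm hnew hfirst (some r')
        have hmain := ih hsim rfl (by simp [ExhState.push] at hM ⊢; omega) (by
          have hlt : s.cur < s.bound := hi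
          have h2 : (m :: r').length + 1 = r'.length + 2 := rfl
          simp only [stepBound, ExhState.push, List.length_append, List.length_cons,
            List.length_nil, Nat.add_mul] at hn hM ⊢
          have hb1 := h.valid.bound_le
          split_ifs at hn ⊢ <;> omega)
        rw [htarget, hhere]
        simp only [Option.getD_some, List.drop_succ_cons, List.drop_zero]
        rw [hmain]
        constructor
        · exact fun h' => .inr (.inr ⟨m, r', hm, hokm, rfl, h'⟩)
        · rintro (h' | h' | ⟨m', r'', hm', -, h', h''⟩)
          · simp at h'
          · simp at h'
          · simp only [List.cons.injEq, true_and] at h'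
            obtain ⟨rfl, rfl⟩ := h'
            exact h''
      · rw [if_neg (fun h' => hokm (hb.1 h'.2)), machineStep_of_done (.inl rfl)]
        constructor
        · intro h'
          simp [MachineState.rest] at h'
        · rintro (h' | h' | ⟨m', r'', hm', hok', h', -⟩)
          · simp at h'
          · simp at h'
          · simp only [List.cons.injEq, true_and] at h'
            obtain ⟨rfl, rfl⟩ := h'
            exact absurd hok' hokm
    have hstep : machineStep Γ t = t.trans (answers Γ t) := rfl
    rw [MachineState.trans, if_neg hactive, h.cur, h.bound, h.length] at hstep
    cases h.valid.action I with
    | restart hi hp hP =>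
      rw [if_pos (by omega), if_pos hp, ← h.length] at hstep
      rw [hstep, hP]
      refine ih h.restart hr hM ?_
      have := h.valid.bound_le
      simp only [stepBound, ExhState.restart, hp, if_true, lt_irrefl, if_false] at hn ⊢
      omega
    | dropAt hi hp hP =>
      rw [if_pos (by omega), if_neg (by omega)] at hstep
      exact term hstep hP
    | em hi hH hj hP =>
      rw [if_neg (by omega)] at hstep
      obtain ⟨g, x, G, hx, hhere, hG, hH'⟩ := h.here_eq hi
      obtain rfl := Option.some.inj (hH.symm.trans hH')
      obtain ⟨e1, e2⟩ := h.partner_eq hhere hj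
      have ht : t.here.2.2.2 = none := by
        rw [hhere, Game.info_of_isAtomic hx hj.isAtomic]
      have hjb : t.partner < s.bound := by
        rw [e2]
        obtain ⟨_, _, _, hjb, _⟩ := hj
        exact hjb
      rw [ht, if_neg (by simp), if_neg (by simp), if_pos ⟨e1, hjb⟩, e2] at hstep
      exact term hstep hP
    | stopAt hi hH hx' hP =>
      rw [if_neg (by omega)] at hstep
      obtain ⟨g, x, G, hx, hhere, hG, hH'⟩ := h.here_eq hi
      obtain rfl := Option.some.inj (hH.symm.trans hH')
      have ht : t.here.2.2.2 = none := by
        rw [hhere, Game.info_of_isAtomic hx hx'.1]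
      have hl : t.here.2.1 = some (.inl .player) := by
        rw [hhere]
        exact (Game.info_fst_eq_some_iff hx _).2 hx'
      have hem := h.not_partner hΓ hhere hG fun ⟨j, hj⟩ => hj.not_isEnd_inl _ hx'
      rw [h.bound] at hem
      rw [ht, if_neg (by simp), if_neg (by simp), if_neg hem, if_pos hl] at hstep
      exact term hstep hP
    | skip hi hH hat hno hx' hP =>
      rw [if_neg (by omega)] at hstep
      obtain ⟨g, x, G, hx, hhere, hG, hH'⟩ := h.here_eq hi
      obtain rfl := Option.some.inj (hH.symm.trans hH')
      have ht : t.here.2.2.2 = none := by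
        rw [hhere, Game.info_of_isAtomic hx hat]
      have hl : ¬ t.here.2.1 = some (.inl .player) := by
        rw [hhere]
        exact fun h' => hx' ((Game.info_fst_eq_some_iff hx _).1 h')
      have hem := h.not_partner hΓ hhere hG hno
      rw [h.bound] at hem
      rw [ht, if_neg (by simp), if_neg (by simp), if_neg hem, if_neg hl, ← h.cur, ← h.bound]
        at hstep
      exact next hi hstep hP
    | player_move hm hi hH hna ht hfirst hP =>
      rename_i m₀
      rw [if_neg (by omega)] at hstep
      obtain ⟨g, x, G, hx, hhere, hG, hH'⟩ := h.here_eq hi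
      obtain rfl := Option.some.inj (hH.symm.trans hH')
      have ht' : t.here.2.2.2 = some .player := by
        rw [hhere, Game.info_of_not_isAtomic hx hna, ht]
      have ha1 : (answers Γ t).1 = x ++ [m₀] := by
        simp [answers, hhere, hG, nthChild_eq (h.isNthChild hH ht hfirst)]
      have ha2 : (answers Γ t).2.2 = G.info t.target := by
        simp [answers, hhere, hG]
      rw [if_pos ⟨ht', by simp [ha1]⟩, ha1, ha2] at hstep
      refine go (ok := fun m => m = m₀) hi hhere hG hH hstep ?_ ?_ ?_
      · rw [decide_eq_true_eq, MachineState.target, hhere]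
        simp [eq_comm]
      · rintro m rfl
        exact ⟨hm, hfirst.1.2, fun _ => hfirst⟩
      · intro r
        rw [hP]
        refine or_congr_right (or_congr_right ⟨?_, ?_⟩)
        · rintro ⟨r', h1, h2⟩
          exact ⟨m₀, r', hm, rfl, h1, h2⟩
        · rintro ⟨_, r', _, rfl, h1, h2⟩
          exact ⟨r', h1, h2⟩
    | player_skip hi hH hna ht hno hP =>
      rw [if_neg (by omega)] at hstep
      obtain ⟨g, x, G, hx, hhere, hG, hH'⟩ := h.here_eq hi
      obtain rfl := Option.some.inj (hH.symm.trans hH')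
      have hinfo : t.here.2 = (none, none, some .player) := by
        rw [hhere, Game.info_of_not_isAtomic hx hna, ht]
      have ha1 : (answers Γ t).1 = [] := by
        simp [answers, hhere, hG, nthChild_eq_nil (h.not_isNthChild hno)]
      rw [ha1, hinfo, if_neg (by simp), if_neg (by simp), if_neg (by simp), if_neg (by simp),
        ← h.cur, ← h.bound] at hstep
      exact next hi hstep hP
    | opponent_move hi hH hna ht hJ hP =>
      rw [if_neg (by omega)] at hstep
      obtain ⟨g, x, G, hx, hhere, hG, hH'⟩ := h.here_eq hi
      obtain rfl := Option.some.inj (hH.symm.trans hH')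
      have hJ' : ∀ m l, (s.cur, m, l) ∉ s.rel := by
        intro m l hl
        obtain ⟨H', h1, h2, -⟩ := h.rel_moves hl
        rw [hH] at h1
        cases h1
        exact hJ m h2 l hl
      have ht' : t.here.2.2.2 = some .opponent := by
        rw [hhere, Game.info_of_not_isAtomic hx hna, ht]
      have ha2 : (answers Γ t).2.2 = G.info t.target := by
        simp [answers, hhere, hG]
      rw [if_neg (by simp [ht']), if_pos ⟨ht', h.count_eq_zero_iff.2 hJ'⟩, ha2] at hstep
      refine go (ok := fun m => [m] ∈ (G.sub x hx).positions) hi hhere hG hH hstep ?_ ?_ ?_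
      · rw [show (answers Γ t).2.1 = charFun G.positions t.target by simp [answers, hhere, hG],
          charFun, MachineState.target, hhere]
        exact @decide_eq_true_iff _ (_)
      · exact fun m hm => ⟨hm, hJ' m, fun h' => by rw [ht] at h'; cases h'⟩
      · intro r
        rw [hP]
        refine or_congr_right (or_congr_right ⟨?_, ?_⟩)
        · rintro ⟨m, r', hm, h1, h2⟩
          exact ⟨m, r', hm, hm, h1, h2⟩
        · rintro ⟨m, r', hm, -, h1, h2⟩
          exact ⟨m, r', hm, h1, h2⟩
    | opponent_skip hi hH hna ht hJ hP =>
      rw [if_neg (by omega)] at hstep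
      obtain ⟨g, x, G, hx, hhere, hG, hH'⟩ := h.here_eq hi
      obtain rfl := Option.some.inj (hH.symm.trans hH')
      have hinfo : t.here.2 = (none, none, some .opponent) := by
        rw [hhere, Game.info_of_not_isAtomic hx hna, ht]
      have hc : ¬ t.count = 0 := by
        rw [h.count_eq_zero_iff]
        obtain ⟨m, -, l, hl⟩ := hJ
        exact fun h' => h' m l hl
      rw [hinfo, if_neg (by simp), if_neg (by simp [hc]), if_neg (by simp), if_neg (by simp),
        ← h.cur, ← h.bound] at hstep
      exact next hi hstep hP

theorem simulates_init (Γ : List (Game Par)) (r : List Move) :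
    Simulates Γ (ExhState.init Γ) (machineInit Γ r) where
  valid := ⟨Nat.zero_le _, le_rfl⟩
  cur := rfl
  bound := rfl
  length := by simp [machineInit, ExhState.init, MachineState.recs]
  rel := rfl
  recs {k R} hR := by
    change (Γ.zipIdx.map fun x => ((x.2, []), x.1.info []))[k]? = some R at hR
    rw [List.getElem?_map, Option.map_eq_some_iff] at hR
    obtain ⟨⟨G, j⟩, hG, rfl⟩ := hR
    rw [List.getElem?_zipIdx, Option.map_eq_some_iff] at hG
    obtain ⟨G', hG', heq⟩ := hG
    cases heq
    refine ⟨G, G.nil_mem, by simpa using hG', ?_, rfl⟩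
    rw [Game.sub_nil]
    exact hG'
  rel_moves h := by simp [ExhState.init] at h
  nodup := by simp [ExhState.init]

/-! ### Primitive recursiveness of the strategy. -/

variable [Primcodable Par]

/-- `EXH` is primitive recursive relative to the finitary parts of the games. -/
theorem EXH_primrecRelTo
    (hΓ : ∀ G ∈ Γ, ∀ x ∈ leaves G.positions, ∀ a, G.label x = .inr a → a ∈ I) :
    PrimrecRelTo Γ (EXH I Γ) := by
  have h := machine_primrecRel (Γ := Γ)
    (O := {codeMap (ParamDual.dual : Par → Par)} ∪ {f | ∃ G ∈ Γ, f ∈ G.finitaryPart})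
    (.inl rfl) fun G hG f hf => .inr ⟨G, hG, hf⟩
  refine PrimrecRel'.of_eq h fun r => ?_
  -- Initially the bound equals the number of local positions, so with `M = Γ.length + r.length` the
  -- required number of steps is `r.length * (2 * M + 4) + Γ.length`, which `machineFuel` exceeds.
  have hcorr := machine_correct hΓ (Γ.length + r.length) (machineFuel Γ.length r)
    (simulates_init Γ r) (r := r) rfl le_rfl (by
      simp only [stepBound, machineFuel, ExhState.init, lt_irrefl, if_false, Nat.add_mul]
      omega)
  rw [charFun, decide_eq_decide, hcorr]
  rfl

theorem EXH_primrec
    (hΓ : ∀ G ∈ Γ, ∀ x ∈ leaves G.positions, ∀ a, G.label x = .inr a → a ∈ I)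
    (hdual : Primrec (ParamDual.dual : Par → Par)) (hfin : ∀ G ∈ Γ, G.PrimrecFinitary) :
    Primrec (charFun (EXH I Γ)) := by
  refine PrimrecIn.primrec ?_ (EXH_primrecRelTo hΓ)
  rintro f (rfl | ⟨G, hG, hf⟩)
  · exact hdual
  · obtain ⟨h1, h2, h3, h4, h5⟩ := hfin G hG
    rcases hf with rfl | rfl | rfl | rfl | rfl
    exacts [h1, h2, h3, h4, h5]

end ParamGame

/-! ### The main theorem. -/

theorem mainTheorem5 {Par : Type*} [Primcodable Par] [ParamDual Par]
    (I : Set Par) (hI : SelfDual I) (Γ : List (Game Par))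
    (ρ : Par → Option Player) (hρ : IsGameAssignment (forallGame I Γ) ρ) :
    ((forallGame I Γ).assign ρ).Determined ∧
    ((∀ η, IsAssignment I η → ∀ G ∈ Γ, (G.assign (overwrite ρ η)).Determined) →
      List.TFAE [
        ∃ σ, ((forallGame I Γ).assign ρ).IsWinning .player σ,
        ((forallGame I Γ).assign ρ).IsWinning .player (EXH I (closedSequent I Γ ρ)) ∧
          PrimrecRelTo (closedSequent I Γ ρ) (EXH I (closedSequent I Γ ρ)) ∧
          (Primrec (ParamDual.dual : Par → Par) →
            (∀ G ∈ closedSequent I Γ ρ, G.PrimrecFinitary) →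
            Primrec (charFun (EXH I (closedSequent I Γ ρ)))),
        ∀ η, IsAssignment I η → ∃ G ∈ Γ, ∃ σ,
          (G.assign (overwrite ρ η)).IsWinning .player σ]) := by
  have hsim := forallGame_assign_similar hI hρ
  have hclosed : ∀ G ∈ closedSequent I Γ ρ, ∀ x ∈ leaves G.positions, ∀ a,
      G.label x = .inr a → a ∈ I := fun G hG x hx a ha => closedSequent_label hρ hG hx ha
  have hcombine : ∀ {η}, IsAssignment I η →
      (∀ G ∈ Γ, ∃ σ, (G.assign (overwrite ρ η)).IsWinning .opponent σ) →
      ∃ τ, ((forallGame I Γ).assign ρ).IsWinning .opponent τ := by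
    intro η hη h
    obtain ⟨τ, hτ⟩ := exists_isWinning_opponent_forallGame (Γ := closedSequent I Γ ρ) hη (by
      intro G hG
      obtain ⟨G, hG', rfl⟩ := List.mem_map.1 hG
      obtain ⟨σ, hσ⟩ := h G hG'
      exact ⟨σ, (assign_overwrite_similar hI hρ hη hG').isWinning hσ⟩)
    exact ⟨τ, hsim.symm.isWinning hτ⟩
  -- The dichotomy, carried from the closed games back to `ρ` and `(ρ, η)`; no determinacy is
  -- assumed here.
  have hEXH : ((forallGame I Γ).assign ρ).IsWinning .player (EXH I (closedSequent I Γ ρ)) ∨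
      ∃ η, IsAssignment I η ∧
        ∀ G ∈ Γ, ∃ σ, (G.assign (overwrite ρ η)).IsWinning .opponent σ := by
    refine (EXH_isWinning_or_refutation I (closedSequent I Γ ρ)).imp hsim.symm.isWinning ?_
    rintro ⟨R⟩
    have hη := R.assignment_isAssignment hI
    refine ⟨R.assignment, hη, fun G hG => ?_⟩
    obtain ⟨i, hi⟩ := List.getElem?_of_mem hG
    exact ⟨R.strategy i, (assign_overwrite_similar hI hρ hη hG).symm.isWinning
      (R.isWinning_strategy hclosed (by simp [closedSequent, hi]))⟩
  refine ⟨?_, fun hdet => ?_⟩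
  · rcases hEXH with h | ⟨η, hη, h⟩
    · exact ⟨_, _, h⟩
    · obtain ⟨τ, hτ⟩ := hcombine hη h
      exact ⟨_, τ, hτ⟩
  · tfae_have 2 → 1 := fun h => ⟨_, h.1⟩
    tfae_have 1 → 3 := by
      rintro ⟨σ, hσ⟩ η hη
      by_contra! hno
      -- Only here is determinacy of the given games used: it turns the absence of winning
      -- strategies of Player into winning strategies of Opponent.
      obtain ⟨τ, hτ⟩ := hcombine hη fun G hG => by
        obtain ⟨g, τ, hτ⟩ := hdet η hη G hG
        rcases Player.eq_player_or_opponent g with rfl | rfl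
        · exact absurd hτ (hno G hG τ)
        · exact ⟨τ, hτ⟩
      exact Game.not_isWinning_both _ hσ hτ
    tfae_have 3 → 2 := by
      intro h
      refine ⟨hEXH.resolve_right ?_, EXH_primrecRelTo hclosed, EXH_primrec hclosed⟩
      rintro ⟨η, hη, hopp⟩
      obtain ⟨G, hG, σ, hσ⟩ := h η hη
      obtain ⟨τ, hτ⟩ := hopp G hG
      exact Game.not_isWinning_both _ hσ hτ
    tfae_finish
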